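/- Let $E:\mathbb R\to\mathbb R$ be even and Lipschitz with support $[-1,1]$, non-increasing on $[0,\infty)$, with $E(0)=1$; let $E,E',E''$ be absolutely continuous and let $E'''$ be of bounded variation (equivalently, $E$ is $C^2$ and $E''$ is the indefinite integral of a function of bounded variation). For $\lambda>0$ put $E^\lambda(\nu)=E(\nu/\lambda)$, $$\hat E^\lambda(t)=\int_{-\infty}^{\infty}E^\lambda(\nu)e^{-i\nu t}\,d\nu=\int_{-\infty}^\infty E^\lambda(\nu)\cos(t\nu)\,d\nu,\qquad M^\lambda(z)=\frac1\pi\int_0^\infty \hat E^\lambda(t)\,t^{-z}\,dt .$$ Suppose that $\hat E^\lambda(t)\ge 0$ for all real $t$, and let $s$ be real with $1/2<s<1$. Then for all complex (non-real) zeros $\rho,\rho'$ of the Riemann zeta function the integral for $M^\lambda(\rho+\rho'-2s)$ converges absolutely; and the double sum over pairs of complex zeros, repeated according to multiplicity, $$\Sigma_2^\lambda(s)=\lim_{R\to\infty}\ \sum_{|\mathrm{Im}\,\rho|<R,\ |\mathrm{Im}\,\rho'|<R}\Gamma(\rho-s)\,\Gamma(\rho'-s)\,M^\lambda(\rho+\rho'-2s)\,\cos\{\pi(\rho-\rho')/2\}$$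 exists (as a limit of square partial sums), is real, and satisfies $$\Sigma_2^\lambda(s)\ge 0 .$$ Moreover the assumptions hold for the Jackson function $E=E_J$ and every $\lambda>0$, where $E_J(x)=1-6x^2+6|x|^3$ for $|x|\le\frac12$, $E_J(x)=2(1-|x|)^3$ for $\frac12\le|x|\le1$, and $E_J(x)=0$ for $|x|\ge1$: it has all the properties required of $E$ above, and $\hat E_J^\lambda(t)\ge0$ for all real $t$. -/

import Mathlib

open Filter Topology

/-- A smooth sieving function: even, Lipschitz, with support `[-1, 1]`, non-increasing on `[0, ∞)`,
`E 0 = 1`, and such that `E`, `E'`, `E''` are absolutely continuous with `E'''` of bounded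
variation.  As `E'''` is in general defined only almost everywhere, the last condition says that
`E` is `C²` and that `E''` is the indefinite integral of a function `g` of bounded variation. -/
structure IsSmoothSievingFunction (E : ℝ → ℝ) : Prop where
  even : ∀ x, E (-x) = E x
  support_eq : tsupport E = Set.Icc (-1) 1
  lipschitz : ∃ K, LipschitzWith K E
  antitone : AntitoneOn E (Set.Ici 0)
  apply_zero : E 0 = 1
  contDiff : ContDiff ℝ 2 E
  third_deriv_bv : ∃ g : ℝ → ℝ, BoundedVariationOn g Set.univ ∧
    ∀ x y : ℝ, iteratedDeriv 2 E y - iteratedDeriv 2 E x = ∫ t in x..y, g t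

/-- The Fourier transform `∫ E(ν/λ) exp(-iνt) dν` of `E^λ(ν) = E(ν/λ)`.  Since `E` is even, the
imaginary part vanishes, and the transform is the cosine integral. -/
noncomputable def sieveFourier (E : ℝ → ℝ) (lam t : ℝ) : ℝ :=
  ∫ ν : ℝ, E (ν / lam) * Real.cos (t * ν)

/-- `M^λ(z) = π⁻¹ ∫₀^∞ Ê^λ(t) t^(-z) dt`, written with the Mellin transform
`mellin f w = ∫₀^∞ t^(w-1) f(t) dt`.  For a smooth sieving function the integral converges
absolutely, and is holomorphic in `z`, on the strip `-3 < Re z < 1`. -/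
noncomputable def sieveMellin (E : ℝ → ℝ) (lam : ℝ) (z : ℂ) : ℂ :=
  (1 / (Real.pi : ℂ)) * mellin (fun t : ℝ => (sieveFourier E lam t : ℂ)) (1 - z)

/-- The complex (that is, non-real) zeros of the Riemann zeta function. -/
def complexZetaZeros : Set ℂ := {ρ | riemannZeta ρ = 0 ∧ ρ.im ≠ 0}

theorem complexZetaZeros_re_mem {ρ : ℂ} (h : ρ ∈ complexZetaZeros) : ρ.re ∈ Set.Ioo (0 : ℝ) 1 := by
  obtain ⟨h0, him⟩ := h
  refine ⟨?_, ?_⟩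
  · by_contra! hre
    have h1 : 1 ≤ (1 - ρ).re := by simpa using hre
    have hs : ∀ n : ℕ, 1 - ρ ≠ -n := fun n hn => him (by
      have := congrArg Complex.im hn
      simpa using this)
    have hs' : 1 - ρ ≠ 1 := fun hn => him (by
      have := congrArg Complex.im hn
      simpa using this)
    have key := riemannZeta_one_sub hs hs'
    rw [sub_sub_cancel, h0] at key
    have hc : Complex.cos (Real.pi * (1 - ρ) / 2) ≠ 0 := by
      rw [Complex.cos_ne_zero_iff]
      intro k hk
      have := congrArg Complex.im hk
      have e : ((2 * (k : ℂ) + 1) * Real.pi / 2).im = 0 := by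
        have : (2 * (k : ℂ) + 1) * Real.pi / 2 = (((2 * (k : ℝ) + 1) * Real.pi / 2 : ℝ) : ℂ) := by
          push_cast; ring
        rw [this, Complex.ofReal_im]
      rw [e] at this
      have e2 : (Real.pi * (1 - ρ) / 2 : ℂ) = ((Real.pi / 2 : ℝ) : ℂ) * (1 - ρ) := by
        push_cast; ring
      rw [e2, Complex.im_ofReal_mul] at this
      simp [Real.pi_ne_zero, him] at this
    have hz := riemannZeta_ne_zero_of_one_le_re h1
    have hG := Complex.Gamma_ne_zero hs
    have hp : (2 * (Real.pi : ℂ)) ^ (-(1 - ρ)) ≠ 0 := by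
      rw [Complex.cpow_ne_zero_iff]
      left
      simp [Real.pi_ne_zero]
    exact (mul_ne_zero (mul_ne_zero (mul_ne_zero (mul_ne_zero two_ne_zero hp) hG) hc) hz) key.symm
  · by_contra! hre
    exact riemannZeta_ne_zero_of_one_le_re hre h0

theorem finite_complexZetaZeros_im_lt (R : ℝ) :
    {ρ : ℂ | ρ ∈ complexZetaZeros ∧ |ρ.im| < R}.Finite := by
  have hK : IsCompact (Set.Icc (0 : ℝ) 1 ×ℂ Set.Icc (-R) R) := isCompact_Icc.reProdIm isCompact_Icc
  refine hK.inter_riemannZetaZeros_finite.subset ?_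
  rintro ρ ⟨hρ, hR⟩
  have := complexZetaZeros_re_mem hρ
  refine ⟨⟨⟨this.1.le, this.2.le⟩, (abs_le.1 hR.le)⟩, hρ.1⟩

/-- The complex zeros `ρ` of zeta with `|Im ρ| < R`, each listed once. -/
noncomputable def zetaZerosBelow (R : ℝ) : Finset ℂ := (finite_complexZetaZeros_im_lt R).toFinset

/-- The multiplicity of a zero of zeta. -/
noncomputable def zetaMult (ρ : ℂ) : ℕ := analyticOrderNatAt riemannZeta ρ

/-- The term `Γ(ρ-s) Γ(ρ'-s) M^λ(ρ+ρ'-2s) cos(π(ρ-ρ')/2)` of the double series. -/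
noncomputable def sigmaTwoTerm (E : ℝ → ℝ) (lam s : ℝ) (ρ ρ' : ℂ) : ℂ :=
  Complex.Gamma (ρ - s) * Complex.Gamma (ρ' - s) * sieveMellin E lam (ρ + ρ' - 2 * s) *
    Complex.cos (Real.pi * (ρ - ρ') / 2)

/-- The square partial sum over the pairs of complex zeros with `|Im ρ|, |Im ρ'| < R`, taking
multiplicities into account. -/
noncomputable def sigmaTwoPartial (E : ℝ → ℝ) (lam s R : ℝ) : ℂ :=
  ∑ ρ ∈ zetaZerosBelow R, ∑ ρ' ∈ zetaZerosBelow R,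
    (zetaMult ρ : ℂ) * (zetaMult ρ' : ℂ) * sigmaTwoTerm E lam s ρ ρ'

/-- The double sum `Σ₂^λ(s)` converges, as a limit of square partial sums, to `L`. -/
def HasSigmaTwo (E : ℝ → ℝ) (lam s : ℝ) (L : ℂ) : Prop :=
  Tendsto (fun R : ℝ => sigmaTwoPartial E lam s R) atTop (𝓝 L)

/-- The basic function `E_J` of the Jackson kernel sieve `E_J^λ(ν) = E_J(ν/λ)`. -/
noncomputable def jacksonE (x : ℝ) : ℝ :=
  if |x| ≤ 1 / 2 then 1 - 6 * x ^ 2 + 6 * |x| ^ 3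
  else if |x| ≤ 1 then 2 * (1 - |x|) ^ 3
  else 0

/-!
Write `Ê` for the Fourier transform of the sieving function and put
`A_R(t) = ∑ Γ(ρ - s) exp (iπ(ρ - s)/2) t ^ (s - ρ)`, the sum over the complex zeros with
`|Im ρ| < R` (`zeroSum`).  The zeros are closed under conjugation, so that expanding `|A_R|²`,
pairing `ρ'` with its conjugate and symmetrising in `ρ, ρ'` shows that the square partial sum of
`Σ₂` is `π⁻¹ ∫₀^∞ Ê(t) |A_R(t)|² dt` (`sigmaTwoPartial_eq_integral`).  With `Ê ≥ 0` it is
therefore real and non-negative, and what remains is its convergence.  Since `Ê(t) ≪ (1 + t)⁻³`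
(`exists_abs_integral_mul_cos_le`), it suffices that `A_R` converges in `L²((1 + t)⁻³ dt)`, which is
`l2Converges_zeroSum`.

For this the sharp truncation is replaced by an entire function `smoothCutoff R`, which is close to
the indicator function of `|Im u| < R` except near `|Im u| = R`.  By Stirling's bound the term of
`ρ` has norm `≪ |Im ρ| ^ (1/2 - s)`, and there are `O(log T)` zeros in a unit window, so the
replacement costs `o(1)` (`exists_sum_zeros_transition_le`).  The smoothed sum is a contour integral
of `ζ'/ζ (u) Γ(u - s) exp (iπ(u - s)/2) t ^ (s - u)` times the cutoff
(`exists_l2Converges_tendsto_smoothed_sum`).  On the left edge and on the horizontal pieces the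
integral converges absolutely, and the limit in `L²` is immediate
(`l2Converges_integral_smoothCutoff`).  On the right edge the Dirichlet series of `ζ'/ζ` may be
integrated term by term (`integrable_and_hasSum_right_line`), and yields the trigonometric series
`∑ Λ(n) n⁻ˢ exp (i n t)` with the exponentials replaced by `smoothedExp s R (n t)`.  As `s > 1/2`
the coefficients are square-summable, and such series converge in the weighted `L²` space by
periodicity; the smoothing is removed by Fourier inversion for small `n` and by Schur's test for
large `n` (`l2Converges_sum_smoothedExp`).

Landau's lemma on `ζ'/ζ` (`norm_logDeriv_sub_sum_le`) and the residue theorem on rectangles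
(`rectIntegral_logDeriv_mul`) are proved here in the form needed.  The Jackson function is a cubic
B-spline, with Fourier transform `48 (1 - cos (t/2))² / t⁴` (`integral_jacksonE_mul_cos`).
-/

/-! ### Stirling's bound for the Gamma function -/

theorem Complex.norm_Gamma_le_Gamma_re {z : ℂ} (hz : 0 < z.re) :
    ‖Complex.Gamma z‖ ≤ Real.Gamma z.re := by
  rw [Complex.Gamma_eq_integral hz, Real.Gamma_eq_integral hz, Complex.GammaIntegral]
  refine (MeasureTheory.norm_integral_le_integral_norm _).trans (le_of_eq ?_)
  refine MeasureTheory.setIntegral_congr_fun measurableSet_Ioi fun t ht => ?_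
  have ht' : (0 : ℝ) < t := ht
  simp only [norm_mul, Complex.norm_real, Real.norm_eq_abs, abs_of_pos (Real.exp_pos _)]
  rw [Complex.norm_cpow_eq_rpow_re_of_pos ht']
  simp

/-- By the reflection formula `|Γ(1/2 + iy)|² = π / cosh (π y)`. -/
theorem Complex.norm_Gamma_le_of_re_eq_half {z : ℂ} (hz : z.re = 1 / 2) :
    ‖Complex.Gamma z‖ ≤ √(2 * Real.pi) * Real.exp (-(Real.pi * |z.im| / 2)) := by
  have h1 : (1 : ℂ) - z = (starRingEnd ℂ) z := by
    apply Complex.ext <;> simp [hz]; norm_num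
  have h2 := Complex.Gamma_mul_Gamma_one_sub z
  rw [h1, Complex.Gamma_conj, Complex.mul_conj, Complex.normSq_eq_norm_sq] at h2
  have h3 : Complex.sin (Real.pi * z) = ((Real.cosh (Real.pi * z.im) : ℝ) : ℂ) := by
    have : (Real.pi : ℂ) * z = Real.pi / 2 + (Real.pi * z.im : ℝ) * Complex.I := by
      apply Complex.ext <;> simp [hz]; ring
    rw [this, add_comm, Complex.sin_add_pi_div_two, Complex.cos_mul_I, Complex.ofReal_cosh]
  rw [h3] at h2
  have h4 : ‖Complex.Gamma z‖ ^ 2 = Real.pi / Real.cosh (Real.pi * z.im) := by exact_mod_cast h2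
  have h5 : Real.exp (Real.pi * |z.im|) / 2 ≤ Real.cosh (Real.pi * z.im) := by
    rw [← Real.cosh_abs, abs_mul, abs_of_pos Real.pi_pos, Real.cosh_eq]
    have := Real.exp_pos (-(Real.pi * |z.im|))
    linarith
  refine abs_le_of_sq_le_sq' ?_ (by positivity) |>.2
  rw [h4, mul_pow, Real.sq_sqrt (by positivity), ← Real.exp_nat_mul]
  calc Real.pi / Real.cosh (Real.pi * z.im) ≤ Real.pi / (Real.exp (Real.pi * |z.im|) / 2) := by
        gcongr
    _ = 2 * Real.pi * Real.exp (((2 : ℕ) : ℝ) * -(Real.pi * |z.im| / 2)) := by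
        rw [show ((2 : ℕ) : ℝ) * -(Real.pi * |z.im| / 2) = -(Real.pi * |z.im|) by push_cast; ring,
          Real.exp_neg]
        field_simp

/-- In the right half-plane the argument of `z` is `± π / 2` up to `Re z / |Im z|`. -/
theorem Complex.le_arg_mul_im {z : ℂ} (hz : 0 < z.re) :
    Real.pi * |z.im| / 2 - z.re ≤ z.arg * z.im := by
  have key : ∀ w : ℂ, 0 < w.re → 0 < w.im → Real.pi * |w.im| / 2 - w.re ≤ w.arg * w.im := by
    intro w hw hi
    have h1 : 0 < w.arg := by
      rcases (Complex.arg_nonneg_iff.2 hi.le).lt_or_eq with h | h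
      · exact h
      · exact absurd (Complex.arg_eq_zero_iff.1 h.symm).2 hi.ne'
    have h2 : w.arg < Real.pi / 2 := by
      have := Complex.abs_arg_lt_pi_div_two_iff.2 (Or.inl hw)
      exact (abs_lt.1 this).2
    have h3 := (Real.lt_tan (x := Real.pi / 2 - w.arg) (by linarith) (by linarith)).le
    rw [Real.tan_pi_div_two_sub, Complex.tan_arg, inv_div, le_div_iff₀ hi] at h3
    rw [abs_of_pos hi]
    nlinarith
  rcases lt_trichotomy z.im 0 with h | h | h
  · have := key ((starRingEnd ℂ) z) (by simpa) (by simpa)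
    rw [Complex.arg_conj, if_neg] at this
    · simpa using this
    · intro h'
      rw [Complex.arg_eq_pi_iff] at h'
      linarith
  · simp [h, hz.le]
  · exact key z hz h

theorem Complex.arg_mul_im_le {z : ℂ} (hz : 0 ≤ z.re) : z.arg * z.im ≤ Real.pi * |z.im| / 2 := by
  calc z.arg * z.im ≤ |z.arg| * |z.im| := by rw [← abs_mul]; exact le_abs_self _
    _ ≤ Real.pi / 2 * |z.im| := by
        gcongr; exact Complex.abs_arg_le_pi_div_two_iff.2 hz
    _ = _ := by ring

theorem Complex.norm_cpow_half_sub {z : ℂ} (hz : z ≠ 0) :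
    ‖z ^ (1 / 2 - z)‖ = ‖z‖ ^ (1 / 2 - z.re) * Real.exp (z.arg * z.im) := by
  rw [Complex.norm_cpow_of_ne_zero hz]
  have h1 : (1 / 2 - z).re = 1 / 2 - z.re := by simp
  have h2 : (1 / 2 - z).im = -z.im := by simp
  rw [h1, h2, div_eq_mul_inv, ← Real.exp_neg]
  ring_nf

/-- Phragmén–Lindelöf for `Γ(z) z^(1/2 - z)` between the lines `Re z = 1/2` and `Re z = 3/2`, where
the reflection formula gives the exact size of `Γ`. -/
theorem Complex.norm_Gamma_mul_cpow_le {z : ℂ} (h1 : 1 / 2 ≤ z.re) (h2 : z.re ≤ 3 / 2) :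
    ‖Complex.Gamma z * z ^ (1 / 2 - z)‖ ≤ √(2 * Real.pi) := by
  have hsq : (0 : ℝ) ≤ √(2 * Real.pi) := Real.sqrt_nonneg _
  refine PhragmenLindelof.vertical_strip (a := 1 / 2) (b := 3 / 2)
    (f := fun z => Complex.Gamma z * z ^ (1 / 2 - z)) ?_ ?_ ?_ ?_ h1 h2
  · apply DifferentiableOn.diffContOnCl
    intro w hw
    have hw' : w.re ∈ Set.Icc (1 / 2 : ℝ) (3 / 2) := by
      have : closure (Complex.re ⁻¹' Set.Ioo (1 / 2 : ℝ) (3 / 2)) ⊆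
          Complex.re ⁻¹' Set.Icc (1 / 2 : ℝ) (3 / 2) :=
        closure_minimal (Set.preimage_mono Set.Ioo_subset_Icc_self)
          (isClosed_Icc.preimage Complex.continuous_re)
      exact this hw
    apply DifferentiableAt.differentiableWithinAt
    apply DifferentiableAt.mul
    · apply Complex.differentiableAt_Gamma
      intro m hm
      have := congrArg Complex.re hm
      simp only [Complex.neg_re, Complex.natCast_re] at this
      have : (0 : ℝ) ≤ m := m.cast_nonneg
      linarith [hw'.1]
    · apply DifferentiableAt.cpow differentiableAt_id (by fun_prop)
      left
      simp only [id]
      linarith [hw'.1]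
  -- the growth condition of the Phragmén–Lindelöf principle
  · refine ⟨1, ?_, 2, ?_⟩
    · rw [lt_div_iff₀ (by norm_num)]
      have := Real.pi_gt_three
      linarith
    obtain ⟨C, hC⟩ := isCompact_Icc.exists_bound_of_continuousOn (s := Set.Icc (1 / 2 : ℝ) (3 / 2))
      (f := Real.Gamma) (by
        intro x hx
        apply ContinuousAt.continuousWithinAt
        apply (Real.differentiableAt_Gamma _).continuousAt
        intro m hm
        have : (0 : ℝ) ≤ m := m.cast_nonneg
        linarith [hx.1])
    refine Asymptotics.IsBigO.of_bound (C * 2) ?_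
    rw [eventually_inf_principal]
    refine Eventually.of_forall fun w hw => ?_
    have hw0 : 0 < w.re := by linarith [hw.1]
    have hwne : w ≠ 0 := by rintro rfl; simp at hw0
    rw [norm_mul, Complex.norm_cpow_half_sub hwne, Real.norm_eq_abs, abs_of_pos (Real.exp_pos _)]
    have hwn : 1 / 2 ≤ ‖w‖ := hw.1.le.trans ((le_abs_self _).trans (Complex.abs_re_le_norm w))
    have e1 : ‖Complex.Gamma w‖ ≤ C := by
      refine (Complex.norm_Gamma_le_Gamma_re hw0).trans ((le_abs_self _).trans ?_)
      exact hC _ ⟨hw.1.le, hw.2.le⟩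
    have e2 : ‖w‖ ^ (1 / 2 - w.re) ≤ 2 := by
      calc ‖w‖ ^ (1 / 2 - w.re) ≤ (1 / 2 : ℝ) ^ (1 / 2 - w.re) :=
            Real.rpow_le_rpow_of_nonpos (by norm_num) hwn (by linarith [hw.1])
        _ ≤ (1 / 2 : ℝ) ^ (-1 : ℝ) :=
            Real.rpow_le_rpow_of_exponent_ge (by norm_num) (by norm_num) (by linarith [hw.2])
        _ = 2 := by rw [Real.rpow_neg_one]; norm_num
    have e3 : Real.exp (w.arg * w.im) ≤ Real.exp (2 * Real.exp (1 * |w.im|)) := by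
      apply Real.exp_le_exp.2
      refine (Complex.arg_mul_im_le hw0.le).trans ?_
      have := Real.add_one_le_exp (1 * |w.im|)
      have h4 := Real.pi_le_four
      have := abs_nonneg w.im
      nlinarith
    have hC0 : 0 ≤ C := (norm_nonneg _).trans e1
    calc ‖Complex.Gamma w‖ * (‖w‖ ^ (1 / 2 - w.re) * Real.exp (w.arg * w.im))
        ≤ C * (2 * Real.exp (2 * Real.exp (1 * |w.im|))) := by gcongr
      _ = _ := by ring
  · intro w hw
    have hwne : w ≠ 0 := by rintro rfl; norm_num at hw
    rw [norm_mul, Complex.norm_cpow_half_sub hwne, hw]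
    simp only [sub_self, Real.rpow_zero, one_mul]
    calc _ ≤ √(2 * Real.pi) * Real.exp (-(Real.pi * |w.im| / 2)) *
          Real.exp (Real.pi * |w.im| / 2) := by
          gcongr
          · exact Complex.norm_Gamma_le_of_re_eq_half hw
          · exact Complex.arg_mul_im_le (by rw [hw]; norm_num)
      _ = √(2 * Real.pi) := by rw [mul_assoc, ← Real.exp_add]; simp
  · intro w hw
    have hwne : w ≠ 0 := by rintro rfl; norm_num at hw
    have hwn : 0 < ‖w‖ := norm_pos_iff.2 hwne
    have hw1 : w - 1 ≠ 0 := by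
      intro h
      have := congrArg Complex.re h
      simp [hw] at this
      norm_num at this
    have e1 : Complex.Gamma w = (w - 1) * Complex.Gamma (w - 1) := by
      conv_lhs => rw [← sub_add_cancel w 1]
      exact Complex.Gamma_add_one _ hw1
    have e2 : ‖w - 1‖ ≤ ‖w‖ := by
      refine abs_le_of_sq_le_sq' ?_ (norm_nonneg _) |>.2
      rw [← Complex.normSq_eq_norm_sq, ← Complex.normSq_eq_norm_sq, Complex.normSq_apply,
        Complex.normSq_apply]
      simp [hw]
      norm_num
    rw [norm_mul, Complex.norm_cpow_half_sub hwne, hw, e1, norm_mul,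
      show (1 / 2 - 3 / 2 : ℝ) = -1 by norm_num, Real.rpow_neg_one]
    calc _ ≤ ‖w‖ * (√(2 * Real.pi) * Real.exp (-(Real.pi * |w.im| / 2))) *
          (‖w‖⁻¹ * Real.exp (Real.pi * |w.im| / 2)) := by
          gcongr
          · have := Complex.norm_Gamma_le_of_re_eq_half (z := w - 1) (by simp [hw]; norm_num)
            simpa using this
          · exact Complex.arg_mul_im_le (by rw [hw]; norm_num)
      _ = √(2 * Real.pi) * (‖w‖ * ‖w‖⁻¹) *
          (Real.exp (-(Real.pi * |w.im| / 2)) * Real.exp (Real.pi * |w.im| / 2)) := by ring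
      _ = √(2 * Real.pi) := by rw [← Real.exp_add, mul_inv_cancel₀ hwn.ne']; simp

/-- Stirling's upper bound for `Γ` in a vertical strip away from the real axis.  The central strip
is treated by the Phragmén–Lindelöf principle, and the recurrence of `Γ` widens it. -/
theorem Complex.exists_norm_Gamma_le (n : ℕ) : ∃ C : ℝ, 0 < C ∧ ∀ z : ℂ, |z.re - 1| ≤ n + 1 / 2 →
    1 ≤ |z.im| →
      ‖Complex.Gamma z‖ ≤ C * |z.im| ^ (z.re - 1 / 2) * Real.exp (-(Real.pi * |z.im| / 2)) := by
  induction n with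
  | zero =>
    refine ⟨√(2 * Real.pi) * (5 / 2) * Real.exp (3 / 2), by positivity, fun z hz hi => ?_⟩
    simp only [CharP.cast_eq_zero, zero_add] at hz
    obtain ⟨h1, h2⟩ := abs_le.1 hz
    have hz1 : 1 / 2 ≤ z.re := by linarith
    have hz2 : z.re ≤ 3 / 2 := by linarith
    have hz0 : z ≠ 0 := by rintro rfl; norm_num at hz1
    have hzn : 0 < ‖z‖ := norm_pos_iff.2 hz0
    have hb := Complex.norm_Gamma_mul_cpow_le hz1 hz2
    rw [norm_mul, Complex.norm_cpow_half_sub hz0] at hb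
    have e0 : ‖Complex.Gamma z‖ ≤ √(2 * Real.pi) *
        (‖z‖ ^ (z.re - 1 / 2) * Real.exp (-(z.arg * z.im))) := by
      have hp : 0 < ‖z‖ ^ (1 / 2 - z.re) * Real.exp (z.arg * z.im) := by positivity
      rw [← le_div_iff₀ hp] at hb
      refine hb.trans (le_of_eq ?_)
      rw [div_eq_mul_inv, mul_inv, ← Real.exp_neg, ← Real.rpow_neg hzn.le, neg_sub]
    have e1 : ‖z‖ ≤ 5 / 2 * |z.im| := by
      have := Complex.norm_le_abs_re_add_abs_im z
      rw [abs_of_pos (by linarith : 0 < z.re)] at this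
      linarith
    have e2 : ‖z‖ ^ (z.re - 1 / 2) ≤ 5 / 2 * |z.im| ^ (z.re - 1 / 2) := by
      calc ‖z‖ ^ (z.re - 1 / 2) ≤ (5 / 2 * |z.im|) ^ (z.re - 1 / 2) :=
            Real.rpow_le_rpow hzn.le e1 (by linarith)
        _ = (5 / 2) ^ (z.re - 1 / 2) * |z.im| ^ (z.re - 1 / 2) :=
            Real.mul_rpow (by norm_num) (abs_nonneg _)
        _ ≤ _ := by
            gcongr
            calc (5 / 2 : ℝ) ^ (z.re - 1 / 2) ≤ (5 / 2) ^ (1 : ℝ) :=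
                  Real.rpow_le_rpow_of_exponent_le (by norm_num) (by linarith)
              _ = 5 / 2 := Real.rpow_one _
    have e3 : Real.exp (-(z.arg * z.im)) ≤
        Real.exp (3 / 2) * Real.exp (-(Real.pi * |z.im| / 2)) := by
      rw [← Real.exp_add]
      apply Real.exp_le_exp.2
      have := Complex.le_arg_mul_im (z := z) (by linarith)
      linarith
    calc ‖Complex.Gamma z‖ ≤ _ := e0
      _ ≤ √(2 * Real.pi) * (5 / 2 * |z.im| ^ (z.re - 1 / 2) *
          (Real.exp (3 / 2) * Real.exp (-(Real.pi * |z.im| / 2)))) := by gcongr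
      _ = _ := by ring
  | succ n ih =>
    obtain ⟨C, hC, h⟩ := ih
    refine ⟨C * (n + 3), by positivity, fun z hz hi => ?_⟩
    have hi0 : 0 < |z.im| := by linarith
    push_cast at hz
    obtain ⟨hz1, hz2⟩ := abs_le.1 hz
    have hn0 : (0 : ℝ) ≤ n := n.cast_nonneg
    by_cases hold : |z.re - 1| ≤ n + 1 / 2
    · calc _ ≤ _ := h z hold hi
        _ ≤ _ := by gcongr; nlinarith
    rcases lt_or_ge z.re 1 with hlt | hge
    · rw [abs_of_neg (by linarith)] at hold
      have h' := h (z + 1) (by simp; rw [abs_le]; constructor <;> linarith) (by simpa using hi)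
      have hz0 : z ≠ 0 := by rintro rfl; simp at hi; linarith
      rw [Complex.Gamma_add_one _ hz0, norm_mul] at h'
      simp only [Complex.add_im, Complex.one_im, add_zero, Complex.add_re, Complex.one_re] at h'
      have e1 : |z.im| * ‖Complex.Gamma z‖ ≤ ‖z‖ * ‖Complex.Gamma z‖ := by
        gcongr; exact Complex.abs_im_le_norm z
      have e2 : |z.im| ^ (z.re + 1 - 1 / 2) = |z.im| * |z.im| ^ (z.re - 1 / 2) := by
        rw [show z.re + 1 - 1 / 2 = 1 + (z.re - 1 / 2) by ring, Real.rpow_add hi0, Real.rpow_one]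
      rw [e2] at h'
      have e3 := e1.trans h'
      have e4 : ‖Complex.Gamma z‖ ≤
          C * |z.im| ^ (z.re - 1 / 2) * Real.exp (-(Real.pi * |z.im| / 2)) := by
        refine le_of_mul_le_mul_left (e3.trans (le_of_eq ?_)) hi0
        ring
      refine e4.trans ?_
      gcongr
      nlinarith
    · rw [abs_of_nonneg (by linarith)] at hold
      have h' := h (z - 1) (by simp; rw [abs_le]; constructor <;> linarith) (by simpa using hi)
      have hz0 : z - 1 ≠ 0 := by
        intro h0
        have := congrArg Complex.im h0
        simp at this
        rw [this] at hi
        norm_num at hi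
      have e1 : Complex.Gamma z = (z - 1) * Complex.Gamma (z - 1) := by
        conv_lhs => rw [← sub_add_cancel z 1]
        exact Complex.Gamma_add_one _ hz0
      have e2 : ‖z - 1‖ ≤ (n + 3) * |z.im| := by
        have := Complex.norm_le_abs_re_add_abs_im (z - 1)
        simp only [Complex.sub_re, Complex.one_re, Complex.sub_im, Complex.one_im, sub_zero] at this
        nlinarith
      simp only [Complex.sub_im, Complex.one_im, sub_zero, Complex.sub_re, Complex.one_re] at h'
      have e3 : |z.im| ^ (z.re - 1 / 2) = |z.im| * |z.im| ^ (z.re - 1 - 1 / 2) := by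
        rw [show z.re - 1 / 2 = 1 + (z.re - 1 - 1 / 2) by ring, Real.rpow_add hi0, Real.rpow_one]
      rw [e1, norm_mul, e3]
      calc _ ≤ ((n + 3) * |z.im|) *
            (C * |z.im| ^ (z.re - 1 - 1 / 2) * Real.exp (-(Real.pi * |z.im| / 2))) := by gcongr
        _ = _ := by ring

/-! ### Polynomial growth of the zeta function -/

/-- The Mellin-type integral of the fractional part that continues `ζ` to `Re s > 0`. -/
noncomputable def fractIntegral (s : ℂ) : ℂ :=
  mellin (fun t : ℝ => (((Set.Ioi (1 : ℝ)).indicator Int.fract t : ℝ) : ℂ)) (-s)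

theorem norm_indicator_fract_le (t : ℝ) :
    ‖(((Set.Ioi (1 : ℝ)).indicator Int.fract t : ℝ) : ℂ)‖ ≤ 1 := by
  rw [Complex.norm_real, Real.norm_eq_abs]
  by_cases h : t ∈ Set.Ioi (1 : ℝ)
  · rw [Set.indicator_of_mem h, abs_of_nonneg (Int.fract_nonneg _)]
    exact (Int.fract_lt_one _).le
  · rw [Set.indicator_of_notMem h]; simp

theorem measurable_indicator_fract :
    Measurable (fun t : ℝ => (((Set.Ioi (1 : ℝ)).indicator Int.fract t : ℝ) : ℂ)) :=
  Complex.measurable_ofReal.comp (measurable_fract.indicator measurableSet_Ioi)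

theorem differentiableAt_fractIntegral {s : ℂ} (hs : 0 < s.re) :
    DifferentiableAt ℂ fractIntegral s := by
  have : DifferentiableAt ℂ
      (mellin (fun t : ℝ => (((Set.Ioi (1 : ℝ)).indicator Int.fract t : ℝ) : ℂ))) (-s) := by
    refine mellin_differentiableAt_of_isBigO_rpow (a := 0) (b := (-s).re - 1) ?_ ?_ ?_ ?_ ?_
    · refine MeasureTheory.LocallyIntegrable.locallyIntegrableOn ?_ _
      refine (MeasureTheory.locallyIntegrable_const (1 : ℝ)).mono
        measurable_indicator_fract.aestronglyMeasurable ?_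
      exact Eventually.of_forall fun t => by simpa using norm_indicator_fract_le t
    · refine Asymptotics.IsBigO.of_bound 1 (Eventually.of_forall fun t => ?_)
      simpa using norm_indicator_fract_le t
    · simpa using hs
    · refine Asymptotics.IsBigO.of_bound 1 ?_
      filter_upwards [Ioo_mem_nhdsGT (zero_lt_one' ℝ)] with t ht
      rw [Set.indicator_of_notMem (by simpa using ht.2.le)]
      simp
    · simp
  exact this.comp s (differentiableAt_id.neg)

theorem fractIntegral_eq (s : ℂ) :
    fractIntegral s = ∫ t in Set.Ioi (1 : ℝ), (t : ℂ) ^ (-s - 1) * (Int.fract t : ℝ) := by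
  have hsub : Set.Ioi (1 : ℝ) ⊆ Set.Ioi 0 := Set.Ioi_subset_Ioi zero_le_one
  rw [fractIntegral, mellin, ← MeasureTheory.integral_indicator measurableSet_Ioi,
    ← MeasureTheory.integral_indicator measurableSet_Ioi]
  congr 1
  ext t
  by_cases h : t ∈ Set.Ioi (1 : ℝ)
  · rw [Set.indicator_of_mem (hsub h), Set.indicator_of_mem h, Set.indicator_of_mem h, smul_eq_mul]
  · rw [Set.indicator_of_notMem h]
    by_cases h' : t ∈ Set.Ioi (0 : ℝ)
    · rw [Set.indicator_of_mem h', Set.indicator_of_notMem h]; simp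
    · rw [Set.indicator_of_notMem h']

theorem norm_fractIntegral_le {s : ℂ} (hs : 0 < s.re) : ‖fractIntegral s‖ ≤ 1 / s.re := by
  rw [fractIntegral_eq]
  have h1 : MeasureTheory.IntegrableOn (fun t : ℝ => t ^ (-s.re - 1)) (Set.Ioi 1) :=
    integrableOn_Ioi_rpow_of_lt (by linarith) zero_lt_one
  calc _ ≤ ∫ t in Set.Ioi (1 : ℝ), t ^ (-s.re - 1) := by
        refine MeasureTheory.norm_integral_le_of_norm_le h1 ?_
        filter_upwards [MeasureTheory.ae_restrict_mem measurableSet_Ioi] with t ht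
        have ht0 : (0 : ℝ) < t := zero_lt_one.trans ht
        rw [norm_mul, Complex.norm_cpow_eq_rpow_re_of_pos ht0, Complex.norm_real, Real.norm_eq_abs,
          abs_of_nonneg (Int.fract_nonneg _)]
        simp only [Complex.sub_re, Complex.neg_re, Complex.one_re]
        exact mul_le_of_le_one_right (by positivity) (Int.fract_lt_one _).le
    _ = 1 / s.re := by
        rw [integral_Ioi_rpow_of_lt (by linarith) zero_lt_one]
        simp

theorem riemannZeta_eq_of_one_lt_re {s : ℂ} (hs : 1 < s.re) :
    riemannZeta s = s / (s - 1) - s * fractIntegral s := by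
  have hs0 : (0 : ℝ) < s.re := by linarith
  have hs1 : s - 1 ≠ 0 := by
    intro h
    have := congrArg Complex.re h
    simp at this
    linarith
  have h1 := LSeries_eq_mul_integral' (fun _ => (1 : ℂ)) zero_le_one hs (by
    refine Asymptotics.IsBigO.of_bound 1 (Eventually.of_forall fun n => ?_)
    simp)
  rw [show (fun _ : ℕ => (1 : ℂ)) = 1 from rfl, LSeries_one_eq_riemannZeta hs] at h1
  rw [h1, fractIntegral_eq]
  have i1 : MeasureTheory.IntegrableOn (fun t : ℝ => (t : ℂ) ^ (-s)) (Set.Ioi 1) :=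
    integrableOn_Ioi_cpow_of_lt (by simpa using hs) zero_lt_one
  have i2 : MeasureTheory.IntegrableOn (fun t : ℝ => (t : ℂ) ^ (-s - 1) * (Int.fract t : ℝ))
      (Set.Ioi 1) := by
    have := integrableOn_Ioi_cpow_of_lt (a := -s - 1) (by simp; linarith) zero_lt_one
    refine MeasureTheory.Integrable.mul_bdd (c := 1) this ?_ ?_
    · exact (Complex.measurable_ofReal.comp measurable_fract).aestronglyMeasurable
    · refine Eventually.of_forall fun t => ?_
      rw [Complex.norm_real, Real.norm_eq_abs, abs_of_nonneg (Int.fract_nonneg _)]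
      exact (Int.fract_lt_one _).le
  have e : ∫ t in Set.Ioi (1 : ℝ), (∑ k ∈ Finset.Icc 1 ⌊t⌋₊, (1 : ℕ → ℂ) k) * (t : ℂ) ^ (-(s + 1)) =
      (∫ t in Set.Ioi (1 : ℝ), (t : ℂ) ^ (-s)) -
        ∫ t in Set.Ioi (1 : ℝ), (t : ℂ) ^ (-s - 1) * (Int.fract t : ℝ) := by
    rw [← MeasureTheory.integral_sub i1 i2]
    refine MeasureTheory.setIntegral_congr_fun measurableSet_Ioi fun t ht => ?_
    have ht0 : (0 : ℝ) < t := zero_lt_one.trans ht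
    have hf : ((⌊t⌋₊ : ℕ) : ℂ) = (t : ℂ) - (Int.fract t : ℝ) := by
      rw [← Int.self_sub_floor, ← natCast_floor_eq_intCast_floor ht0.le]
      push_cast; ring
    have hp : (t : ℂ) ^ (-s) = t * (t : ℂ) ^ (-s - 1) := by
      rw [Complex.cpow_sub _ _ (Complex.ofReal_ne_zero.2 ht0.ne'), Complex.cpow_one]
      field_simp [Complex.ofReal_ne_zero.2 ht0.ne']
    simp only [Pi.one_apply, Finset.sum_const, Nat.card_Icc, add_tsub_cancel_right, nsmul_eq_mul,
      mul_one]
    rw [hf, hp, show -(s + 1) = -s - 1 by ring]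
    ring
  rw [e, integral_Ioi_cpow_of_lt (by simpa using hs) zero_lt_one]
  simp only [Complex.ofReal_one, Complex.one_cpow]
  have : -s + 1 ≠ 0 := by
    intro h
    apply hs1
    linear_combination -h
  field_simp
  ring

/-- Analytic continuation in the open quadrant, which is connected and avoids the pole. -/
theorem riemannZeta_eq_of_re_pos_of_im_pos {s : ℂ} (hs : 0 < s.re) (hi : 0 < s.im) :
    riemannZeta s = s / (s - 1) - s * fractIntegral s := by
  let U : Set ℂ := {z | 0 < z.re ∧ 0 < z.im}
  have hUo : IsOpen U := (isOpen_lt continuous_const Complex.continuous_re).inter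
    (isOpen_lt continuous_const Complex.continuous_im)
  have hUc : Convex ℝ U := (convex_halfSpace_re_gt 0).inter (convex_halfSpace_im_gt 0)
  have hne : ∀ z ∈ U, z - 1 ≠ 0 := fun z hz h => by
    have := congrArg Complex.im h
    simp at this
    linarith [hz.2]
  have h1 : AnalyticOnNhd ℂ riemannZeta U := by
    refine DifferentiableOn.analyticOnNhd (fun z hz => ?_) hUo
    exact (differentiableAt_riemannZeta (sub_ne_zero.1 (hne z hz))).differentiableWithinAt
  have h2 : AnalyticOnNhd ℂ (fun s => s / (s - 1) - s * fractIntegral s) U := by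
    refine DifferentiableOn.analyticOnNhd (fun z hz => ?_) hUo
    refine DifferentiableAt.differentiableWithinAt ?_
    refine DifferentiableAt.sub (DifferentiableAt.div (by fun_prop) (by fun_prop) (hne z hz)) ?_
    exact differentiableAt_id.mul (differentiableAt_fractIntegral hz.1)
  have h0 : (2 + Complex.I : ℂ) ∈ U := by simp [U]
  refine h1.eqOn_of_preconnected_of_eventuallyEq h2 hUc.isPreconnected h0 ?_ ⟨hs, hi⟩
  have : {z : ℂ | 1 < z.re} ∈ 𝓝 (2 + Complex.I : ℂ) :=
    (isOpen_lt continuous_const Complex.continuous_re).mem_nhds (by simp)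
  filter_upwards [this] with z hz using riemannZeta_eq_of_one_lt_re hz

theorem norm_riemannZeta_conj (s : ℂ) : ‖riemannZeta ((starRingEnd ℂ) s)‖ = ‖riemannZeta s‖ := by
  rw [riemannZeta_conj, RCLike.norm_conj]

theorem norm_riemannZeta_le_of_half_le_re {s : ℂ} (hs : 1 / 2 ≤ s.re) (hi : 1 ≤ |s.im|) :
    ‖riemannZeta s‖ ≤ 3 * ‖s‖ := by
  have key : ∀ z : ℂ, 1 / 2 ≤ z.re → 1 ≤ z.im → ‖riemannZeta z‖ ≤ 3 * ‖z‖ := by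
    intro z hz hi
    have hz0 : 0 < z.re := by linarith
    rw [riemannZeta_eq_of_re_pos_of_im_pos hz0 (by linarith)]
    have e1 : ‖z / (z - 1)‖ ≤ ‖z‖ := by
      rw [norm_div]
      refine div_le_self (norm_nonneg _) ?_
      refine hi.trans ((le_abs_self _).trans ?_)
      simpa using Complex.abs_im_le_norm (z - 1)
    have e2 : ‖z * fractIntegral z‖ ≤ ‖z‖ * 2 := by
      rw [norm_mul]
      gcongr
      refine (norm_fractIntegral_le hz0).trans ?_
      rw [div_le_iff₀ hz0]
      linarith
    calc _ ≤ _ := norm_sub_le _ _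
      _ ≤ ‖z‖ + ‖z‖ * 2 := add_le_add e1 e2
      _ = _ := by ring
  rcases le_abs.1 hi with h | h
  · exact key s hs h
  · have := key ((starRingEnd ℂ) s) (by simpa using hs) (by simpa using h)
    rwa [norm_riemannZeta_conj, RCLike.norm_conj] at this

theorem Complex.norm_cos_le_exp (z : ℂ) : ‖Complex.cos z‖ ≤ Real.exp |z.im| := by
  rw [Complex.cos]
  have h1 : ‖Complex.exp (z * Complex.I)‖ ≤ Real.exp |z.im| := by
    rw [Complex.norm_exp]
    apply Real.exp_le_exp.2
    simp
    exact neg_le_abs _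
  have h2 : ‖Complex.exp (-z * Complex.I)‖ ≤ Real.exp |z.im| := by
    rw [Complex.norm_exp]
    apply Real.exp_le_exp.2
    simp
    exact le_abs_self _
  rw [norm_div]
  have := norm_add_le (Complex.exp (z * Complex.I)) (Complex.exp (-z * Complex.I))
  simp only [Complex.norm_ofNat]
  rw [div_le_iff₀ (by norm_num)]
  linarith

/-- Polynomial growth of `ζ` in a vertical strip, from the continuation to `Re s > 0` and the
functional equation. -/
theorem exists_norm_riemannZeta_le : ∃ C A : ℝ, 1 ≤ C ∧ 1 ≤ A ∧ ∀ s : ℂ, -6 ≤ s.re → s.re ≤ 10 →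
    1 ≤ |s.im| → ‖riemannZeta s‖ ≤ C * |s.im| ^ A := by
  obtain ⟨C, hC, hΓ⟩ := Complex.exists_norm_Gamma_le 6
  refine ⟨(2 * C + 1) * 33, 15 / 2, by nlinarith, by norm_num, fun s h1 h2 hi => ?_⟩
  have hi0 : 0 < |s.im| := by linarith
  have hnorm : ∀ z : ℂ, -10 ≤ z.re → z.re ≤ 10 → 1 ≤ |z.im| → ‖z‖ ≤ 11 * |z.im| := by
    intro z ha hb hi
    have := Complex.norm_le_abs_re_add_abs_im z
    have : |z.re| ≤ 10 := abs_le.2 ⟨by linarith, by linarith⟩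
    linarith
  rcases le_total (1 / 2) s.re with h | h
  · calc ‖riemannZeta s‖ ≤ 3 * ‖s‖ := norm_riemannZeta_le_of_half_le_re h hi
      _ ≤ 3 * (11 * |s.im|) := by gcongr; exact hnorm s (by linarith) h2 hi
      _ = 33 * |s.im| ^ (1 : ℝ) := by rw [Real.rpow_one]; ring
      _ ≤ ((2 * C + 1) * 33) * |s.im| ^ (15 / 2 : ℝ) := by
          gcongr
          · nlinarith
          · norm_num
  -- the functional equation gives the exponent `13 / 2 + 1`: here `Re (1 - s) ≤ 7`, and `ζ (1 - s)`
  -- grows at most linearly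
  · set z := 1 - s with hz
    have hzre : z.re = 1 - s.re := by simp [hz]
    have hzim : |z.im| = |s.im| := by simp [hz]
    have hz1 : 1 / 2 ≤ z.re := by linarith
    have hz2 : z.re ≤ 7 := by linarith
    have hfe := riemannZeta_one_sub (s := z) (by
      intro n hn
      have := congrArg Complex.re hn
      simp only [Complex.neg_re, Complex.natCast_re] at this
      have : (0 : ℝ) ≤ n := n.cast_nonneg
      linarith) (by
      intro h
      rw [h] at hzim
      simp at hzim
      rw [← hzim] at hi
      norm_num at hi)
    rw [show (1 : ℂ) - z = s by rw [hz]; ring] at hfe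
    rw [hfe]
    simp only [norm_mul]
    have e1 : ‖(2 * (Real.pi : ℂ)) ^ (-z)‖ ≤ 1 := by
      rw [show (2 * (Real.pi : ℂ)) = ((2 * Real.pi : ℝ) : ℂ) by push_cast; rfl,
        Complex.norm_cpow_eq_rpow_re_of_pos (by positivity)]
      apply Real.rpow_le_one_of_one_le_of_nonpos
      · nlinarith [Real.pi_gt_three]
      · simp; linarith
    have e2 : ‖Complex.Gamma z‖ ≤
        C * |s.im| ^ (13 / 2 : ℝ) * Real.exp (-(Real.pi * |s.im| / 2)) := by
      have := hΓ z (by rw [abs_le]; constructor <;> push_cast <;> linarith) (by rw [hzim]; exact hi)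
      rw [hzim] at this
      refine this.trans ?_
      gcongr
      linarith
    have e3 : ‖Complex.cos (Real.pi * z / 2)‖ ≤ Real.exp (Real.pi * |s.im| / 2) := by
      refine (Complex.norm_cos_le_exp _).trans (le_of_eq ?_)
      rw [show (Real.pi : ℂ) * z / 2 = ((Real.pi / 2 : ℝ) : ℂ) * z by push_cast; ring,
        Complex.im_ofReal_mul, abs_mul, abs_of_pos (by positivity), hzim]
      ring_nf
    have e4 : ‖riemannZeta z‖ ≤ 33 * |s.im| := by
      have := norm_riemannZeta_le_of_half_le_re hz1 (by rw [hzim]; exact hi)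
      have h' := hnorm z (by linarith) (by linarith) (by rw [hzim]; exact hi)
      rw [hzim] at h'
      linarith
    rw [Complex.norm_ofNat]
    calc _ ≤ 2 * 1 * (C * |s.im| ^ (13 / 2 : ℝ) * Real.exp (-(Real.pi * |s.im| / 2))) *
          Real.exp (Real.pi * |s.im| / 2) * (33 * |s.im|) := by gcongr
      _ = 2 * C * 33 * (|s.im| ^ (13 / 2 : ℝ) * |s.im|) *
          (Real.exp (-(Real.pi * |s.im| / 2)) * Real.exp (Real.pi * |s.im| / 2)) := by ring
      _ = 2 * C * 33 * |s.im| ^ (15 / 2 : ℝ) := by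
          rw [← Real.exp_add, neg_add_cancel, Real.exp_zero, mul_one,
            ← Real.rpow_add_one hi0.ne']
          norm_num
      _ ≤ _ := by
          gcongr
          linarith

/-! ### Local zeros and the logarithmic derivative -/

section Factorization

variable {f : ℂ → ℂ} {U : Set ℂ}

theorem DifferentiableOn.exists_eq_pow_mul (hU : IsOpen U) (hf : DifferentiableOn ℂ f U) {a : ℂ}
    (ha : a ∈ U) (hord : analyticOrderAt f a ≠ ⊤) :
    ∃ g : ℂ → ℂ, DifferentiableOn ℂ g U ∧ g a ≠ 0 ∧
      ∀ z ∈ U, f z = (z - a) ^ analyticOrderNatAt f a * g z := by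
  classical
  have hfa : AnalyticAt ℂ f a := hf.analyticAt (hU.mem_nhds ha)
  obtain ⟨g₀, hg₀, hg₀a, hfg⟩ := hfa.analyticOrderAt_ne_top.1 hord
  set n := analyticOrderNatAt f a
  let g : ℂ → ℂ := fun z => if z = a then g₀ a else f z / (z - a) ^ n
  have hga : g a = g₀ a := if_pos rfl
  have hgne : ∀ z, z ≠ a → g z = f z / (z - a) ^ n := fun z hz => if_neg hz
  have hev : g =ᶠ[𝓝 a] g₀ := by
    filter_upwards [hfg] with z hz
    by_cases h : z = a
    · rw [h, hga]
    · rw [hgne z h, hz, smul_eq_mul, mul_div_cancel_left₀]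
      exact pow_ne_zero _ (sub_ne_zero.2 h)
  refine ⟨g, fun z hz => ?_, by rwa [hga], fun z hz => ?_⟩
  · by_cases h : z = a
    · rw [h]
      exact (hg₀.congr hev.symm).differentiableAt.differentiableWithinAt
    · have h1 : DifferentiableAt ℂ (fun z => f z / (z - a) ^ n) z :=
        (hf.differentiableAt (hU.mem_nhds hz)).div (by fun_prop)
          (pow_ne_zero _ (sub_ne_zero.2 h))
      refine (h1.congr_of_eventuallyEq ?_).differentiableWithinAt
      filter_upwards [isOpen_ne.mem_nhds h] with w hw using hgne w hw
  · by_cases h : z = a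
    · rw [h, hfg.self_of_nhds, hga]; rfl
    · rw [hgne z h, mul_div_cancel₀]
      exact pow_ne_zero _ (sub_ne_zero.2 h)

/-- Finitely many zeros can be divided out of a holomorphic function. -/
theorem DifferentiableOn.exists_eq_prod_mul (hU : IsOpen U) (hf : DifferentiableOn ℂ f U)
    (Z : Finset ℂ) (hZ : ↑Z ⊆ U) (hord : ∀ ρ ∈ Z, analyticOrderAt f ρ ≠ ⊤) :
    ∃ g : ℂ → ℂ, DifferentiableOn ℂ g U ∧ (∀ ρ ∈ Z, g ρ ≠ 0) ∧
      ∀ z ∈ U, f z = (∏ ρ ∈ Z, (z - ρ) ^ analyticOrderNatAt f ρ) * g z := by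
  classical
  induction Z using Finset.induction_on with
  | empty => exact ⟨f, hf, by simp, by simp⟩
  | insert a Z haZ ih =>
    have hZ' : ↑Z ⊆ U := fun x hx => hZ (by simp [Finset.mem_coe.1 hx])
    have ha : a ∈ U := hZ (by simp)
    obtain ⟨g, hg, hgZ, hfg⟩ := ih hZ' fun ρ hρ => hord ρ (Finset.mem_insert_of_mem hρ)
    set P : ℂ → ℂ := fun z => ∏ ρ ∈ Z, (z - ρ) ^ analyticOrderNatAt f ρ with hP
    have hPd : Differentiable ℂ P := by
      intro z
      simp only [hP]
      fun_prop
    have hPa : P a ≠ 0 := by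
      simp only [hP]
      refine Finset.prod_ne_zero_iff.2 fun ρ hρ => pow_ne_zero _ (sub_ne_zero.2 ?_)
      rintro rfl
      exact haZ hρ
    have hPan : AnalyticAt ℂ P a := hPd.analyticAt a
    have hgan : AnalyticAt ℂ g a := hg.analyticAt (hU.mem_nhds ha)
    have hoeq : analyticOrderAt f a = analyticOrderAt g a := by
      have e : f =ᶠ[𝓝 a] P • g := by
        filter_upwards [hU.mem_nhds ha] with z hz
        simp [hP, hfg z hz]
      rw [analyticOrderAt_congr e, analyticOrderAt_smul hPan hgan,
        hPan.analyticOrderAt_eq_zero.2 hPa, zero_add]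
    have hnat : analyticOrderNatAt g a = analyticOrderNatAt f a := by
      rw [analyticOrderNatAt, analyticOrderNatAt, hoeq]
    obtain ⟨h, hh, hha, hgh⟩ := hg.exists_eq_pow_mul hU ha
      (hoeq ▸ hord a (Finset.mem_insert_self _ _))
    refine ⟨h, hh, ?_, fun z hz => ?_⟩
    · intro ρ hρ
      rcases Finset.mem_insert.1 hρ with rfl | hρ
      · exact hha
      · intro h0
        apply hgZ ρ hρ
        rw [hgh ρ (hZ' hρ), h0, mul_zero]
    · rw [Finset.prod_insert haZ, hfg z hz, hgh z hz, hnat]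
      ring

theorem logDeriv_eq_sum_add_of_eq_prod_mul (hU : IsOpen U) {g : ℂ → ℂ}
    (hg : DifferentiableOn ℂ g U) {Z : Finset ℂ} {m : ℂ → ℕ}
    (hfg : ∀ z ∈ U, f z = (∏ ρ ∈ Z, (z - ρ) ^ m ρ) * g z) {u : ℂ} (hu : u ∈ U) (hfu : f u ≠ 0)
    (hm : ∀ ρ ∈ Z, m ρ ≠ 0) :
    deriv f u / f u = (∑ ρ ∈ Z, (m ρ : ℂ) / (u - ρ)) + deriv g u / g u := by
  have hne := hfu
  rw [hfg u hu] at hne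
  have hPu := left_ne_zero_of_mul hne
  have hgu := right_ne_zero_of_mul hne
  have hρ : ∀ ρ ∈ Z, u - ρ ≠ 0 := fun ρ h h0 => by
    have := Finset.prod_ne_zero_iff.1 hPu ρ h
    rw [h0, zero_pow (hm ρ h)] at this
    exact this rfl
  have e : f =ᶠ[𝓝 u] fun z => (∏ ρ ∈ Z, (z - ρ) ^ m ρ) * g z := by
    filter_upwards [hU.mem_nhds hu] with z hz using hfg z hz
  have e2 : logDeriv f u = logDeriv (fun z => (∏ ρ ∈ Z, (z - ρ) ^ m ρ) * g z) u := by
    rw [logDeriv_apply, logDeriv_apply, e.deriv_eq, e.self_of_nhds]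
  rw [← logDeriv_apply, ← logDeriv_apply, e2, logDeriv_mul u hPu hgu (by fun_prop)
    (hg.differentiableAt (hU.mem_nhds hu))]
  congr 1
  rw [logDeriv_prod (f := fun ρ z => (z - ρ) ^ m ρ) (fun ρ h => pow_ne_zero _ (hρ ρ h))
    (fun ρ h => by fun_prop)]
  refine Finset.sum_congr rfl fun ρ h => ?_
  rw [logDeriv_fun_pow (by fun_prop)]
  simp [logDeriv_apply, div_eq_mul_inv]

end Factorization

/-- Landau's lemma.  If `f` is bounded by `M` on a disc of radius `8` about `c`, then `f` has
`O(log (M / |f c|))` zeros in the disc of radius `5 / 2`, and up to an error of that size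
`f' / f` is there the sum of its polar parts.  The zeros are divided out; the quotient is estimated
by the maximum principle and its logarithm by the Borel–Carathéodory theorem. -/
theorem norm_logDeriv_sub_sum_le {f : ℂ → ℂ} {c : ℂ} {M : ℝ}
    (hf : DifferentiableOn ℂ f (Metric.ball c 8)) (hM : ∀ z ∈ Metric.ball c 8, ‖f z‖ ≤ M)
    (hc : f c ≠ 0) (Z : Finset ℂ) (hZ : ∀ z, z ∈ Z ↔ z ∈ Metric.closedBall c (5 / 2) ∧ f z = 0) :
    (2 : ℝ) ^ (∑ ρ ∈ Z, analyticOrderNatAt f ρ) ≤ M / ‖f c‖ ∧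
    ∀ u ∈ Metric.closedBall c (9 / 4), f u ≠ 0 →
      ‖deriv f u / f u - ∑ ρ ∈ Z, (analyticOrderNatAt f ρ : ℂ) / (u - ρ)‖ ≤
        304 * (Real.log (M / ‖f c‖) + 1) := by
  have hUo : IsOpen (Metric.ball c 8) := Metric.isOpen_ball
  have hcU : c ∈ Metric.ball c 8 := Metric.mem_ball_self (by norm_num)
  have han : AnalyticOnNhd ℂ f (Metric.ball c 8) := hf.analyticOnNhd hUo
  have hsub : Metric.closedBall c (5 / 2) ⊆ Metric.ball c 8 :=
    Metric.closedBall_subset_ball (by norm_num)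
  have hZU : ↑Z ⊆ Metric.ball c 8 := fun z hz => hsub ((hZ z).1 hz).1
  have hordc : analyticOrderAt f c ≠ ⊤ := by
    rw [(han c hcU).analyticOrderAt_eq_zero.2 hc]
    simp
  have hord : ∀ ρ ∈ Metric.ball c 8, analyticOrderAt f ρ ≠ ⊤ := fun ρ hρ =>
    han.analyticOrderAt_ne_top_of_isPreconnected (convex_ball c 8).isPreconnected hcU hρ hordc
  have hm : ∀ ρ ∈ Z, analyticOrderNatAt f ρ ≠ 0 := by
    intro ρ hρ h0
    have h1 : analyticOrderAt f ρ = 0 := by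
      rw [← Nat.cast_analyticOrderNatAt (hord ρ (hZU hρ)), h0]; rfl
    exact (han ρ (hZU hρ)).analyticOrderAt_eq_zero.1 h1 ((hZ ρ).1 hρ).2
  obtain ⟨g, hg, hgZ, hfg⟩ := hf.exists_eq_prod_mul hUo Z hZU fun ρ hρ => hord ρ (hZU hρ)
  set m : ℂ → ℕ := analyticOrderNatAt f with hmdef
  set N := ∑ ρ ∈ Z, m ρ with hN
  have hfc : 0 < ‖f c‖ := norm_pos_iff.2 hc
  have hM0 : 0 < M := hfc.trans_le (hM c hcU)
  have hgne : ∀ z ∈ Metric.closedBall c (5 / 2), g z ≠ 0 := by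
    intro z hz h0
    by_cases hzZ : z ∈ Z
    · exact hgZ z hzZ h0
    · exact hzZ ((hZ z).2 ⟨hz, by rw [hfg z (hsub hz), h0, mul_zero]⟩)
  -- the factors `z - ρ` have modulus at least `5` on the circle of radius `15 / 2`
  have hgb : ∀ z ∈ Metric.closedBall c (15 / 2), ‖g z‖ ≤ M / 5 ^ N := by
    have hcl : closure (Metric.ball c (15 / 2)) = Metric.closedBall c (15 / 2) :=
      closure_ball c (by norm_num)
    have hsub2 : Metric.closedBall c (15 / 2) ⊆ Metric.ball c 8 :=
      Metric.closedBall_subset_ball (by norm_num)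
    intro z hz
    refine Complex.norm_le_of_forall_mem_frontier_norm_le (U := Metric.ball c (15 / 2))
      Metric.isBounded_ball ?_ ?_ (by rwa [hcl])
    · exact (hg.mono (by rwa [hcl])).diffContOnCl
    · intro w hw
      rw [frontier_ball c (by norm_num)] at hw
      have hwU : w ∈ Metric.ball c 8 := hsub2 (Metric.sphere_subset_closedBall hw)
      have h1 : (5 : ℝ) ^ N ≤ ‖∏ ρ ∈ Z, (w - ρ) ^ m ρ‖ := by
        rw [norm_prod, hN, ← Finset.prod_pow_eq_pow_sum]
        refine Finset.prod_le_prod (fun _ _ => by positivity) fun ρ hρ => ?_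
        rw [norm_pow]
        gcongr
        have h2 : dist ρ c ≤ 5 / 2 := ((hZ ρ).1 hρ).1
        have h3 : dist w c = 15 / 2 := hw
        have := dist_triangle w ρ c
        rw [← dist_eq_norm]
        linarith
      have h2 := hM w hwU
      rw [hfg w hwU, norm_mul] at h2
      rw [le_div_iff₀ (by positivity)]
      calc ‖g w‖ * 5 ^ N ≤ ‖g w‖ * ‖∏ ρ ∈ Z, (w - ρ) ^ m ρ‖ := by gcongr
        _ = _ := mul_comm _ _
        _ ≤ M := h2
  have hgc : ‖f c‖ ≤ (5 / 2) ^ N * ‖g c‖ := by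
    rw [hfg c hcU, norm_mul]
    gcongr
    rw [norm_prod, hN, ← Finset.prod_pow_eq_pow_sum]
    refine Finset.prod_le_prod (fun _ _ => by positivity) fun ρ hρ => ?_
    rw [norm_pow, ← dist_eq_norm, dist_comm]
    gcongr
    exact ((hZ ρ).1 hρ).1
  have hgc0 : 0 < ‖g c‖ := norm_pos_iff.2 (hgne c (Metric.mem_closedBall_self (by norm_num)))
  refine ⟨?_, fun u hu hfu => ?_⟩
  · rw [le_div_iff₀ hfc]
    calc (2 : ℝ) ^ N * ‖f c‖ ≤ 2 ^ N * ((5 / 2) ^ N * (M / 5 ^ N)) := by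
          gcongr
          exact hgc.trans (by gcongr; exact hgb c (Metric.mem_closedBall_self (by norm_num)))
      _ = M := by rw [div_pow]; field_simp
  · have huU : u ∈ Metric.ball c 8 := Metric.closedBall_subset_ball (by norm_num) hu
    rw [logDeriv_eq_sum_add_of_eq_prod_mul hUo hg hfg huU hfu hm, add_sub_cancel_left]
    have hbsub : Metric.ball c (5 / 2) ⊆ Metric.ball c 8 := Metric.ball_subset_ball (by norm_num)
    have hgd : ∀ z ∈ Metric.ball c (5 / 2), DifferentiableAt ℂ g z := fun z hz =>
      hg.differentiableAt (hUo.mem_nhds (hbsub hz))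
    have hgne' : ∀ z ∈ Metric.ball c (5 / 2), g z ≠ 0 := fun z hz =>
      hgne z (Metric.ball_subset_closedBall hz)
    -- `g` has no zeros in the disc of radius `5 / 2`, so it has a logarithm `G` there, a primitive
    -- of `g' / g`
    have hld : DifferentiableOn ℂ (fun z => deriv g z / g z) (Metric.ball c (5 / 2)) := by
      refine DifferentiableOn.div ?_ (hg.mono hbsub) hgne'
      exact (hg.deriv hUo).mono hbsub
    obtain ⟨G, hGc, hG⟩ := hld.isExactOn_ball.with_val_at c 0
    have hconst : ∀ z ∈ Metric.ball c (5 / 2), Complex.exp (-G z) * g z = g c := by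
      intro z hz
      have hcb : c ∈ Metric.ball c (5 / 2) := Metric.mem_ball_self (by norm_num)
      have hder : ∀ w ∈ Metric.ball c (5 / 2),
          HasDerivAt (fun w => Complex.exp (-G w) * g w) 0 w := by
        intro w hw
        have h1 := ((hG w hw).neg.cexp).mul (hgd w hw).hasDerivAt
        refine h1.congr_deriv ?_
        field_simp [hgne' w hw]
        ring
      have := (convex_ball c (5 / 2)).is_const_of_fderivWithin_eq_zero (𝕜 := ℂ)
        (f := fun w => Complex.exp (-G w) * g w)
        (fun w hw => (hder w hw).differentiableAt.differentiableWithinAt)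
        (fun w hw => by
          rw [fderivWithin_of_isOpen Metric.isOpen_ball hw, (hder w hw).hasFDerivAt.fderiv]
          ext; simp) hz hcb
      simpa [hGc] using this
    set K := M / ‖f c‖ with hK
    have hre : ∀ z ∈ Metric.ball c (5 / 2), (G z).re ≤ Real.log K + 1 := by
      intro z hz
      have h1 : g z = g c * Complex.exp (G z) := by
        rw [← hconst z hz, mul_right_comm, ← Complex.exp_add]
        simp
      have h2 : Real.exp (G z).re ≤ K := by
        have h3 : ‖g z‖ = ‖g c‖ * Real.exp (G z).re := by rw [h1, norm_mul, Complex.norm_exp]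
        have h4 := hgb z (Metric.closedBall_subset_closedBall (by norm_num)
          (Metric.ball_subset_closedBall hz))
        rw [h3] at h4
        rw [hK, le_div_iff₀ hfc]
        have h5 : (1 / 2 : ℝ) ^ N ≤ 1 := pow_le_one₀ (by norm_num) (by norm_num)
        calc Real.exp (G z).re * ‖f c‖ ≤ Real.exp (G z).re * ((5 / 2) ^ N * ‖g c‖) := by gcongr
          _ = (‖g c‖ * Real.exp (G z).re) * (5 / 2) ^ N := by ring
          _ ≤ M / 5 ^ N * (5 / 2) ^ N := by gcongr
          _ = M * (1 / 2) ^ N := by rw [div_pow, div_pow]; field_simp; simp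
          _ ≤ M * 1 := by gcongr
          _ = M := mul_one _
      have := Real.log_le_log (Real.exp_pos _) h2
      rw [Real.log_exp] at this
      linarith
    have hK1 : 0 ≤ Real.log K := by
      apply Real.log_nonneg
      rw [hK, le_div_iff₀ hfc, one_mul]
      exact hM c hcU
    have hGd : DifferentiableOn ℂ G (Metric.ball c (5 / 2)) := fun z hz =>
      (hG z hz).differentiableAt.differentiableWithinAt
    -- Borel–Carathéodory on the disc of radius `19 / 8`, then Cauchy's estimate on discs of radius
    -- `1 / 8`: the constant is `304 = 38 * 8`
    have hBC : ∀ z ∈ Metric.closedBall c (19 / 8), ‖G z‖ ≤ 38 * (Real.log K + 1) := by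
      intro z hz
      have hz' : ‖z - c‖ ≤ 19 / 8 := by rwa [← dist_eq_norm]
      have := Complex.borelCaratheodory_zero (f := fun w => G (c + w)) (R := 5 / 2)
        (M := Real.log K + 1) (z := z - c) (by linarith) ?_ ?_ (by norm_num) ?_ (by simpa using hGc)
      · simp only [add_sub_cancel] at this
        refine this.trans ?_
        rw [div_le_iff₀ (by linarith)]
        nlinarith [norm_nonneg (z - c)]
      · intro w hw
        refine (DifferentiableAt.comp w (g := G) ?_ (by fun_prop)).differentiableWithinAt
        refine (hG (c + w) ?_).differentiableAt
        simpa using hw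
      · intro w hw
        exact hre (c + w) (by simpa using hw)
      · simp; linarith
    have hu' : u ∈ Metric.ball c (5 / 2) := Metric.closedBall_subset_ball (by norm_num) hu
    rw [← (hG u hu').deriv]
    have hsub3 : Metric.closedBall u (1 / 8) ⊆ Metric.closedBall c (19 / 8) := by
      refine Metric.closedBall_subset_closedBall' ?_
      have : dist u c ≤ 9 / 4 := hu
      linarith
    have := Complex.norm_deriv_le_of_forall_mem_sphere_norm_le (f := G) (c := u) (R := 1 / 8)
      (C := 38 * (Real.log K + 1)) (by norm_num) ?_ ?_
    · refine this.trans (le_of_eq ?_)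
      ring
    · refine DifferentiableOn.diffContOnCl (hGd.mono ?_)
      rw [closure_ball u (by norm_num)]
      exact hsub3.trans (Metric.closedBall_subset_ball (by norm_num))
    · intro z hz
      exact hBC z (hsub3 (Metric.sphere_subset_closedBall hz))

/-! ### The residue theorem on rectangles -/

/-- The integral of `f` around the boundary of the rectangle `[a, b] × [c, d]`, counterclockwise. -/
noncomputable def rectIntegral (f : ℂ → ℂ) (a b c d : ℝ) : ℂ :=
  (∫ x in a..b, f (x + c * Complex.I)) - (∫ x in a..b, f (x + d * Complex.I)) +
    Complex.I * (∫ y in c..d, f (b + y * Complex.I)) -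
    Complex.I * ∫ y in c..d, f (a + y * Complex.I)

/-- The boundary of the rectangle `[a, b] × [c, d]`. -/
def rectBoundary (a b c d : ℝ) : Set ℂ :=
  {z | (z.re ∈ Set.Icc a b ∧ z.im ∈ Set.Icc c d) ∧ (z.re = a ∨ z.re = b ∨ z.im = c ∨ z.im = d)}

section Rect

variable {a b c d : ℝ}

theorem mem_rectBoundary_bottom (hcd : c ≤ d) {x : ℝ} (hx : x ∈ Set.Icc a b) :
    (x + c * Complex.I : ℂ) ∈ rectBoundary a b c d := by
  simp [rectBoundary, hcd]; exact hx

theorem mem_rectBoundary_top (hcd : c ≤ d) {x : ℝ} (hx : x ∈ Set.Icc a b) :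
    (x + d * Complex.I : ℂ) ∈ rectBoundary a b c d := by
  simp [rectBoundary, hcd]; exact hx

theorem mem_rectBoundary_right (hab : a ≤ b) {y : ℝ} (hy : y ∈ Set.Icc c d) :
    (b + y * Complex.I : ℂ) ∈ rectBoundary a b c d := by
  simp [rectBoundary, hab]; exact hy

theorem mem_rectBoundary_left (hab : a ≤ b) {y : ℝ} (hy : y ∈ Set.Icc c d) :
    (a + y * Complex.I : ℂ) ∈ rectBoundary a b c d := by
  simp [rectBoundary, hab]; exact hy

theorem rectIntegral_congr (hab : a ≤ b) (hcd : c ≤ d) {f g : ℂ → ℂ}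
    (h : ∀ z ∈ rectBoundary a b c d, f z = g z) :
    rectIntegral f a b c d = rectIntegral g a b c d := by
  unfold rectIntegral
  congr 1
  · congr 1
    · congr 1
      · refine intervalIntegral.integral_congr fun x hx => h _ ?_
        rw [Set.uIcc_of_le hab] at hx
        exact mem_rectBoundary_bottom hcd hx
      · refine intervalIntegral.integral_congr fun x hx => h _ ?_
        rw [Set.uIcc_of_le hab] at hx
        exact mem_rectBoundary_top hcd hx
    · congr 1
      refine intervalIntegral.integral_congr fun x hx => h _ ?_
      rw [Set.uIcc_of_le hcd] at hx
      exact mem_rectBoundary_right hab hx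
  · congr 1
    refine intervalIntegral.integral_congr fun x hx => h _ ?_
    rw [Set.uIcc_of_le hcd] at hx
    exact mem_rectBoundary_left hab hx

theorem intervalIntegrable_rect_sides (hab : a ≤ b) (hcd : c ≤ d) {f : ℂ → ℂ}
    (h : ContinuousOn f (rectBoundary a b c d)) :
    IntervalIntegrable (fun x : ℝ => f (x + c * Complex.I)) MeasureTheory.volume a b ∧
    IntervalIntegrable (fun x : ℝ => f (x + d * Complex.I)) MeasureTheory.volume a b ∧
    IntervalIntegrable (fun y : ℝ => f (b + y * Complex.I)) MeasureTheory.volume c d ∧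
    IntervalIntegrable (fun y : ℝ => f (a + y * Complex.I)) MeasureTheory.volume c d := by
  refine ⟨?_, ?_, ?_, ?_⟩ <;> refine ContinuousOn.intervalIntegrable ?_ <;>
    refine h.comp (by fun_prop) fun x hx => ?_
  · rw [Set.uIcc_of_le hab] at hx
    exact mem_rectBoundary_bottom hcd hx
  · rw [Set.uIcc_of_le hab] at hx
    exact mem_rectBoundary_top hcd hx
  · rw [Set.uIcc_of_le hcd] at hx
    exact mem_rectBoundary_right hab hx
  · rw [Set.uIcc_of_le hcd] at hx
    exact mem_rectBoundary_left hab hx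

theorem rectIntegral_add (hab : a ≤ b) (hcd : c ≤ d) {f g : ℂ → ℂ}
    (hf : ContinuousOn f (rectBoundary a b c d)) (hg : ContinuousOn g (rectBoundary a b c d)) :
    rectIntegral (fun z => f z + g z) a b c d =
      rectIntegral f a b c d + rectIntegral g a b c d := by
  obtain ⟨f1, f2, f3, f4⟩ := intervalIntegrable_rect_sides hab hcd hf
  obtain ⟨g1, g2, g3, g4⟩ := intervalIntegrable_rect_sides hab hcd hg
  unfold rectIntegral
  rw [intervalIntegral.integral_add f1 g1, intervalIntegral.integral_add f2 g2,
    intervalIntegral.integral_add f3 g3, intervalIntegral.integral_add f4 g4]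
  ring

theorem rectIntegral_const_mul (k : ℂ) (f : ℂ → ℂ) :
    rectIntegral (fun z => k * f z) a b c d = k * rectIntegral f a b c d := by
  unfold rectIntegral
  simp only [intervalIntegral.integral_const_mul]
  ring

theorem rectIntegral_sum (hab : a ≤ b) (hcd : c ≤ d) {ι : Type*} (S : Finset ι) {f : ι → ℂ → ℂ}
    (hf : ∀ i ∈ S, ContinuousOn (f i) (rectBoundary a b c d)) :
    rectIntegral (fun z => ∑ i ∈ S, f i z) a b c d = ∑ i ∈ S, rectIntegral (f i) a b c d := by
  classical
  induction S using Finset.induction_on with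
  | empty => simp [rectIntegral]
  | insert i S hi ih =>
    simp only [Finset.sum_insert hi]
    rw [rectIntegral_add hab hcd (hf i (by simp))
      (continuousOn_finsetSum _ fun j hj => hf j (by simp [hj])),
      ih fun j hj => hf j (by simp [hj])]

theorem rectIntegral_eq_zero (hab : a ≤ b) (hcd : c ≤ d) {f : ℂ → ℂ}
    (hf : DifferentiableOn ℂ f (Set.Icc a b ×ℂ Set.Icc c d)) : rectIntegral f a b c d = 0 := by
  have := Complex.integral_boundary_rect_eq_zero_of_differentiableOn f (a + c * Complex.I)
    (b + d * Complex.I) (by simpa [Set.uIcc_of_le hab, Set.uIcc_of_le hcd] using hf)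
  simpa [rectIntegral] using this

theorem Complex.log_I_mul_of_re_pos {z : ℂ} (hz : 0 < z.re) :
    Complex.log (Complex.I * z) = Complex.log z + Real.pi / 2 * Complex.I := by
  have hz0 : z ≠ 0 := by rintro rfl; simp at hz
  have h := abs_lt.1 (Complex.abs_arg_lt_pi_div_two_iff.2 (Or.inl hz))
  rw [Complex.log_mul Complex.I_ne_zero hz0 (by
    rw [Complex.arg_I]; constructor <;> linarith), Complex.log_I]
  ring

theorem Complex.log_neg_I_mul_of_re_pos {z : ℂ} (hz : 0 < z.re) :
    Complex.log (-Complex.I * z) = Complex.log z - Real.pi / 2 * Complex.I := by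
  have hz0 : z ≠ 0 := by rintro rfl; simp at hz
  have h := abs_lt.1 (Complex.abs_arg_lt_pi_div_two_iff.2 (Or.inl hz))
  rw [Complex.log_mul (by simp) hz0 (by
    rw [Complex.arg_neg_I]; constructor <;> linarith), Complex.log_neg_I]
  ring

theorem integral_inv_eq_log_sub_log {k w v : ℂ} (hk : k ≠ 0) {x y : ℝ} (hxy : x ≤ y)
    (h : ∀ t ∈ Set.Icc x y, 0 < (k * (t * v + w)).re) :
    ∫ t in x..y, v / (t * v + w) = Complex.log (k * (y * v + w)) - Complex.log (k * (x * v + w)) := by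
  have hne : ∀ t ∈ Set.Icc x y, (t * v + w : ℂ) ≠ 0 := fun t ht h0 => by
    have := h t ht
    rw [h0] at this
    simp at this
  refine intervalIntegral.integral_eq_sub_of_hasDerivAt
    (f := fun t : ℝ => Complex.log (k * (t * v + w))) (fun t ht => ?_) ?_
  · rw [Set.uIcc_of_le hxy] at ht
    have h1 : HasDerivAt (fun t : ℝ => k * ((t : ℂ) * v + w)) (k * v) t := by
      have := ((Complex.ofRealCLM.hasDerivAt (x := t)).mul_const v).add_const w |>.const_mul k
      simpa using this
    have h2 := h1.clog_real (Or.inl (h t ht))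
    refine h2.congr_deriv ?_
    field_simp [hne t ht]
  · refine ContinuousOn.intervalIntegrable ?_
    rw [Set.uIcc_of_le hxy]
    exact ContinuousOn.div (by fun_prop) (by fun_prop) hne

theorem rectIntegral_inv_sub {ρ : ℂ} (h1 : a < ρ.re) (h2 : ρ.re < b) (h3 : c < ρ.im)
    (h4 : ρ.im < d) : rectIntegral (fun z => (z - ρ)⁻¹) a b c d = 2 * Real.pi * Complex.I := by
  have hab : a ≤ b := (h1.trans h2).le
  have hcd : c ≤ d := (h3.trans h4).le
  have s1 : ∫ x in a..b, (x + c * Complex.I - ρ : ℂ)⁻¹ =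
      Complex.log (Complex.I * (b + c * Complex.I - ρ)) -
        Complex.log (Complex.I * (a + c * Complex.I - ρ)) := by
    have := integral_inv_eq_log_sub_log (k := Complex.I) (v := 1) (w := c * Complex.I - ρ)
      Complex.I_ne_zero hab (fun t ht => by simp; linarith)
    simpa [add_sub_assoc] using this
  have s2 : ∫ x in a..b, (x + d * Complex.I - ρ : ℂ)⁻¹ =
      Complex.log (-Complex.I * (b + d * Complex.I - ρ)) -
        Complex.log (-Complex.I * (a + d * Complex.I - ρ)) := by
    have := integral_inv_eq_log_sub_log (k := -Complex.I) (v := 1) (w := d * Complex.I - ρ)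
      (by simp) hab (fun t ht => by simp; linarith)
    simpa [add_sub_assoc] using this
  have s3 : Complex.I * ∫ y in c..d, (b + y * Complex.I - ρ : ℂ)⁻¹ =
      Complex.log (b + d * Complex.I - ρ) - Complex.log (b + c * Complex.I - ρ) := by
    have := integral_inv_eq_log_sub_log (k := 1) (v := Complex.I) (w := b - ρ)
      one_ne_zero hcd (fun t ht => by simp; linarith)
    simp only [one_mul] at this
    rw [show (b + d * Complex.I - ρ : ℂ) = d * Complex.I + (b - ρ) by ring,
      show (b + c * Complex.I - ρ : ℂ) = c * Complex.I + (b - ρ) by ring, ← this,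
      ← intervalIntegral.integral_const_mul]
    congr 1
    ext y
    rw [div_eq_mul_inv]
    congr 2
    ring
  have s4 : Complex.I * ∫ y in c..d, (a + y * Complex.I - ρ : ℂ)⁻¹ =
      Complex.log (-(a + d * Complex.I - ρ)) - Complex.log (-(a + c * Complex.I - ρ)) := by
    have := integral_inv_eq_log_sub_log (k := -1) (v := Complex.I) (w := a - ρ)
      (by simp) hcd (fun t ht => by simp; linarith)
    simp only [neg_mul, one_mul] at this
    rw [show (a + d * Complex.I - ρ : ℂ) = d * Complex.I + (a - ρ) by ring,
      show (a + c * Complex.I - ρ : ℂ) = c * Complex.I + (a - ρ) by ring, ← this,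
      ← intervalIntegral.integral_const_mul]
    congr 1
    ext y
    rw [div_eq_mul_inv]
    congr 2
    ring
  have e1 : Complex.log (Complex.I * (b + c * Complex.I - ρ)) =
      Complex.log (b + c * Complex.I - ρ) + Real.pi / 2 * Complex.I :=
    Complex.log_I_mul_of_re_pos (by simp; linarith)
  have e2 : Complex.log (-Complex.I * (b + d * Complex.I - ρ)) =
      Complex.log (b + d * Complex.I - ρ) - Real.pi / 2 * Complex.I :=
    Complex.log_neg_I_mul_of_re_pos (by simp; linarith)
  have e3 : Complex.log (Complex.I * (a + c * Complex.I - ρ)) =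
      Complex.log (-(a + c * Complex.I - ρ)) - Real.pi / 2 * Complex.I := by
    rw [← Complex.log_neg_I_mul_of_re_pos (by simp; linarith)]
    congr 1; ring
  have e4 : Complex.log (-Complex.I * (a + d * Complex.I - ρ)) =
      Complex.log (-(a + d * Complex.I - ρ)) + Real.pi / 2 * Complex.I := by
    rw [← Complex.log_I_mul_of_re_pos (by simp; linarith)]
    congr 1; ring
  rw [rectIntegral, s1, s2, s3, s4, e1, e2, e3, e4]
  ring

theorem rectBoundary_subset : rectBoundary a b c d ⊆ Set.Icc a b ×ℂ Set.Icc c d :=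
  fun _ hz => hz.1

theorem ne_of_mem_rectBoundary {ρ z : ℂ} (hρ : ρ ∈ Set.Ioo a b ×ℂ Set.Ioo c d)
    (hz : z ∈ rectBoundary a b c d) : z ≠ ρ := by
  rintro rfl
  obtain ⟨⟨h1, h2⟩, h3, h4⟩ := hρ
  rcases hz.2 with h | h | h | h
  · exact h1.ne' h
  · exact h2.ne h
  · exact h3.ne' h
  · exact h4.ne h

/-- Cauchy's integral formula for a rectangle. -/
theorem rectIntegral_div_sub {U : Set ℂ} (hU : IsOpen U) (hRU : Set.Icc a b ×ℂ Set.Icc c d ⊆ U)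
    {Ψ : ℂ → ℂ} (hΨ : DifferentiableOn ℂ Ψ U) {ρ : ℂ} (hρ : ρ ∈ Set.Ioo a b ×ℂ Set.Ioo c d) :
    rectIntegral (fun z => Ψ z / (z - ρ)) a b c d = 2 * Real.pi * Complex.I * Ψ ρ := by
  obtain ⟨⟨h1, h2⟩, h3, h4⟩ := id hρ
  have hab : a ≤ b := (h1.trans h2).le
  have hcd : c ≤ d := (h3.trans h4).le
  have hρU : ρ ∈ U := hRU ⟨⟨h1.le, h2.le⟩, ⟨h3.le, h4.le⟩⟩
  have hds : DifferentiableOn ℂ (dslope Ψ ρ) U :=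
    (Complex.differentiableOn_dslope (hU.mem_nhds hρU)).2 hΨ
  have e : ∀ z ∈ rectBoundary a b c d,
      Ψ z / (z - ρ) = dslope Ψ ρ z + Ψ ρ * (z - ρ)⁻¹ := by
    intro z hz
    have hne := ne_of_mem_rectBoundary hρ hz
    rw [dslope_of_ne _ hne, slope_def_field]
    ring
  rw [rectIntegral_congr hab hcd e, rectIntegral_add hab hcd, rectIntegral_const_mul,
    rectIntegral_inv_sub h1 h2 h3 h4, rectIntegral_eq_zero hab hcd (hds.mono hRU)]
  · ring
  · exact hds.continuousOn.mono (rectBoundary_subset.trans hRU)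
  · refine ContinuousOn.mul continuousOn_const (ContinuousOn.inv₀ (by fun_prop) fun z hz => ?_)
    exact sub_ne_zero.2 (ne_of_mem_rectBoundary hρ hz)

/-- The argument principle for a rectangle, with a holomorphic weight `Ψ`. -/
theorem rectIntegral_logDeriv_mul (hab : a ≤ b) (hcd : c ≤ d) {U : Set ℂ} (hU : IsOpen U)
    (hRU : Set.Icc a b ×ℂ Set.Icc c d ⊆ U) {f Ψ : ℂ → ℂ} (hf : DifferentiableOn ℂ f U)
    (hΨ : DifferentiableOn ℂ Ψ U) (Z : Finset ℂ) (hZ : ↑Z ⊆ Set.Ioo a b ×ℂ Set.Ioo c d)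
    (hfZ : ∀ z ∈ Set.Icc a b ×ℂ Set.Icc c d, f z = 0 ↔ z ∈ Z)
    (hord : ∀ ρ ∈ Z, analyticOrderAt f ρ ≠ ⊤) :
    rectIntegral (fun z => deriv f z / f z * Ψ z) a b c d =
      2 * Real.pi * Complex.I * ∑ ρ ∈ Z, (analyticOrderNatAt f ρ : ℂ) * Ψ ρ := by
  have hIoo : Set.Ioo a b ×ℂ Set.Ioo c d ⊆ Set.Icc a b ×ℂ Set.Icc c d := fun z hz =>
    ⟨Set.Ioo_subset_Icc_self hz.1, Set.Ioo_subset_Icc_self hz.2⟩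
  have hZU : ↑Z ⊆ U := hZ.trans (hIoo.trans hRU)
  obtain ⟨g, hg, hgZ, hfg⟩ := hf.exists_eq_prod_mul hU Z hZU hord
  have hgne : ∀ z ∈ Set.Icc a b ×ℂ Set.Icc c d, g z ≠ 0 := by
    intro z hz h0
    by_cases hzZ : z ∈ Z
    · exact hgZ z hzZ h0
    · exact hzZ ((hfZ z hz).1 (by rw [hfg z (hRU hz), h0, mul_zero]))
  have hm : ∀ ρ ∈ Z, analyticOrderNatAt f ρ ≠ 0 := by
    intro ρ hρ h0
    have hρU := hZU hρ
    have h1 : analyticOrderAt f ρ = 0 := by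
      rw [← Nat.cast_analyticOrderNatAt (hord ρ hρ), h0]; rfl
    exact (hf.analyticAt (hU.mem_nhds hρU)).analyticOrderAt_eq_zero.1 h1
      ((hfZ ρ (hIoo (hZ hρ))).2 hρ)
  have e : ∀ z ∈ rectBoundary a b c d, deriv f z / f z * Ψ z =
      (∑ ρ ∈ Z, (analyticOrderNatAt f ρ : ℂ) * (Ψ z / (z - ρ))) + deriv g z / g z * Ψ z := by
    intro z hz
    have hzR := rectBoundary_subset hz
    have hfz : f z ≠ 0 := fun h0 =>
      ne_of_mem_rectBoundary (hZ ((hfZ z hzR).1 h0)) hz rfl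
    rw [logDeriv_eq_sum_add_of_eq_prod_mul hU hg hfg (hRU hzR) hfz hm, add_mul, Finset.sum_mul]
    congr 1
    refine Finset.sum_congr rfl fun ρ _ => ?_
    ring
  have hgΨ : DifferentiableOn ℂ (fun z => deriv g z / g z * Ψ z) (Set.Icc a b ×ℂ Set.Icc c d) :=
    (((hg.deriv hU).mono hRU).div (hg.mono hRU) hgne).mul (hΨ.mono hRU)
  have hcont : ∀ ρ ∈ Z, ContinuousOn (fun z => (analyticOrderNatAt f ρ : ℂ) * (Ψ z / (z - ρ)))
      (rectBoundary a b c d) := by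
    intro ρ hρ
    refine continuousOn_const.mul (ContinuousOn.div ?_ (by fun_prop) fun z hz => ?_)
    · exact hΨ.continuousOn.mono (rectBoundary_subset.trans hRU)
    · exact sub_ne_zero.2 (ne_of_mem_rectBoundary (hZ hρ) hz)
  rw [rectIntegral_congr hab hcd e, rectIntegral_add hab hcd (continuousOn_finsetSum _ hcont)
    (hgΨ.continuousOn.mono rectBoundary_subset), rectIntegral_eq_zero hab hcd hgΨ,
    rectIntegral_sum hab hcd Z hcont, add_zero, Finset.mul_sum]
  refine Finset.sum_congr rfl fun ρ hρ => ?_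
  rw [rectIntegral_const_mul, rectIntegral_div_sub hU hRU hΨ (hZ hρ)]
  ring

end Rect

/-! ### Zeros of the zeta function -/

/-- The zeros of `ζ` in the closed disc of radius `5 / 2` about `2 + iT`. -/
noncomputable def zetaDisc (T : ℝ) : Finset ℂ :=
  (IsCompact.inter_riemannZetaZeros_finite
    (isCompact_closedBall (2 + T * Complex.I : ℂ) (5 / 2))).toFinset

theorem mem_zetaDisc {T : ℝ} {z : ℂ} :
    z ∈ zetaDisc T ↔ z ∈ Metric.closedBall (2 + T * Complex.I : ℂ) (5 / 2) ∧ riemannZeta z = 0 := by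
  rw [zetaDisc, Set.Finite.mem_toFinset, Set.mem_inter_iff, mem_riemannZetaZeros]

/-- On the line `Re s = 2` we have `|ζ(s)| ≥ 1 - ∑_{n ≥ 2} n⁻² = 2 - π² / 6`. -/
theorem one_fourth_le_norm_riemannZeta {s : ℂ} (hs : s.re = 2) : 1 / 4 ≤ ‖riemannZeta s‖ := by
  have hs1 : 1 < s.re := by rw [hs]; norm_num
  have hnorm : ∀ n : ℕ, ‖1 / (n + 2 : ℂ) ^ s‖ = 1 / ((n + 2 : ℕ) : ℝ) ^ 2 := by
    intro n
    have : (n + 2 : ℂ) = (((n + 2 : ℕ) : ℝ) : ℂ) := by push_cast; ring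
    rw [norm_div, norm_one, this, Complex.norm_cpow_eq_rpow_re_of_pos (by positivity), hs]
    norm_cast
  have h2 : HasSum (fun n : ℕ => 1 / ((n + 2 : ℕ) : ℝ) ^ 2) (Real.pi ^ 2 / 6 - 1) := by
    refine (hasSum_nat_add_iff (f := fun n : ℕ => 1 / (n : ℝ) ^ 2) 2).2 ?_
    have e : Real.pi ^ 2 / 6 - 1 + ∑ i ∈ Finset.range 2, 1 / (i : ℝ) ^ 2 = Real.pi ^ 2 / 6 := by
      simp [Finset.sum_range_succ]
    rw [e]
    exact hasSum_zeta_two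
  have hsum : Summable (fun n : ℕ => 1 / (n + 1 : ℂ) ^ s) := by
    have := (Complex.summable_one_div_nat_cpow (p := s)).2 hs1
    have := (summable_nat_add_iff 1).2 this
    simpa using this
  rw [zeta_eq_tsum_one_div_nat_add_one_cpow hs1, hsum.tsum_eq_zero_add]
  have e : ∀ n : ℕ, (1 / ((n + 1 : ℕ) + 1 : ℂ) ^ s) = 1 / (n + 2 : ℂ) ^ s := by
    intro n
    congr 2
    push_cast; ring
  simp only [e]
  have h3 : ‖∑' n : ℕ, 1 / (n + 2 : ℂ) ^ s‖ ≤ Real.pi ^ 2 / 6 - 1 := by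
    refine tsum_of_norm_bounded h2 fun n => (hnorm n).le
  have h4 : Real.pi ^ 2 < 3.15 ^ 2 := by
    have := Real.pi_lt_d2
    have := Real.pi_pos
    gcongr
  have h5 : (1 : ℂ) / (((0 : ℕ) : ℂ) + 1) ^ s = 1 := by simp
  rw [h5]
  have h6 := norm_sub_le_norm_add (1 : ℂ) (∑' n : ℕ, 1 / (n + 2 : ℂ) ^ s)
  rw [norm_one] at h6
  norm_num at h4
  linarith

theorem analyticOrderAt_riemannZeta_ne_top {z : ℂ} (hz : z ≠ 1) :
    analyticOrderAt riemannZeta z ≠ ⊤ := by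
  refine analyticOn_riemannZeta.analyticOrderAt_ne_top_of_isPreconnected (x := 2)
    (isConnected_compl_singleton_of_one_lt_rank (by simp) 1).isPreconnected (by simp) hz ?_
  rw [(analyticOn_riemannZeta 2 (by simp)).analyticOrderAt_eq_zero.2]
  · simp
  · exact riemannZeta_ne_zero_of_one_le_re (by simp)

theorem one_le_zetaMult {z : ℂ} (hz : z ≠ 1) (h0 : riemannZeta z = 0) : 1 ≤ zetaMult z := by
  have hord := analyticOrderAt_riemannZeta_ne_top hz
  rw [Nat.one_le_iff_ne_zero]
  intro h
  have h1 : analyticOrderAt riemannZeta z = 0 := by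
    rw [← Nat.cast_analyticOrderNatAt hord]
    rw [zetaMult] at h
    rw [h]; rfl
  exact (analyticOn_riemannZeta z hz).analyticOrderAt_eq_zero.1 h1 h0

/-- Landau's lemma for `ζ`.  For `|T| ≥ 9` the disc of radius `8` about `2 + iT` avoids the pole and
the real axis, and the polynomial growth of `ζ` makes the errors `O(log |T|)`. -/
theorem exists_zeta_landau : ∃ C : ℝ, 0 < C ∧ ∀ T : ℝ, 9 ≤ |T| →
    ((∑ ρ ∈ zetaDisc T, zetaMult ρ : ℕ) : ℝ) ≤ C * Real.log |T| ∧
    ∀ u ∈ Metric.closedBall (2 + T * Complex.I : ℂ) (9 / 4), riemannZeta u ≠ 0 →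
      ‖deriv riemannZeta u / riemannZeta u - ∑ ρ ∈ zetaDisc T, (zetaMult ρ : ℂ) / (u - ρ)‖ ≤
        C * Real.log |T| := by
  obtain ⟨C, A, hC, hA, hζ⟩ := exists_norm_riemannZeta_le
  set D : ℝ := Real.log (4 * C) + 2 * A with hD
  have hlogC : 0 ≤ Real.log (4 * C) := Real.log_nonneg (by linarith)
  have hD0 : 0 ≤ D := by positivity
  refine ⟨304 * (D + 1) + 2 * D, by positivity, fun T hT => ?_⟩
  set c : ℂ := 2 + T * Complex.I with hc
  have hcre : c.re = 2 := by simp [hc]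
  have hcim : c.im = T := by simp [hc]
  have hζc := one_fourth_le_norm_riemannZeta hcre
  have hball : ∀ z ∈ Metric.ball c 8, |z.re - 2| < 8 ∧ |z.im - T| < 8 := by
    intro z hz
    rw [Metric.mem_ball, dist_eq_norm] at hz
    have h1 := Complex.abs_re_le_norm (z - c)
    have h2 := Complex.abs_im_le_norm (z - c)
    rw [Complex.sub_re, hcre] at h1
    rw [Complex.sub_im, hcim] at h2
    exact ⟨h1.trans_lt hz, h2.trans_lt hz⟩
  have him : ∀ z ∈ Metric.ball c 8, 1 ≤ |z.im| ∧ |z.im| ≤ 2 * |T| := by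
    intro z hz
    have h1 := (hball z hz).2
    have h2 := abs_sub_abs_le_abs_sub T z.im
    have h3 := abs_sub_abs_le_abs_sub z.im T
    rw [abs_sub_comm] at h2
    constructor <;> linarith
  have hT0 : 0 < |T| := by linarith
  have hlogT : 1 ≤ Real.log |T| := by
    rw [Real.le_log_iff_exp_le hT0]
    have := Real.exp_one_lt_d9
    linarith
  have key := norm_logDeriv_sub_sum_le (f := riemannZeta) (c := c) (M := C * (2 * |T|) ^ A) ?_ ?_ ?_
    (zetaDisc T) (fun z => mem_zetaDisc)
  · set K := C * (2 * |T|) ^ A / ‖riemannZeta c‖ with hK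
    have hK1 : K ≤ 4 * C * (2 * |T|) ^ A := by
      rw [hK, div_le_iff₀ (by linarith)]
      have : 0 ≤ C * (2 * |T|) ^ A := by positivity
      nlinarith
    have hKpos : 0 < K := by
      have : 0 < ‖riemannZeta c‖ := by linarith
      positivity
    have hlogK : Real.log K ≤ D * Real.log |T| := by
      have h1 := Real.log_le_log hKpos hK1
      rw [Real.log_mul (by positivity) (by positivity), Real.log_rpow (by positivity),
        Real.log_mul (by norm_num) hT0.ne'] at h1
      have h2 : Real.log 2 ≤ Real.log |T| := Real.log_le_log (by norm_num) (by linarith)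
      rw [hD]
      nlinarith
    refine ⟨?_, fun u hu hu0 => ?_⟩
    · have h1 := key.1
      have h2 := Real.log_le_log (by positivity) h1
      rw [Real.log_pow] at h2
      have h3 : (1 / 2 : ℝ) ≤ Real.log 2 := by have := Real.log_two_gt_d9; linarith
      have h4 : ((∑ ρ ∈ zetaDisc T, zetaMult ρ : ℕ) : ℝ) * (1 / 2) ≤ D * Real.log |T| := by
        refine le_trans ?_ (h2.trans hlogK)
        gcongr
        exact le_refl _
      nlinarith
    · refine (key.2 u hu hu0).trans ?_
      nlinarith
  · intro z hz
    refine (differentiableAt_riemannZeta ?_).differentiableWithinAt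
    rintro rfl
    have := (him _ hz).1
    simp at this
    linarith
  · intro z hz
    have h1 := abs_lt.1 (hball z hz).1
    have h2 := him z hz
    refine (hζ z (by linarith) (by linarith) h2.1).trans ?_
    gcongr
    exact h2.2
  · intro h0
    rw [h0, norm_zero] at hζc
    linarith

theorem mem_complexZetaZeros_of_mem_zetaDisc {T : ℝ} (hT : 9 ≤ |T|) {ρ : ℂ} (h : ρ ∈ zetaDisc T) :
    ρ ∈ complexZetaZeros := by
  obtain ⟨h1, h2⟩ := mem_zetaDisc.1 h
  refine ⟨h2, fun him => ?_⟩
  rw [Metric.mem_closedBall, dist_eq_norm] at h1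
  have h3 := Complex.abs_im_le_norm (ρ - (2 + T * Complex.I))
  simp [him] at h3
  linarith

theorem mem_zetaDisc_of_abs_sub_le {T : ℝ} {ρ : ℂ} (h : ρ ∈ complexZetaZeros)
    (hT : |ρ.im - T| ≤ 1) : ρ ∈ zetaDisc T := by
  refine mem_zetaDisc.2 ⟨?_, h.1⟩
  have hre := complexZetaZeros_re_mem h
  rw [Metric.mem_closedBall, dist_eq_norm]
  refine abs_le_of_sq_le_sq' ?_ (by norm_num) |>.2
  rw [← Complex.normSq_eq_norm_sq, Complex.normSq_apply]
  simp only [Complex.sub_re, Complex.add_re, Complex.re_ofNat, Complex.mul_re, Complex.ofReal_re,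
    Complex.I_re, mul_zero, Complex.ofReal_im, Complex.I_im, mul_one, sub_self, add_zero,
    Complex.sub_im, Complex.add_im, Complex.im_ofNat, Complex.mul_im, zero_add]
  have := abs_le.1 hT
  nlinarith [hre.1, hre.2]

theorem ne_one_of_mem_complexZetaZeros {ρ : ℂ} (h : ρ ∈ complexZetaZeros) : ρ ≠ 1 := by
  rintro rfl
  exact h.2 (by simp)

theorem mem_zetaZerosBelow {R : ℝ} {ρ : ℂ} :
    ρ ∈ zetaZerosBelow R ↔ ρ ∈ complexZetaZeros ∧ |ρ.im| < R := by
  rw [zetaZerosBelow, Set.Finite.mem_toFinset]; rfl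

/-- The number of zeros with imaginary part in a window of length one is `O(log)`. -/
theorem exists_sum_zetaMult_le : ∃ C : ℝ, 0 < C ∧ ∀ (k : ℕ) (S : Finset ℂ),
    (∀ ρ ∈ S, ρ ∈ complexZetaZeros ∧ (k : ℝ) ≤ |ρ.im| ∧ |ρ.im| < k + 1) →
      ∑ ρ ∈ S, (zetaMult ρ : ℝ) ≤ C * Real.log (k + 3) := by
  classical
  obtain ⟨C, hC, h⟩ := exists_zeta_landau
  set B : ℝ := ∑ ρ ∈ zetaZerosBelow 9, (zetaMult ρ : ℝ) with hB
  have hB0 : 0 ≤ B := Finset.sum_nonneg fun _ _ => Nat.cast_nonneg _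
  refine ⟨2 * C + B, by positivity, fun k S hS => ?_⟩
  have hlog : 1 ≤ Real.log (k + 3) := by
    rw [Real.le_log_iff_exp_le (by positivity)]
    have := Real.exp_one_lt_d9
    have : (0 : ℝ) ≤ k := k.cast_nonneg
    linarith
  rcases lt_or_ge k 9 with hk | hk
  · have h1 : ∑ ρ ∈ S, (zetaMult ρ : ℝ) ≤ B := by
      refine Finset.sum_le_sum_of_subset_of_nonneg (fun ρ hρ => ?_) fun _ _ _ => Nat.cast_nonneg _
      obtain ⟨h2, h3, h4⟩ := hS ρ hρ
      refine mem_zetaZerosBelow.2 ⟨h2, h4.trans_le ?_⟩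
      have : (k : ℝ) + 1 ≤ 9 := by exact_mod_cast hk
      exact this
    nlinarith
  · have hk' : (9 : ℝ) ≤ k := by exact_mod_cast hk
    have hsub : S ⊆ zetaDisc k ∪ zetaDisc (-k) := by
      intro ρ hρ
      obtain ⟨h2, h3, h4⟩ := hS ρ hρ
      rw [Finset.mem_union]
      rcases le_total 0 ρ.im with h0 | h0
      · left
        rw [abs_of_nonneg h0] at h3 h4
        exact mem_zetaDisc_of_abs_sub_le h2 (abs_le.2 ⟨by linarith, by linarith⟩)
      · right
        rw [abs_of_nonpos h0] at h3 h4
        exact mem_zetaDisc_of_abs_sub_le h2 (abs_le.2 ⟨by linarith, by linarith⟩)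
    have h1 := (h k (by rwa [abs_of_nonneg (by linarith)])).1
    have h2 := (h (-k) (by rwa [abs_neg, abs_of_nonneg (by linarith)])).1
    rw [abs_neg] at h2
    rw [abs_of_nonneg (by linarith)] at h1 h2
    have h3 : Real.log k ≤ Real.log (k + 3) := Real.log_le_log (by linarith) (by linarith)
    calc ∑ ρ ∈ S, (zetaMult ρ : ℝ) ≤ ∑ ρ ∈ zetaDisc k ∪ zetaDisc (-k), (zetaMult ρ : ℝ) :=
          Finset.sum_le_sum_of_subset_of_nonneg hsub fun _ _ _ => Nat.cast_nonneg _
      _ ≤ ∑ ρ ∈ zetaDisc k, (zetaMult ρ : ℝ) + ∑ ρ ∈ zetaDisc (-k), (zetaMult ρ : ℝ) := by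
          rw [← Finset.sum_union_inter]
          exact le_add_of_nonneg_right (Finset.sum_nonneg fun _ _ => Nat.cast_nonneg _)
      _ ≤ C * Real.log k + C * Real.log k := by
          push_cast at h1 h2
          exact add_le_add h1 h2
      _ ≤ (2 * C + B) * Real.log (k + 3) := by nlinarith

theorem norm_sum_zetaMult_div_le {T δ : ℝ} (hδ : 0 < δ) {u : ℂ}
    (h : ∀ ρ ∈ zetaDisc T, δ ≤ ‖u - ρ‖) :
    ‖∑ ρ ∈ zetaDisc T, (zetaMult ρ : ℂ) / (u - ρ)‖ ≤
      ((∑ ρ ∈ zetaDisc T, zetaMult ρ : ℕ) : ℝ) / δ := by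
  refine (norm_sum_le _ _).trans ?_
  push_cast
  rw [Finset.sum_div]
  refine Finset.sum_le_sum fun ρ hρ => ?_
  rw [norm_div, Complex.norm_natCast]
  gcongr
  exact h ρ hρ

/-- To the left of the critical strip `ζ' / ζ` grows at most logarithmically. -/
theorem exists_norm_logDeriv_zeta_left_le {σ : ℝ} (h1 : -(1 / 4) ≤ σ) (h2 : σ < 0) :
    ∃ C : ℝ, 0 < C ∧ ∀ y : ℝ, 9 ≤ |y| →
      ‖deriv riemannZeta (σ + y * Complex.I) / riemannZeta (σ + y * Complex.I)‖ ≤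
        C * Real.log |y| := by
  obtain ⟨C, hC, h⟩ := exists_zeta_landau
  have hσ : 0 < -σ := by linarith
  refine ⟨C / (-σ) + C, by positivity, fun y hy => ?_⟩
  obtain ⟨hN, hL⟩ := h y hy
  set u : ℂ := σ + y * Complex.I with hu
  have hure : u.re = σ := by simp [hu]
  have huim : u.im = y := by simp [hu]
  have hub : u ∈ Metric.closedBall (2 + y * Complex.I : ℂ) (9 / 4) := by
    rw [Metric.mem_closedBall, dist_eq_norm, hu,
      show (σ + y * Complex.I - (2 + y * Complex.I) : ℂ) = ((σ - 2 : ℝ) : ℂ) by push_cast; ring,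
      Complex.norm_real, Real.norm_eq_abs, abs_of_neg (by linarith)]
    linarith
  have hu0 : riemannZeta u ≠ 0 := by
    intro h0
    have := complexZetaZeros_re_mem (ρ := u) ⟨h0, by
      rw [huim]; rintro rfl; simp at hy; linarith⟩
    rw [hure] at this
    linarith [this.1]
  have h3 := hL u hub hu0
  have h4 : ‖∑ ρ ∈ zetaDisc y, (zetaMult ρ : ℂ) / (u - ρ)‖ ≤ C * Real.log |y| / (-σ) := by
    refine (norm_sum_zetaMult_div_le hσ fun ρ hρ => ?_).trans ?_
    · have := (complexZetaZeros_re_mem (mem_complexZetaZeros_of_mem_zetaDisc hy hρ)).1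
      refine le_trans ?_ (Complex.abs_re_le_norm _)
      rw [Complex.sub_re, hure, abs_of_neg (by linarith)]
      linarith
    · gcongr
  have := norm_sub_norm_le (deriv riemannZeta u / riemannZeta u)
    (∑ ρ ∈ zetaDisc y, (zetaMult ρ : ℂ) / (u - ρ))
  calc _ ≤ C * Real.log |y| + C * Real.log |y| / (-σ) := by linarith
    _ = _ := by ring

/-- In every interval of length one there is a point that keeps a distance `1 / (4 (n + 1))` from
`n` given points. -/
theorem exists_mem_Icc_forall_le_abs_sub (S : Finset ℝ) (a : ℝ) :
    ∃ T ∈ Set.Icc a (a + 1), ∀ x ∈ S, 1 / (4 * ((S.card : ℝ) + 1)) ≤ |T - x| := by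
  by_contra! hcon
  set δ : ℝ := 1 / (4 * ((S.card : ℝ) + 1)) with hδ
  have hδ0 : 0 < δ := by positivity
  have hcov : Set.Icc a (a + 1) ⊆ ⋃ x ∈ S, Set.Icc (x - δ) (x + δ) := by
    intro T hT
    obtain ⟨x, hx, hlt⟩ := hcon T hT
    have := abs_lt.1 hlt
    simp only [Set.mem_iUnion]
    exact ⟨x, hx, by linarith, by linarith⟩
  have h1 : MeasureTheory.volume (Set.Icc a (a + 1)) ≤
      ∑ x ∈ S, MeasureTheory.volume (Set.Icc (x - δ) (x + δ)) :=
    (MeasureTheory.measure_mono hcov).trans (MeasureTheory.measure_biUnion_finset_le _ _)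
  simp only [Real.volume_Icc, add_sub_cancel_left] at h1
  have e : ∀ x : ℝ, x + δ - (x - δ) = 2 * δ := fun x => by ring
  simp only [e, Finset.sum_const, nsmul_eq_mul] at h1
  rw [← ENNReal.ofReal_natCast, ← ENNReal.ofReal_mul (by positivity),
    ENNReal.ofReal_le_ofReal_iff (by positivity)] at h1
  have : (S.card : ℝ) * (2 * δ) < 1 := by
    rw [hδ, mul_one_div, mul_div_assoc', div_lt_one (by positivity)]
    have : (0 : ℝ) ≤ S.card := Nat.cast_nonneg _
    linarith
  linarith

theorem card_zetaDisc_le {T : ℝ} (hT : 9 ≤ |T|) :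
    (zetaDisc T).card ≤ ∑ ρ ∈ zetaDisc T, zetaMult ρ := by
  rw [Finset.card_eq_sum_ones]
  refine Finset.sum_le_sum fun ρ hρ => ?_
  have := mem_complexZetaZeros_of_mem_zetaDisc hT hρ
  exact one_le_zetaMult (ne_one_of_mem_complexZetaZeros this) this.1

/-- There are arbitrarily large heights `± T` on which `ζ` has no zeros and `ζ' / ζ` is of
polynomial size. -/
theorem exists_good_height : ∃ C : ℝ, 0 < C ∧ ∀ j : ℕ, 12 ≤ j → ∃ T : ℝ, (j : ℝ) ≤ T ∧ T ≤ j + 1 ∧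
    (∀ ρ ∈ complexZetaZeros, |ρ.im| ≠ T) ∧
    ∀ u : ℂ, |u.im| = T → -(1 / 4) ≤ u.re → u.re ≤ 3 / 2 →
      ‖deriv riemannZeta u / riemannZeta u‖ ≤ C * (j : ℝ) ^ 2 := by
  classical
  obtain ⟨C, hC, h⟩ := exists_zeta_landau
  refine ⟨2 * C * (4 * (8 * C + 1)) + 2 * C, by positivity, fun j hj => ?_⟩
  have hj' : (12 : ℝ) ≤ j := by exact_mod_cast hj
  have hlog : ∀ T : ℝ, 9 ≤ |T| → |T| ≤ j + 1 → Real.log |T| ≤ 2 * j := fun T h1 h2 =>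
    (Real.log_le_self (abs_nonneg _)).trans (by linarith)
  have habs : ∀ i : ℝ, (j : ℝ) ≤ |i| → |i| ≤ j + 1 →
      ((zetaDisc i).card : ℝ) ≤ 2 * C * j := fun i h1 h2 => by
    have h9 : 9 ≤ |i| := by linarith
    have h3 := (h i h9).1
    have h4 : ((zetaDisc i).card : ℝ) ≤ ((∑ ρ ∈ zetaDisc i, zetaMult ρ : ℕ) : ℝ) := by
      exact_mod_cast card_zetaDisc_le h9
    have := hlog i h9 h2
    nlinarith
  -- `O(j)` zeros matter for the heights in `[j, j + 1]` and their negatives, so that some height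
  -- keeps a distance `≫ 1 / j` from all of them
  set S : Finset ℝ := ((zetaDisc j ∪ zetaDisc (j + 1)) ∪
    (zetaDisc (-j) ∪ zetaDisc (-(j + 1)))).image fun ρ => |ρ.im| with hS
  have hScard : (S.card : ℝ) ≤ 8 * C * j := by
    have e1 : S.card ≤ ((zetaDisc j).card + (zetaDisc (j + 1)).card) +
        ((zetaDisc (-j)).card + (zetaDisc (-(j + 1))).card) := by
      refine Finset.card_image_le.trans ((Finset.card_union_le _ _).trans ?_)
      exact add_le_add (Finset.card_union_le _ _) (Finset.card_union_le _ _)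
    have e2 : (S.card : ℝ) ≤ (((zetaDisc j).card + (zetaDisc (j + 1)).card) +
        ((zetaDisc (-j)).card + (zetaDisc (-(j + 1))).card) : ℝ) := by exact_mod_cast e1
    have a1 : |(j : ℝ)| = j := abs_of_nonneg (by linarith)
    have a2 : |(j : ℝ) + 1| = j + 1 := abs_of_nonneg (by linarith)
    have h1 := habs j (by rw [a1]) (by rw [a1]; linarith)
    have h2 := habs (j + 1) (by rw [a2]; linarith) (by rw [a2])
    have h3 := habs (-j) (by rw [abs_neg, a1]) (by rw [abs_neg, a1]; linarith)
    have h4 := habs (-(j + 1)) (by rw [abs_neg, a2]; linarith) (by rw [abs_neg, a2])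
    linarith
  obtain ⟨T, ⟨hT1, hT2⟩, hT⟩ := exists_mem_Icc_forall_le_abs_sub S j
  have hT0 : 0 < T := by linarith
  set δ : ℝ := 1 / (4 * ((S.card : ℝ) + 1)) with hδ
  have hδ0 : 0 < δ := by positivity
  have hδ1 : δ ≤ 1 := by
    rw [hδ, div_le_one (by positivity)]
    have : (0 : ℝ) ≤ S.card := Nat.cast_nonneg _
    linarith
  have hfar : ∀ ρ ∈ complexZetaZeros, δ ≤ |T - (|ρ.im|)| := by
    intro ρ hρ
    by_contra! hlt
    have h1 := abs_lt.1 hlt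
    have hmem : (|ρ.im|) ∈ S := by
      rw [hS, Finset.mem_image]
      refine ⟨ρ, ?_, rfl⟩
      rw [Finset.mem_union, Finset.mem_union, Finset.mem_union]
      have hcases : |(|ρ.im|) - j| ≤ 1 ∨ |(|ρ.im|) - (j + 1)| ≤ 1 := by
        rcases le_total (|ρ.im|) (j + 1) with h2 | h2
        · left; rw [abs_le]; constructor <;> linarith
        · right; rw [abs_le]; constructor <;> linarith
      rcases le_total 0 ρ.im with h0 | h0
      · left
        rw [abs_of_nonneg h0] at hcases
        exact hcases.imp (mem_zetaDisc_of_abs_sub_le hρ) (mem_zetaDisc_of_abs_sub_le hρ)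
      · right
        rw [abs_of_nonpos h0] at hcases
        refine hcases.imp (fun h2 => mem_zetaDisc_of_abs_sub_le hρ ?_)
          (fun h2 => mem_zetaDisc_of_abs_sub_le hρ ?_)
        · rw [← abs_neg]; convert h2 using 2; ring
        · rw [← abs_neg]; convert h2 using 2; ring
    exact absurd (hT _ hmem) (not_le.2 hlt)
  refine ⟨T, hT1, hT2, fun ρ hρ h0 => ?_, fun u hu h1 h2 => ?_⟩
  · have := hfar ρ hρ
    rw [h0, sub_self, abs_zero] at this
    linarith
  · have hu9 : 9 ≤ |u.im| := by rw [hu]; linarith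
    obtain ⟨hN, hL⟩ := h u.im hu9
    have hub : u ∈ Metric.closedBall (2 + u.im * Complex.I : ℂ) (9 / 4) := by
      rw [Metric.mem_closedBall, dist_eq_norm]
      have : u - (2 + u.im * Complex.I) = ((u.re - 2 : ℝ) : ℂ) := by
        apply Complex.ext <;> simp
      rw [this, Complex.norm_real, Real.norm_eq_abs, abs_le]
      constructor <;> linarith
    have hu0 : riemannZeta u ≠ 0 := by
      intro h0
      have := hfar u ⟨h0, by rintro h3; rw [h3] at hu9; norm_num at hu9⟩
      rw [hu, sub_self, abs_zero] at this
      linarith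
    have h3 := hL u hub hu0
    have h4 : ‖∑ ρ ∈ zetaDisc u.im, (zetaMult ρ : ℂ) / (u - ρ)‖ ≤ C * Real.log |u.im| / δ := by
      refine (norm_sum_zetaMult_div_le hδ0 fun ρ hρ => ?_).trans ?_
      · refine (hfar ρ (mem_complexZetaZeros_of_mem_zetaDisc hu9 hρ)).trans ?_
        rw [← hu]
        refine (abs_abs_sub_abs_le _ _).trans ?_
        rw [← Complex.sub_im]
        exact Complex.abs_im_le_norm _
      · gcongr
    have h5 := norm_sub_norm_le (deriv riemannZeta u / riemannZeta u)
      (∑ ρ ∈ zetaDisc u.im, (zetaMult ρ : ℂ) / (u - ρ))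
    have h6 := hlog u.im hu9 (by rw [hu]; exact hT2)
    have h7 : C * Real.log |u.im| / δ ≤ (2 * C * j) * (4 * ((8 * C + 1) * j)) := by
      rw [hδ, div_div_eq_mul_div, div_one]
      have : C * Real.log |u.im| ≤ 2 * C * j := by nlinarith
      gcongr
      nlinarith
    calc _ ≤ C * Real.log |u.im| / δ + C * Real.log |u.im| := by linarith
      _ ≤ (2 * C * j) * (4 * ((8 * C + 1) * j)) + 2 * C * j := by
          have : C * Real.log |u.im| ≤ C * (2 * j) := mul_le_mul_of_nonneg_left h6 hC.le
          linarith
      _ ≤ (2 * C * j) * (4 * ((8 * C + 1) * j)) + 2 * C * (j : ℝ) ^ 2 := by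
          gcongr
          nlinarith
      _ = _ := by ring

/-! ### A smooth cutoff in vertical strips -/

theorem differentiable_intervalIntegral_of_hasDerivAt {F F' : ℂ → ℝ → ℂ} (a b : ℝ)
    (hd : ∀ u y, HasDerivAt (fun u => F u y) (F' u y) u)
    (hF : Continuous fun p : ℂ × ℝ => F p.1 p.2) (hF' : Continuous fun p : ℂ × ℝ => F' p.1 p.2) :
    Differentiable ℂ fun u => ∫ y in a..b, F u y := by
  intro u
  have hK : IsCompact (Metric.closedBall u 1 ×ˢ Set.uIcc a b) :=
    (isCompact_closedBall u 1).prod isCompact_uIcc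
  obtain ⟨C, hC⟩ := hK.exists_bound_of_continuousOn hF'.continuousOn
  refine (intervalIntegral.hasDerivAt_integral_of_dominated_loc_of_deriv_le
    (F := F) (F' := F') (bound := fun _ => C) (s := Metric.closedBall u 1)
    (Metric.closedBall_mem_nhds u one_pos) ?_ ?_ ?_ ?_ ?_ ?_).2.differentiableAt
  · exact Eventually.of_forall fun v =>
      (hF.comp (Continuous.prodMk_right v)).aestronglyMeasurable
  · exact (hF.comp (Continuous.prodMk_right u)).intervalIntegrable _ _
  · exact (hF'.comp (Continuous.prodMk_right u)).aestronglyMeasurable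
  · exact Eventually.of_forall fun y hy v hv => hC (v, y) ⟨hv, Set.uIoc_subset_uIcc hy⟩
  · exact intervalIntegrable_const
  · exact Eventually.of_forall fun y _ v _ => hd v y

/-- An entire approximation of the indicator function of `|Im u| < R`, with transition zones of
bounded width: the convolution of that indicator with a Gaussian, continued analytically. -/
noncomputable def smoothCutoff (R : ℝ) (u : ℂ) : ℂ :=
  ((1 / √Real.pi : ℝ) : ℂ) * ∫ y in -R..R, Complex.exp ((u - Complex.I * y) ^ 2)

theorem norm_cexp_sub_sq (u : ℂ) (y : ℝ) :
    ‖Complex.exp ((u - Complex.I * y) ^ 2)‖ = Real.exp (u.re ^ 2) * Real.exp (-(u.im - y) ^ 2) := by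
  rw [Complex.norm_exp, ← Real.exp_add]
  congr 1
  simp [pow_two]
  ring

theorem differentiable_smoothCutoff (R : ℝ) : Differentiable ℂ (smoothCutoff R) := by
  refine (differentiable_const _).mul (differentiable_intervalIntegral_of_hasDerivAt (-R) R
    (F := fun u y => Complex.exp ((u - Complex.I * y) ^ 2))
    (F' := fun u y => Complex.exp ((u - Complex.I * y) ^ 2) * (2 * (u - Complex.I * y)))
    (fun u y => ?_) (by fun_prop) (by fun_prop))
  have h1 : HasDerivAt (fun u : ℂ => u - Complex.I * y) 1 u := (hasDerivAt_id u).sub_const _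
  have h2 : HasDerivAt (fun u : ℂ => (u - Complex.I * y) ^ 2) (2 * (u - Complex.I * y)) u := by
    simpa using h1.fun_pow 2
  exact h2.cexp

theorem integrable_gaussian_sub (b : ℝ) : MeasureTheory.Integrable fun y : ℝ =>
    Real.exp (-(b - y) ^ 2) := by
  have h := (integrable_exp_neg_mul_sq one_pos).comp_sub_left b
  simpa using h

theorem integral_gaussian_sub (b : ℝ) : ∫ y : ℝ, Real.exp (-(b - y) ^ 2) = √Real.pi := by
  have h := MeasureTheory.integral_sub_left_eq_self (fun y : ℝ => Real.exp (-y ^ 2))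
    MeasureTheory.volume b
  rw [h]
  simpa using integral_gaussian 1

theorem integrable_cexp_sub_sq (u : ℂ) : MeasureTheory.Integrable fun y : ℝ =>
    Complex.exp ((u - Complex.I * y) ^ 2) := by
  refine ((integrable_gaussian_sub u.im).const_mul (Real.exp (u.re ^ 2))).mono'
    (by fun_prop) (Eventually.of_forall fun y => (norm_cexp_sub_sq u y).le)

theorem integral_cexp_sub_sq (u : ℂ) :
    ∫ y : ℝ, Complex.exp ((u - Complex.I * y) ^ 2) = ((√Real.pi : ℝ) : ℂ) := by
  have h := integral_cexp_quadratic (b := -1) (by simp) (-2 * Complex.I * u) (u ^ 2)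
  have e : ∀ y : ℝ, (u - Complex.I * y) ^ 2 = -1 * (y : ℂ) ^ 2 + -2 * Complex.I * u * y + u ^ 2 := by
    intro y
    ring_nf
    simp [Complex.I_sq]
    ring
  simp_rw [e]
  rw [h]
  have e2 : u ^ 2 - (-2 * Complex.I * u) ^ 2 / (4 * -1) = 0 := by
    ring_nf
    simp [Complex.I_sq]
  rw [e2, Complex.exp_zero, mul_one, neg_neg, div_one, Real.sqrt_eq_rpow,
    Complex.ofReal_cpow Real.pi_pos.le]
  norm_num

theorem norm_smoothCutoff_le (R : ℝ) (hR : 0 ≤ R) (u : ℂ) :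
    ‖smoothCutoff R u‖ ≤ Real.exp (u.re ^ 2) := by
  have hpi : 0 < √Real.pi := Real.sqrt_pos.2 Real.pi_pos
  rw [smoothCutoff, norm_mul, Complex.norm_real, Real.norm_of_nonneg (by positivity)]
  have h1 : ‖∫ y in -R..R, Complex.exp ((u - Complex.I * y) ^ 2)‖ ≤
      Real.exp (u.re ^ 2) * √Real.pi := by
    rw [intervalIntegral.integral_of_le (by linarith), ← integral_gaussian_sub u.im,
      ← MeasureTheory.integral_const_mul]
    refine (MeasureTheory.norm_integral_le_integral_norm _).trans ?_
    simp_rw [norm_cexp_sub_sq]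
    exact MeasureTheory.setIntegral_le_integral ((integrable_gaussian_sub u.im).const_mul _)
      (Eventually.of_forall fun y => by positivity)
  calc _ ≤ 1 / √Real.pi * (Real.exp (u.re ^ 2) * √Real.pi) := by gcongr
    _ = _ := by field_simp

theorem exp_one_le_sqrt_pi_mul : Real.exp 1 / 2 ≤ √Real.pi := by
  have h1 := Real.exp_one_lt_d9
  have h2 : (1.5 : ℝ) ≤ √Real.pi := by
    rw [Real.le_sqrt (by norm_num) Real.pi_pos.le]
    nlinarith [Real.pi_gt_three]
  linarith

/-- The mass of a Gaussian to the right of a point. -/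
theorem integral_Ioi_gaussian_sub_le (b c : ℝ) :
    ∫ y in Set.Ioi c, Real.exp (-(b - y) ^ 2) ≤ √Real.pi * Real.exp (-2 * (c - b)) := by
  have h1 : ∀ y : ℝ, Real.exp (-(b - y) ^ 2) ≤ Real.exp (1 + 2 * b) * Real.exp (-2 * y) := by
    intro y
    rw [← Real.exp_add]
    refine (Real.exp_le_exp.2 ?_)
    nlinarith [sq_nonneg (y - b - 1)]
  have h2 := MeasureTheory.setIntegral_mono (s := Set.Ioi c) (integrable_gaussian_sub b).integrableOn
    ((integrableOn_exp_mul_Ioi (a := -2) (by norm_num) c).const_mul (Real.exp (1 + 2 * b))) h1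
  refine h2.trans ?_
  rw [MeasureTheory.integral_const_mul, integral_exp_mul_Ioi (by norm_num)]
  have h3 := exp_one_le_sqrt_pi_mul
  have h4 : Real.exp (1 + 2 * b) * (-Real.exp (-2 * c) / -2) =
      Real.exp 1 / 2 * Real.exp (-2 * (c - b)) := by
    have : Real.exp (-2 * (c - b)) = Real.exp (2 * b) * Real.exp (-2 * c) := by
      rw [← Real.exp_add]; ring_nf
    rw [this, Real.exp_add]; ring
  rw [h4]
  gcongr

theorem integral_Iic_gaussian_sub_le (b c : ℝ) :
    ∫ y in Set.Iic c, Real.exp (-(b - y) ^ 2) ≤ √Real.pi * Real.exp (-2 * (b - c)) := by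
  have h := integral_Ioi_gaussian_sub_le (-b) (-c)
  have e := integral_comp_neg_Iic c fun y => Real.exp (-(-b - y) ^ 2)
  have e2 : ∀ y : ℝ, (-b - -y) ^ 2 = (b - y) ^ 2 := fun y => by ring
  simp only [e2] at e
  rw [e]
  convert h using 3
  ring

/-- The cutoff is exponentially small above the transition zone. -/
theorem norm_smoothCutoff_le_of_le {R : ℝ} (hR : 0 ≤ R) (u : ℂ) :
    ‖smoothCutoff R u‖ ≤ 2 * Real.exp (u.re ^ 2) * Real.exp (-2 * (|u.im| - R)) := by
  have hpi : 0 < √Real.pi := Real.sqrt_pos.2 Real.pi_pos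
  rw [smoothCutoff, norm_mul, Complex.norm_real, Real.norm_of_nonneg (by positivity)]
  have h1 : ‖∫ y in -R..R, Complex.exp ((u - Complex.I * y) ^ 2)‖ ≤
      Real.exp (u.re ^ 2) * (√Real.pi * Real.exp (-2 * (|u.im| - R))) := by
    rw [intervalIntegral.integral_of_le (by linarith)]
    refine (MeasureTheory.norm_integral_le_integral_norm _).trans ?_
    simp_rw [norm_cexp_sub_sq]
    rw [MeasureTheory.integral_const_mul]
    gcongr
    rcases le_total 0 u.im with h | h
    · rw [abs_of_nonneg h]
      refine le_trans ?_ (integral_Iic_gaussian_sub_le u.im R)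
      exact MeasureTheory.setIntegral_mono_set (integrable_gaussian_sub u.im).integrableOn
        (Eventually.of_forall fun y => by positivity)
        (LE.le.eventuallyLE fun y hy => hy.2)
    · rw [abs_of_nonpos h]
      have := integral_Ioi_gaussian_sub_le u.im (-R)
      refine le_trans ?_ (this.trans (le_of_eq (by ring_nf)))
      exact MeasureTheory.setIntegral_mono_set (integrable_gaussian_sub u.im).integrableOn
        (Eventually.of_forall fun y => by positivity)
        (LE.le.eventuallyLE fun y hy => hy.1)
  calc _ ≤ 1 / √Real.pi * (Real.exp (u.re ^ 2) * (√Real.pi * Real.exp (-2 * (|u.im| - R)))) := by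
        gcongr
    _ = 1 * Real.exp (u.re ^ 2) * Real.exp (-2 * (|u.im| - R)) := by field_simp
    _ ≤ _ := by gcongr; norm_num

/-- The cutoff is exponentially close to `1` below the transition zone. -/
theorem norm_smoothCutoff_sub_one_le (R : ℝ) (u : ℂ) :
    ‖smoothCutoff R u - 1‖ ≤ 2 * Real.exp (u.re ^ 2) * Real.exp (-2 * (R - |u.im|)) := by
  have hpi : 0 < √Real.pi := Real.sqrt_pos.2 Real.pi_pos
  set f : ℝ → ℂ := fun y => Complex.exp ((u - Complex.I * y) ^ 2) with hf
  have hfi : MeasureTheory.Integrable f := integrable_cexp_sub_sq u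
  have hsplit : (∫ y in -R..R, f y) =
      √Real.pi - (∫ y in Set.Iic (-R), f y) - ∫ y in Set.Ioi R, f y := by
    rw [← integral_cexp_sub_sq u, ← intervalIntegral.integral_Iic_sub_Iic hfi.integrableOn
      hfi.integrableOn, ← MeasureTheory.setIntegral_univ (μ := MeasureTheory.volume),
      ← Set.Iic_union_Ioi (a := R), MeasureTheory.setIntegral_union
        (Set.Iic_disjoint_Ioi le_rfl) measurableSet_Ioi hfi.integrableOn hfi.integrableOn]
    ring
  have e : smoothCutoff R u - 1 = -(((1 / √Real.pi : ℝ) : ℂ) *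
      ((∫ y in Set.Iic (-R), f y) + ∫ y in Set.Ioi R, f y)) := by
    rw [smoothCutoff, hsplit]
    have : ((√Real.pi : ℝ) : ℂ) ≠ 0 := by exact_mod_cast hpi.ne'
    push_cast
    field_simp
    ring
  have hn : ∀ s : Set ℝ, ‖∫ y in s, f y‖ ≤
      Real.exp (u.re ^ 2) * ∫ y in s, Real.exp (-(u.im - y) ^ 2) := by
    intro s
    refine (MeasureTheory.norm_integral_le_integral_norm _).trans (le_of_eq ?_)
    simp_rw [hf, norm_cexp_sub_sq]
    rw [MeasureTheory.integral_const_mul]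
  have h1 := (hn (Set.Iic (-R))).trans (mul_le_mul_of_nonneg_left
    ((integral_Iic_gaussian_sub_le u.im (-R)).trans (mul_le_mul_of_nonneg_left
      (Real.exp_le_exp.2 (by linarith [neg_abs_le u.im] :
        -2 * (u.im - -R) ≤ -2 * (R - |u.im|))) hpi.le)) (Real.exp_pos _).le)
  have h2 := (hn (Set.Ioi R)).trans (mul_le_mul_of_nonneg_left
    ((integral_Ioi_gaussian_sub_le u.im R).trans (mul_le_mul_of_nonneg_left
      (Real.exp_le_exp.2 (by linarith [le_abs_self u.im] :
        -2 * (R - u.im) ≤ -2 * (R - |u.im|))) hpi.le)) (Real.exp_pos _).le)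
  rw [e, norm_neg, norm_mul, Complex.norm_real, Real.norm_of_nonneg (by positivity)]
  calc _ ≤ 1 / √Real.pi * (Real.exp (u.re ^ 2) * (√Real.pi * Real.exp (-2 * (R - |u.im|))) +
        Real.exp (u.re ^ 2) * (√Real.pi * Real.exp (-2 * (R - |u.im|)))) := by
        gcongr
        exact (norm_add_le _ _).trans (add_le_add h1 h2)
    _ = _ := by field_simp; ring

theorem tendsto_smoothCutoff (u : ℂ) : Tendsto (fun R : ℝ => smoothCutoff R u) atTop (𝓝 1) := by
  rw [tendsto_iff_norm_sub_tendsto_zero]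
  have h : Tendsto (fun R : ℝ => 2 * Real.exp (u.re ^ 2) * Real.exp (-2 * (R - |u.im|))) atTop
      (𝓝 (2 * Real.exp (u.re ^ 2) * 0)) := by
    refine Tendsto.const_mul _ (Real.tendsto_exp_atBot.comp ?_)
    have h2 := (tendsto_atTop_add_const_right atTop (-|u.im|) tendsto_id).const_mul_atTop_of_neg
      (r := (-2 : ℝ)) (by norm_num)
    exact h2
  rw [mul_zero] at h
  exact squeeze_zero (fun R => norm_nonneg _) (fun R => norm_smoothCutoff_sub_one_le R u) h

/-- The Gamma integral for a complex scaling parameter. -/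
theorem Complex.integral_cpow_mul_exp_neg_mul_Ioi_of_re_pos {a z : ℂ} (ha : 0 < a.re)
    (hz : 0 < z.re) :
    ∫ t : ℝ in Set.Ioi 0, (t : ℂ) ^ (a - 1) * Complex.exp (-(z * t)) =
      z ^ (-a) * Complex.Gamma a := by
  set U : Set ℂ := {w | 0 < w.re} with hU
  have hUo : IsOpen U := isOpen_lt continuous_const Complex.continuous_re
  have hmeas : ∀ (b w : ℂ), MeasureTheory.AEStronglyMeasurable
      (fun t : ℝ => (t : ℂ) ^ b * Complex.exp (-(w * t)))
      (MeasureTheory.volume.restrict (Set.Ioi 0)) := by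
    intro b w
    refine ContinuousOn.aestronglyMeasurable (fun t ht => ContinuousAt.continuousWithinAt ?_)
      measurableSet_Ioi
    refine ContinuousAt.mul ?_ (by fun_prop)
    exact (continuousAt_ofReal_cpow_const t b (Or.inr (ne_of_gt ht)))
  have hnorm : ∀ (b w : ℂ) (t : ℝ), 0 < t → ‖(t : ℂ) ^ b * Complex.exp (-(w * t))‖ =
      t ^ b.re * Real.exp (-(w.re * t)) := by
    intro b w t ht
    rw [norm_mul, Complex.norm_cpow_eq_rpow_re_of_pos ht, Complex.norm_exp]
    simp
  have hint : ∀ (b : ℝ) (r : ℝ), -1 < b → 0 < r → MeasureTheory.IntegrableOn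
      (fun t : ℝ => t ^ b * Real.exp (-(r * t))) (Set.Ioi 0) := by
    intro b r hb hr
    have := integrableOn_rpow_mul_exp_neg_mul_rpow (p := 1) hb one_pos hr
    simpa using this
  have hdiff : DifferentiableOn ℂ (fun w : ℂ =>
      ∫ t : ℝ in Set.Ioi 0, (t : ℂ) ^ (a - 1) * Complex.exp (-(w * t))) U := by
    intro w hw
    have hw' : 0 < w.re := hw
    refine (hasDerivAt_integral_of_dominated_loc_of_deriv_le
      (F := fun (w : ℂ) (t : ℝ) => (t : ℂ) ^ (a - 1) * Complex.exp (-(w * t)))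
      (F' := fun (w : ℂ) (t : ℝ) => (t : ℂ) ^ (a - 1) * (Complex.exp (-(w * t)) * (-t)))
      (bound := fun t => t ^ a.re * Real.exp (-(w.re / 2 * t)))
      (s := {v : ℂ | w.re / 2 < v.re}) ?_ ?_ ?_ ?_ ?_ ?_ ?_).2.differentiableAt.differentiableWithinAt
    · exact (isOpen_lt continuous_const Complex.continuous_re).mem_nhds
        (by simp only [Set.mem_ofPred_eq]; linarith)
    · exact Eventually.of_forall fun v => hmeas _ v
    · refine (hint (a.re - 1) w.re (by linarith) hw').mono' (hmeas _ w) ?_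
      filter_upwards [MeasureTheory.ae_restrict_mem measurableSet_Ioi] with t ht
      rw [hnorm _ _ t ht]
      simp
    · have := (hmeas (a - 1) w).mul (g := fun t : ℝ => (-t : ℂ)) (by fun_prop)
      refine this.congr (Eventually.of_forall fun t => ?_)
      simp only [Pi.mul_apply]; ring
    · filter_upwards [MeasureTheory.ae_restrict_mem measurableSet_Ioi] with t ht v hv
      have ht' : 0 < t := ht
      have hv' : w.re / 2 < v.re := hv
      rw [← mul_assoc, norm_mul, hnorm _ _ t ht, norm_neg, Complex.norm_real,
        Real.norm_of_nonneg ht'.le, mul_right_comm]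
      have : t ^ (a - 1).re * t = t ^ a.re := by
        rw [← Real.rpow_add_one ht'.ne']; simp
      rw [this]
      gcongr
    · exact hint a.re (w.re / 2) (by linarith) (by linarith)
    · refine Eventually.of_forall fun t v _ => ?_
      have h1 : HasDerivAt (fun v : ℂ => -(v * t)) (-(t : ℂ)) v := by
        simpa using ((hasDerivAt_id v).mul_const (t : ℂ)).fun_neg
      exact (h1.cexp).const_mul _
  have hdiff2 : DifferentiableOn ℂ (fun w : ℂ => w ^ (-a) * Complex.Gamma a) U := by
    intro w hw
    refine DifferentiableAt.differentiableWithinAt ?_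
    exact ((differentiableAt_id.cpow_const (Or.inl hw)).mul_const _)
  have hpre : IsPreconnected U := (convex_halfSpace_re_gt 0).isPreconnected
  refine (hdiff.analyticOnNhd hUo).eqOn_of_preconnected_of_frequently_eq
    (hdiff2.analyticOnNhd hUo) hpre (z₀ := 1) (by simp [hU]) ?_ hz
  have h1 : Tendsto (fun n : ℕ => (((1 + 1 / ((n : ℝ) + 1) : ℝ)) : ℂ)) atTop (𝓝[≠] 1) := by
    refine tendsto_nhdsWithin_iff.2 ⟨?_, Eventually.of_forall fun n => ?_⟩
    · have := (tendsto_one_div_add_atTop_nhds_zero_nat (𝕜 := ℝ)).const_add 1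
      rw [add_zero] at this
      exact_mod_cast (Complex.continuous_ofReal.tendsto _).comp this
    · have : (0 : ℝ) < 1 / ((n : ℝ) + 1) := by positivity
      rw [Set.mem_compl_iff, Set.mem_singleton_iff, ← Complex.ofReal_one, Complex.ofReal_inj]
      linarith
  refine h1.frequently (Frequently.of_forall fun n => ?_)
  have hr : (0 : ℝ) < 1 + 1 / ((n : ℝ) + 1) := by positivity
  rw [Complex.integral_cpow_mul_exp_neg_mul_Ioi ha hr, one_div, Complex.inv_cpow, Complex.cpow_neg]
  rw [Complex.arg_ofReal_of_nonneg hr.le]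
  exact Real.pi_pos.ne

/-! ### The Fourier transform of the cutoff -/

theorem integrable_comp_abs {f : ℝ → ℝ} (hf : MeasureTheory.IntegrableOn f (Set.Ioi 0)) :
    MeasureTheory.Integrable fun x : ℝ => f |x| := by
  rw [← MeasureTheory.integrableOn_univ, ← Set.Iic_union_Ioi (a := (0 : ℝ))]
  have h2 : MeasureTheory.IntegrableOn (fun x : ℝ => f |x|) (Set.Ioi 0) :=
    hf.congr_fun (fun x hx => by rw [abs_of_pos (Set.mem_Ioi.1 hx)]) measurableSet_Ioi
  refine MeasureTheory.IntegrableOn.union ?_ h2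
  rw [integrableOn_Iic_iff_integrableOn_Iio]
  have h3 := MeasureTheory.IntegrableOn.comp_neg h2
  simpa using h3

theorem integrable_exp_neg_mul_abs {a : ℝ} (ha : 0 < a) :
    MeasureTheory.Integrable fun x : ℝ => Real.exp (-a * |x|) :=
  integrable_comp_abs (f := fun x => Real.exp (-a * x))
    (integrableOn_exp_mul_Ioi (a := -a) (by linarith) 0)

/-- The Gamma integral after the substitution `t = exp ξ`. -/
theorem integral_cexp_mul_cexp_neg_mul_exp {a z : ℂ} (ha : 0 < a.re) (hz : 0 < z.re) :
    ∫ ξ : ℝ, Complex.exp (a * ξ) * Complex.exp (-(z * Real.exp ξ)) =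
      z ^ (-a) * Complex.Gamma a := by
  have h := MeasureTheory.integral_image_eq_integral_abs_deriv_smul (s := Set.univ)
    MeasurableSet.univ (f := Real.exp) (f' := Real.exp)
    (fun x _ => (Real.hasDerivAt_exp x).hasDerivWithinAt) Real.exp_injective.injOn
    (fun t : ℝ => (t : ℂ) ^ (a - 1) * Complex.exp (-(z * t)))
  rw [Set.image_univ, Real.range_exp,
    Complex.integral_cpow_mul_exp_neg_mul_Ioi_of_re_pos ha hz] at h
  rw [h, MeasureTheory.setIntegral_univ]
  congr 1 with ξ
  rw [abs_of_pos (Real.exp_pos ξ), Complex.real_smul, ← mul_assoc]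
  congr 1
  rw [Complex.cpow_def_of_ne_zero (by simp), ← Complex.ofReal_log (Real.exp_pos _).le, Real.log_exp,
    Complex.ofReal_exp, ← Complex.exp_add]
  congr 1
  ring

theorem integrable_exp_mul_exp_neg_mul_exp {b r : ℝ} (hb : 0 < b) (hr : 0 < r) :
    MeasureTheory.Integrable fun ξ : ℝ => Real.exp (b * ξ) * Real.exp (-(r * Real.exp ξ)) := by
  have h := MeasureTheory.integrableOn_image_iff_integrableOn_abs_deriv_smul (s := Set.univ)
    MeasurableSet.univ (f := Real.exp) (f' := Real.exp)
    (fun x _ => (Real.hasDerivAt_exp x).hasDerivWithinAt) Real.exp_injective.injOn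
    (fun t : ℝ => t ^ (b - 1) * Real.exp (-(r * t)))
  rw [Set.image_univ, Real.range_exp, MeasureTheory.integrableOn_univ] at h
  have h2 : MeasureTheory.IntegrableOn (fun t : ℝ => t ^ (b - 1) * Real.exp (-(r * t)))
      (Set.Ioi 0) := by
    have := integrableOn_rpow_mul_exp_neg_mul_rpow (p := 1) (s := b - 1) (by linarith) one_pos hr
    simpa using this
  refine (h.1 h2).congr (Eventually.of_forall fun ξ => ?_)
  simp only [smul_eq_mul]
  rw [abs_of_pos (Real.exp_pos ξ), ← mul_assoc]
  congr 1
  rw [Real.rpow_def_of_pos (Real.exp_pos _), Real.log_exp, ← Real.exp_add]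
  congr 1
  ring

/-- The Fourier transform of the smooth cutoff on a vertical line, up to normalisation: a
Dirichlet kernel times a Gaussian. -/
noncomputable def cutoffKernel (R ξ : ℝ) : ℂ :=
  ((1 / (2 * Real.pi) : ℝ) : ℂ) * (∫ y in -R..R, Complex.exp (y * ξ * Complex.I)) *
    Complex.exp (-(ξ : ℂ) ^ 2 / 4)

theorem continuous_dirichlet (R : ℝ) :
    Continuous fun ξ : ℝ => ∫ y in -R..R, Complex.exp (y * ξ * Complex.I) :=
  intervalIntegral.continuous_parametric_intervalIntegral_of_continuous' (by fun_prop) _ _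

theorem continuous_cutoffKernel (R : ℝ) : Continuous (cutoffKernel R) :=
  (continuous_const.mul (continuous_dirichlet R)).mul (by fun_prop)

theorem integral_cexp_add_sq (c ξ : ℝ) :
    ∫ v : ℝ, Complex.exp ((c + v * Complex.I) * ξ) * Complex.exp ((c + v * Complex.I) ^ 2) =
      ((√Real.pi : ℝ) : ℂ) * Complex.exp (-(ξ : ℂ) ^ 2 / 4) := by
  have h := integral_cexp_quadratic (b := -1) (by simp) ((2 * c + ξ) * Complex.I) (c ^ 2 + c * ξ)
  have e : ∀ v : ℝ, Complex.exp ((c + v * Complex.I) * ξ) * Complex.exp ((c + v * Complex.I) ^ 2) =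
      Complex.exp (-1 * (v : ℂ) ^ 2 + (2 * c + ξ) * Complex.I * v + (c ^ 2 + c * ξ)) := by
    intro v
    rw [← Complex.exp_add]
    congr 1
    ring_nf
    simp [Complex.I_sq]
    ring
  simp_rw [e]
  rw [h]
  have e2 : (c : ℂ) ^ 2 + c * ξ - ((2 * c + ξ) * Complex.I) ^ 2 / (4 * -1) = -(ξ : ℂ) ^ 2 / 4 := by
    ring_nf
    simp [Complex.I_sq]
    ring
  rw [e2, neg_neg, div_one, Real.sqrt_eq_rpow, Complex.ofReal_cpow Real.pi_pos.le]
  norm_num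

theorem integrable_cexp_add_sq (c ξ : ℝ) : MeasureTheory.Integrable fun v : ℝ =>
    Complex.exp ((c + v * Complex.I) * ξ) * Complex.exp ((c + v * Complex.I) ^ 2) := by
  refine ((integrable_gaussian_sub 0).const_mul (Real.exp (c * ξ + c ^ 2))).mono'
    (by fun_prop) (Eventually.of_forall fun v => le_of_eq ?_)
  rw [← Complex.exp_add, Complex.norm_exp, ← Real.exp_add]
  congr 1
  simp [pow_two]
  ring

/-- On a vertical line the cutoff is the convolution of an indicator function with a Gaussian, so its
Fourier transform is a product. -/
theorem integral_cexp_mul_smoothCutoff {R : ℝ} (hR : 0 ≤ R) (c ξ : ℝ) :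
    ∫ v : ℝ, Complex.exp ((c + v * Complex.I) * ξ) * smoothCutoff R (c + v * Complex.I) =
      2 * Real.pi * cutoffKernel R ξ := by
  have hpi : ((√Real.pi : ℝ) : ℂ) ≠ 0 := by
    exact_mod_cast (Real.sqrt_pos.2 Real.pi_pos).ne'
  set g : ℝ → ℂ := fun v => Complex.exp ((c + v * Complex.I) * ξ) *
    Complex.exp ((c + v * Complex.I) ^ 2) with hg
  set F : ℝ → ℝ → ℂ := fun v y => Complex.exp (y * ξ * Complex.I) * g (v - y) with hF
  have hFc : Continuous (Function.uncurry F) := by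
    simp only [hF, hg, Function.uncurry_def]
    fun_prop
  have hgn : ∀ y : ℝ, ∀ v : ℝ, ‖F v y‖ = ‖g (v - y)‖ := by
    intro y v
    simp only [hF]
    rw [norm_mul]
    have : ‖Complex.exp (y * ξ * Complex.I)‖ = 1 := by
      rw [← Complex.ofReal_mul]; exact Complex.norm_exp_ofReal_mul_I _
    rw [this, one_mul]
  have hFi : ∀ y : ℝ, MeasureTheory.Integrable fun v => F v y := fun y =>
    ((integrable_cexp_add_sq c ξ).comp_sub_right y).const_mul _
  have hint : MeasureTheory.Integrable (Function.uncurry F)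
      (MeasureTheory.volume.prod (MeasureTheory.volume.restrict (Set.Ioc (-R) R))) := by
    rw [MeasureTheory.integrable_prod_iff' hFc.aestronglyMeasurable]
    refine ⟨Eventually.of_forall fun y => hFi y, ?_⟩
    have : ∀ y : ℝ, ∫ v, ‖Function.uncurry F (v, y)‖ = ∫ v, ‖g v‖ := by
      intro y
      simp only [Function.uncurry_apply_pair, hgn y]
      exact MeasureTheory.integral_sub_right_eq_self (fun v => ‖g v‖) y
    simp only [this]
    exact MeasureTheory.integrable_const _
  have e1 : ∀ v : ℝ, Complex.exp ((c + v * Complex.I) * ξ) * smoothCutoff R (c + v * Complex.I) =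
      ((1 / √Real.pi : ℝ) : ℂ) * ∫ y in Set.Ioc (-R) R, F v y := by
    intro v
    rw [smoothCutoff, intervalIntegral.integral_of_le (by linarith), mul_left_comm,
      ← MeasureTheory.integral_const_mul]
    congr 2 with y
    simp only [hF, hg]
    rw [← Complex.exp_add, ← Complex.exp_add, ← Complex.exp_add]
    congr 1
    push_cast
    ring
  simp_rw [e1]
  rw [MeasureTheory.integral_const_mul, MeasureTheory.integral_integral_swap hint]
  have e2 : ∀ y : ℝ, ∫ v, F v y =
      Complex.exp (y * ξ * Complex.I) * (((√Real.pi : ℝ) : ℂ) * Complex.exp (-(ξ : ℂ) ^ 2 / 4)) := by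
    intro y
    simp only [hF]
    rw [MeasureTheory.integral_const_mul, MeasureTheory.integral_sub_right_eq_self g y,
      integral_cexp_add_sq]
  simp_rw [e2]
  rw [MeasureTheory.integral_mul_const, cutoffKernel, intervalIntegral.integral_of_le (by linarith)]
  push_cast
  have := Complex.ofReal_ne_zero.2 Real.pi_ne_zero
  field_simp
  congr 1 with y
  congr 1
  ring

/-- Interpolation between the bounds `2 R` and `2 / |ξ|` of the Dirichlet kernel. -/
theorem norm_dirichlet_le {R : ℝ} (hR : 0 ≤ R) {ε : ℝ} (hε : 0 ≤ ε) (hε1 : ε ≤ 1) {ξ : ℝ}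
    (hξ : ξ ≠ 0) :
    ‖∫ y in -R..R, Complex.exp (y * ξ * Complex.I)‖ ≤ 2 * (R ^ ε * |ξ| ^ (ε - 1)) := by
  have hξ' : 0 < |ξ| := abs_pos.2 hξ
  set D := ‖∫ y in -R..R, Complex.exp (y * ξ * Complex.I)‖
  have h1 : D ≤ 2 * R := by
    have := intervalIntegral.norm_integral_le_of_norm_le_const (a := -R) (b := R) (C := 1)
      (f := fun y : ℝ => Complex.exp (y * ξ * Complex.I)) (fun y _ => by
        rw [← Complex.ofReal_mul]; exact (Complex.norm_exp_ofReal_mul_I _).le)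
    rw [one_mul, sub_neg_eq_add, abs_of_nonneg (by linarith)] at this
    linarith
  have h2 : D ≤ 2 * |ξ|⁻¹ := by
    have hne : (ξ : ℂ) * Complex.I ≠ 0 := mul_ne_zero (by exact_mod_cast hξ) Complex.I_ne_zero
    have e : ∀ y : ℝ, Complex.exp (y * ξ * Complex.I) = Complex.exp ((ξ * Complex.I) * y) :=
      fun y => by congr 1; ring
    simp only [D, e]
    rw [integral_exp_mul_complex hne, norm_div, norm_mul, Complex.norm_I, mul_one,
      Complex.norm_real, Real.norm_eq_abs, div_eq_mul_inv]
    gcongr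
    refine (norm_sub_le _ _).trans ?_
    have : ∀ y : ℝ, ‖Complex.exp (ξ * Complex.I * y)‖ = 1 := by
      intro y
      rw [← e, ← Complex.ofReal_mul]; exact Complex.norm_exp_ofReal_mul_I _
    rw [this, this]; norm_num
  have hD : 0 ≤ D / 2 := by positivity
  have e : D / 2 = (D / 2) ^ ε * (D / 2) ^ (1 - ε) := by
    rw [← Real.rpow_add' hD (by norm_num)]; simp
  have h3 : D / 2 ≤ R ^ ε * |ξ| ^ (ε - 1) := by
    rw [e, show ε - 1 = -(1 - ε) by ring, Real.rpow_neg hξ'.le, ← Real.inv_rpow hξ'.le]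
    have : 0 ≤ 1 - ε := by linarith
    gcongr <;> linarith
  linarith

/-- For `ε > 0` the bound is integrable near `ξ = 0`, at the price of a factor `R ^ ε`. -/
theorem norm_cutoffKernel_le {R : ℝ} (hR : 0 ≤ R) {ε : ℝ} (hε : 0 ≤ ε) (hε1 : ε ≤ 1) {ξ : ℝ}
    (hξ : ξ ≠ 0) :
    ‖cutoffKernel R ξ‖ ≤ R ^ ε * |ξ| ^ (ε - 1) * Real.exp (-ξ ^ 2 / 4) := by
  rw [cutoffKernel, norm_mul, norm_mul, Complex.norm_real, Real.norm_of_nonneg (by positivity)]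
  have e : ‖Complex.exp (-(ξ : ℂ) ^ 2 / 4)‖ = Real.exp (-ξ ^ 2 / 4) := by
    rw [← Complex.norm_of_nonneg (Real.exp_pos _).le]
    push_cast
    rfl
  rw [e]
  gcongr ?_ * _
  calc 1 / (2 * Real.pi) * ‖∫ y in -R..R, Complex.exp (y * ξ * Complex.I)‖
      ≤ 1 / (2 * Real.pi) * (2 * (R ^ ε * |ξ| ^ (ε - 1))) := by
        gcongr
        exact norm_dirichlet_le hR hε hε1 hξ
    _ = (R ^ ε * |ξ| ^ (ε - 1)) * (1 / Real.pi) := by field_simp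
    _ ≤ (R ^ ε * |ξ| ^ (ε - 1)) * 1 := by
        gcongr
        rw [div_le_one Real.pi_pos]
        linarith [Real.pi_gt_three]
    _ = _ := mul_one _

theorem exp_neg_sq_div_four_mul_exp_le (ξ : ℝ) :
    Real.exp (-ξ ^ 2 / 4) * Real.exp (3 * |ξ|) ≤ Real.exp 16 * Real.exp (-1 * |ξ|) := by
  rw [← Real.exp_add, ← Real.exp_add]
  refine Real.exp_le_exp.2 ?_
  nlinarith [sq_abs ξ, sq_nonneg (|ξ| - 8)]

theorem integrable_abs_rpow_mul_exp {ε : ℝ} (hε : 0 < ε) :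
    MeasureTheory.Integrable fun ξ : ℝ => |ξ| ^ (ε - 1) * Real.exp (-1 * |ξ|) := by
  refine integrable_comp_abs (f := fun x => x ^ (ε - 1) * Real.exp (-1 * x)) ?_
  have := integrableOn_rpow_mul_exp_neg_mul_rpow (p := 1) (s := ε - 1) (b := 1) (by linarith)
    one_pos one_pos
  simpa using this

/-- The mass of the kernel against weights of exponential growth is at most `C R ^ ε`. -/
theorem exists_lintegral_cutoffKernel_le {ε : ℝ} (hε : 0 < ε) (hε1 : ε ≤ 1) :
    ∃ C > 0, ∀ R, 0 ≤ R → ∀ f : ℝ → ℝ, Continuous f → (∀ ξ, |f ξ| ≤ Real.exp (3 * |ξ|)) →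
      MeasureTheory.Integrable (fun ξ => ‖cutoffKernel R ξ‖ * f ξ) ∧
      ∫ ξ, ‖cutoffKernel R ξ‖ * |f ξ| ≤ C * R ^ ε := by
  set g : ℝ → ℝ := fun ξ => |ξ| ^ (ε - 1) * Real.exp (-1 * |ξ|) with hg
  have hgi : MeasureTheory.Integrable g := integrable_abs_rpow_mul_exp hε
  have hg0 : 0 ≤ ∫ ξ, g ξ := MeasureTheory.integral_nonneg fun ξ => by simp only [hg]; positivity
  refine ⟨Real.exp 16 * (∫ ξ, g ξ) + 1, by positivity, fun R hR f hf hfb => ?_⟩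
  have hb : ∀ᵐ ξ : ℝ, ‖cutoffKernel R ξ‖ * |f ξ| ≤ Real.exp 16 * R ^ ε * g ξ := by
    have h0 : ∀ᵐ ξ : ℝ, ξ ≠ 0 := by
      rw [MeasureTheory.ae_iff]; simp
    filter_upwards [h0] with ξ hξ
    calc _ ≤ (R ^ ε * |ξ| ^ (ε - 1) * Real.exp (-ξ ^ 2 / 4)) * Real.exp (3 * |ξ|) := by
          gcongr
          · exact norm_cutoffKernel_le hR hε.le hε1 hξ
          · exact hfb ξ
      _ = (R ^ ε * |ξ| ^ (ε - 1)) * (Real.exp (-ξ ^ 2 / 4) * Real.exp (3 * |ξ|)) := by ring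
      _ ≤ (R ^ ε * |ξ| ^ (ε - 1)) * (Real.exp 16 * Real.exp (-1 * |ξ|)) := by
          gcongr ?_ * ?_
          exact exp_neg_sq_div_four_mul_exp_le ξ
      _ = _ := by simp only [hg]; ring
  have hint : MeasureTheory.Integrable (fun ξ => ‖cutoffKernel R ξ‖ * f ξ) := by
    refine (hgi.const_mul (Real.exp 16 * R ^ ε)).mono'
      ((continuous_cutoffKernel R).norm.mul hf).aestronglyMeasurable ?_
    filter_upwards [hb] with ξ h
    rwa [norm_mul, norm_norm, Real.norm_eq_abs]
  refine ⟨hint, ?_⟩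
  have h2 := MeasureTheory.integral_mono_ae (f := fun ξ => ‖cutoffKernel R ξ‖ * |f ξ|) (by
    refine hint.norm.congr (Eventually.of_forall fun ξ => ?_)
    simp [norm_mul]) (hgi.const_mul (Real.exp 16 * R ^ ε)) hb
  refine h2.trans ?_
  rw [MeasureTheory.integral_const_mul]
  have : 0 ≤ R ^ ε := by positivity
  nlinarith

/-! ### Smoothed exponentials -/

/-- A smoothed version of `exp (i x)`: the part with frequencies below `R`, in the logarithmic
variable `ξ`, of `exp (-ξ² / 4 - s ξ + i x exp ξ)`, evaluated at `ξ = 0`. -/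
noncomputable def smoothedExp (s R x : ℝ) : ℂ :=
  ∫ ξ : ℝ, cutoffKernel R ξ * Complex.exp (-(s * ξ)) * Complex.exp (x * Real.exp ξ * Complex.I)

/-- The Gamma function, twisted by the exponential that makes it polynomially bounded in the
lower half-plane. -/
noncomputable def twistedGamma (z : ℂ) : ℂ :=
  Complex.Gamma z * Complex.exp (Real.pi / 2 * Complex.I * z)

theorem norm_cexp_pi_half_mul (z : ℂ) :
    ‖Complex.exp (Real.pi / 2 * Complex.I * z)‖ = Real.exp (-(Real.pi / 2 * z.im)) := by
  rw [Complex.norm_exp]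
  congr 1
  have : (Real.pi / 2 * Complex.I * z : ℂ) = ((Real.pi / 2 : ℝ) : ℂ) * (Complex.I * z) := by
    push_cast; ring
  rw [this, Complex.re_ofReal_mul]
  simp

theorem norm_twistedGamma_le {z : ℂ} (hz : 0 < z.re) :
    ‖twistedGamma z‖ ≤ Real.Gamma z.re * Real.exp (Real.pi / 2 * |z.im|) := by
  rw [twistedGamma, norm_mul, norm_cexp_pi_half_mul]
  have := Real.Gamma_pos_of_pos hz
  gcongr
  · exact Complex.norm_Gamma_le_Gamma_re hz
  · nlinarith [neg_abs_le z.im, Real.pi_pos]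

theorem integrable_exp_mul_norm_smoothCutoff {R : ℝ} (hR : 0 ≤ R) {b : ℝ} (hb : b < 2) (c : ℝ) :
    MeasureTheory.Integrable fun v : ℝ =>
      Real.exp (b * |v|) * ‖smoothCutoff R (c + v * Complex.I)‖ := by
  have h1 := (integrable_exp_neg_mul_abs (a := 2 - b) (by linarith)).const_mul
    (2 * Real.exp (c ^ 2) * Real.exp (2 * R))
  refine h1.mono' ?_ (Eventually.of_forall fun v => ?_)
  · refine Continuous.aestronglyMeasurable ?_
    have := (differentiable_smoothCutoff R).continuous
    fun_prop
  · rw [Real.norm_of_nonneg (by positivity)]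
    have h2 := norm_smoothCutoff_le_of_le hR (c + v * Complex.I)
    simp only [Complex.add_re, Complex.ofReal_re, Complex.mul_re, Complex.I_re, mul_zero,
      Complex.ofReal_im, Complex.I_im, mul_one, sub_self, add_zero, Complex.add_im, Complex.mul_im,
      zero_add] at h2
    calc _ ≤ Real.exp (b * |v|) * (2 * Real.exp (c ^ 2) * Real.exp (-2 * (|v| - R))) := by gcongr
      _ = 2 * Real.exp (c ^ 2) * (Real.exp (b * |v|) * Real.exp (-2 * (|v| - R))) := by ring
      _ = 2 * Real.exp (c ^ 2) * (Real.exp (2 * R) * Real.exp (-(2 - b) * |v|)) := by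
        rw [← Real.exp_add, ← Real.exp_add]; ring_nf
      _ = _ := by ring

theorem integrable_smoothCutoff {R : ℝ} (hR : 0 ≤ R) (c : ℝ) :
    MeasureTheory.Integrable fun v : ℝ => smoothCutoff R (c + v * Complex.I) := by
  have h := integrable_exp_mul_norm_smoothCutoff hR (b := 0) (by norm_num) c
  simp only [zero_mul, Real.exp_zero, one_mul] at h
  refine (MeasureTheory.integrable_norm_iff ?_).1 h
  have := (differentiable_smoothCutoff R).continuous
  exact Continuous.aestronglyMeasurable (by fun_prop)

theorem continuous_Gamma_line {σ : ℝ} (hσ : 0 < σ) :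
    Continuous fun v : ℝ => Complex.Gamma (σ + v * Complex.I) := by
  refine continuous_iff_continuousAt.2 fun v => ?_
  have h : ContinuousAt Complex.Gamma (σ + v * Complex.I) := by
    refine (Complex.differentiableAt_Gamma _ fun m hm => ?_).continuousAt
    have := congrArg Complex.re hm
    simp at this
    have h0 : (0 : ℝ) ≤ m := Nat.cast_nonneg m
    linarith
  exact ContinuousAt.comp (f := fun v : ℝ => (σ + v * Complex.I : ℂ)) h (by fun_prop)

/-- Insert Euler's integral for `Γ(u) z⁻ᵘ`, with the substitution `t = exp ξ`, and interchange the
integrations. -/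
theorem integral_Gamma_mul_smoothCutoff_of_re_pos {s σ R : ℝ} (hσ : 0 < σ) (hR : 0 ≤ R) {z : ℂ}
    (hz : 0 < z.re) :
    ∫ v : ℝ, z ^ (-(σ + v * Complex.I)) * Complex.Gamma (σ + v * Complex.I) *
        smoothCutoff R ((s + σ : ℝ) + v * Complex.I) =
      2 * Real.pi * ∫ ξ : ℝ, cutoffKernel R ξ * Complex.exp (-(s * ξ)) *
        Complex.exp (-(z * Real.exp ξ)) := by
  set F : ℝ → ℝ → ℂ := fun v ξ => Complex.exp ((σ + v * Complex.I) * ξ) *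
    Complex.exp (-(z * Real.exp ξ)) * smoothCutoff R ((s + σ : ℝ) + v * Complex.I) with hF
  have hFc : Continuous (Function.uncurry F) := by
    have := (differentiable_smoothCutoff R).continuous
    simp only [hF, Function.uncurry_def]
    fun_prop
  have hFn : ∀ v ξ : ℝ, ‖F v ξ‖ = ‖smoothCutoff R ((s + σ : ℝ) + v * Complex.I)‖ *
      (Real.exp (σ * ξ) * Real.exp (-(z.re * Real.exp ξ))) := by
    intro v ξ
    simp only [hF]
    rw [norm_mul, norm_mul, Complex.norm_exp, Complex.norm_exp, mul_comm]
    congr 3 <;> simp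
    left
    exact Complex.ofReal_re _
  have hint : MeasureTheory.Integrable (Function.uncurry F)
      (MeasureTheory.volume.prod MeasureTheory.volume) := by
    refine (((integrable_smoothCutoff hR (s + σ)).norm).mul_prod
      (integrable_exp_mul_exp_neg_mul_exp hσ hz)).mono' hFc.aestronglyMeasurable
      (Eventually.of_forall fun p => ?_)
    exact (hFn p.1 p.2).le
  have e1 : ∀ v : ℝ, z ^ (-(σ + v * Complex.I)) * Complex.Gamma (σ + v * Complex.I) *
      smoothCutoff R ((s + σ : ℝ) + v * Complex.I) = ∫ ξ, F v ξ := by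
    intro v
    simp only [hF]
    rw [MeasureTheory.integral_mul_const, integral_cexp_mul_cexp_neg_mul_exp (by simpa using hσ) hz]
  simp_rw [e1]
  rw [MeasureTheory.integral_integral_swap hint, ← MeasureTheory.integral_const_mul]
  congr 1 with ξ
  have e2 : ∀ v : ℝ, F v ξ = Complex.exp (-(s * ξ)) * Complex.exp (-(z * Real.exp ξ)) *
      (Complex.exp (((s + σ : ℝ) + v * Complex.I) * ξ) *
        smoothCutoff R ((s + σ : ℝ) + v * Complex.I)) := by
    intro v
    simp only [hF]
    have : Complex.exp ((σ + v * Complex.I) * ξ) = Complex.exp (-(s * ξ)) *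
        Complex.exp (((s + σ : ℝ) + v * Complex.I) * ξ) := by
      rw [← Complex.exp_add]; congr 1; push_cast; ring
    rw [this]; ring
  simp_rw [e2]
  rw [MeasureTheory.integral_const_mul, integral_cexp_mul_smoothCutoff hR]
  ring

theorem integrable_cutoffKernel_mul {s : ℝ} (hs : |s| ≤ 3) {R : ℝ} (hR : 0 ≤ R) :
    MeasureTheory.Integrable fun ξ : ℝ => cutoffKernel R ξ * Complex.exp (-(s * ξ)) := by
  obtain ⟨C, _, hC⟩ := exists_lintegral_cutoffKernel_le one_pos le_rfl
  have h := (hC R hR (fun ξ => Real.exp (-(s * ξ))) (by fun_prop) (fun ξ => by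
    rw [abs_of_pos (Real.exp_pos _)]
    refine Real.exp_le_exp.2 ?_
    calc -(s * ξ) ≤ |s * ξ| := neg_le_abs _
      _ = |s| * |ξ| := abs_mul _ _
      _ ≤ 3 * |ξ| := by gcongr)).1
  refine h.mono' ?_ (Eventually.of_forall fun ξ => le_of_eq ?_)
  · have := continuous_cutoffKernel R
    exact Continuous.aestronglyMeasurable (by fun_prop)
  · rw [norm_mul, Complex.norm_exp]
    simp

/-- The line integral of the twisted Gamma function against the smooth cutoff: the boundary case
`z = -i x` of Euler's integral, approached from the right half-plane. -/
theorem integral_twistedGamma_mul_smoothCutoff {s σ R x : ℝ} (hs : |s| ≤ 3) (hσ : 0 < σ)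
    (hR : 0 ≤ R) (hx : 0 < x) :
    ∫ v : ℝ, twistedGamma (σ + v * Complex.I) * (x : ℂ) ^ (-(σ + v * Complex.I)) *
        smoothCutoff R ((s + σ : ℝ) + v * Complex.I) =
      2 * Real.pi * smoothedExp s R x := by
  set Z : ℝ → ℂ := fun δ => δ - x * Complex.I with hZ
  have hZre : ∀ δ, (Z δ).re = δ := fun δ => by simp [hZ]
  have hZim : ∀ δ, (Z δ).im = -x := fun δ => by simp [hZ]
  have hZ0 : ∀ δ, Z δ ≠ 0 := fun δ h => by
    have := congrArg Complex.im h
    rw [hZim] at this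
    simp at this
    linarith
  have hZx : ∀ δ, x ≤ ‖Z δ‖ := fun δ => by
    have := Complex.abs_im_le_norm (Z δ)
    rwa [hZim, abs_neg, abs_of_pos hx] at this
  have hZc : Tendsto Z (𝓝[>] 0) (𝓝 (Z 0)) :=
    (Continuous.tendsto (by simp only [hZ]; fun_prop) 0).mono_left nhdsWithin_le_nhds
  have hk := integrable_cutoffKernel_mul hs hR
  have hR1 : Tendsto (fun δ => ∫ ξ : ℝ, cutoffKernel R ξ * Complex.exp (-(s * ξ)) *
      Complex.exp (-(Z δ * Real.exp ξ))) (𝓝[>] 0) (𝓝 (smoothedExp s R x)) := by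
    refine MeasureTheory.tendsto_integral_filter_of_dominated_convergence
      (fun ξ => ‖cutoffKernel R ξ * Complex.exp (-(s * ξ))‖) ?_ ?_ hk.norm ?_
    · refine Eventually.of_forall fun δ => ?_
      have := continuous_cutoffKernel R
      exact Continuous.aestronglyMeasurable (by fun_prop)
    · filter_upwards [self_mem_nhdsWithin] with δ hδ
      refine Eventually.of_forall fun ξ => ?_
      rw [norm_mul]
      refine mul_le_of_le_one_right (norm_nonneg _) ?_
      rw [Complex.norm_exp, Complex.neg_re, Complex.re_mul_ofReal, hZre, Real.exp_le_one_iff]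
      have : (0 : ℝ) < δ := hδ
      have := Real.exp_pos ξ
      simp only [Left.neg_nonpos_iff]
      positivity
    · refine Eventually.of_forall fun ξ => Tendsto.const_mul _ ?_
      have h1 : Continuous fun z : ℂ => Complex.exp (-(z * Real.exp ξ)) := by fun_prop
      have h2 := (h1.tendsto (Z 0)).comp hZc
      have h3 : Z 0 = -(x * Complex.I) := by simp [hZ]
      have h4 : (x : ℂ) * Real.exp ξ * Complex.I = -(Z 0 * Real.exp ξ) := by rw [h3]; ring
      rw [h4]
      exact h2
  have hL1 : Tendsto (fun δ => ∫ v : ℝ, Z δ ^ (-(σ + v * Complex.I)) *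
      Complex.Gamma (σ + v * Complex.I) * smoothCutoff R ((s + σ : ℝ) + v * Complex.I)) (𝓝[>] 0)
      (𝓝 (∫ v : ℝ, twistedGamma (σ + v * Complex.I) * (x : ℂ) ^ (-(σ + v * Complex.I)) *
        smoothCutoff R ((s + σ : ℝ) + v * Complex.I))) := by
    -- the cutoff decays like `exp (-2 |v|)`, which beats the factor `exp (π |v| / 2)`
    have hpi : Real.pi / 2 < 2 := by linarith [Real.pi_lt_d2]
    refine MeasureTheory.tendsto_integral_filter_of_dominated_convergence
      (fun v => x ^ (-σ) * Real.Gamma σ * (Real.exp (Real.pi / 2 * |v|) *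
        ‖smoothCutoff R ((s + σ : ℝ) + v * Complex.I)‖)) ?_ ?_
        ((integrable_exp_mul_norm_smoothCutoff hR hpi _).const_mul _) ?_
    · refine Eventually.of_forall fun δ => ?_
      have h1 := continuous_Gamma_line hσ
      have h2 := (differentiable_smoothCutoff R).continuous
      have h3 : Continuous fun v : ℝ => Z δ ^ (-(σ + v * Complex.I)) := by
        refine Continuous.const_cpow (by fun_prop) (Or.inl (hZ0 δ))
      exact Continuous.aestronglyMeasurable (by fun_prop)
    · filter_upwards [self_mem_nhdsWithin] with δ hδ
      refine Eventually.of_forall fun v => ?_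
      have hG := Complex.norm_Gamma_le_Gamma_re (z := σ + v * Complex.I) (by simpa using hσ)
      have hGp := Real.Gamma_pos_of_pos hσ
      simp only [Complex.add_re, Complex.ofReal_re, Complex.mul_re, Complex.I_re, mul_zero,
        Complex.ofReal_im, Complex.I_im, mul_one, sub_self, add_zero] at hG
      have hz : ‖Z δ ^ (-(σ + v * Complex.I))‖ ≤ x ^ (-σ) * Real.exp (Real.pi / 2 * |v|) := by
        rw [Complex.norm_cpow_of_ne_zero (hZ0 δ)]
        simp only [Complex.neg_re, Complex.add_re, Complex.ofReal_re, Complex.mul_re, Complex.I_re,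
          mul_zero, Complex.ofReal_im, Complex.I_im, mul_one, sub_self, add_zero, Complex.neg_im,
          Complex.add_im, Complex.mul_im, zero_add]
        rw [div_eq_mul_inv, ← Real.exp_neg]
        gcongr ?_ * Real.exp ?_
        · exact Real.rpow_le_rpow_of_nonpos hx (hZx δ) (by linarith)
        · have ha : |(Z δ).arg| ≤ Real.pi / 2 := by
            rw [Complex.abs_arg_le_pi_div_two_iff, hZre]
            exact le_of_lt hδ
          calc -((Z δ).arg * -v) ≤ |(Z δ).arg * v| := by
                rw [mul_neg, neg_neg]; exact le_abs_self _
            _ = |(Z δ).arg| * |v| := abs_mul _ _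
            _ ≤ _ := by gcongr
      rw [norm_mul, norm_mul]
      calc _ ≤ (x ^ (-σ) * Real.exp (Real.pi / 2 * |v|)) * Real.Gamma σ *
            ‖smoothCutoff R ((s + σ : ℝ) + v * Complex.I)‖ := by gcongr
        _ = _ := by ring
    · refine Eventually.of_forall fun v => Tendsto.mul_const _ ?_
      have h1 : ContinuousAt (fun z : ℂ => z ^ (-(σ + v * Complex.I))) (Z 0) := by
        refine continuousAt_cpow_const (Complex.mem_slitPlane_iff.2 (Or.inr ?_))
        rw [hZim]; linarith
      have h2 := (h1.tendsto.comp hZc).mul_const (Complex.Gamma (σ + v * Complex.I))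
      have hlog : Complex.log (Z 0) = Complex.log x - Real.pi / 2 * Complex.I := by
        have : Z 0 = (x : ℂ) * -Complex.I := by simp [hZ]
        rw [this, Complex.log_ofReal_mul hx (by simp), Complex.log_neg_I, Complex.ofReal_log hx.le]
        ring
      have key : twistedGamma (σ + v * Complex.I) * (x : ℂ) ^ (-(σ + v * Complex.I)) =
          Z 0 ^ (-(σ + v * Complex.I)) * Complex.Gamma (σ + v * Complex.I) := by
        rw [twistedGamma, Complex.cpow_def_of_ne_zero (hZ0 0), hlog,
          Complex.cpow_def_of_ne_zero (by exact_mod_cast hx.ne'), mul_assoc, ← Complex.exp_add,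
          mul_comm]
        congr 2
        ring
      rw [key]
      exact h2
  have hEq : (fun δ => ∫ v : ℝ, Z δ ^ (-(σ + v * Complex.I)) *
      Complex.Gamma (σ + v * Complex.I) * smoothCutoff R ((s + σ : ℝ) + v * Complex.I)) =ᶠ[𝓝[>] 0]
      fun δ => 2 * Real.pi * ∫ ξ : ℝ, cutoffKernel R ξ * Complex.exp (-(s * ξ)) *
        Complex.exp (-(Z δ * Real.exp ξ)) := by
    filter_upwards [self_mem_nhdsWithin] with δ hδ
    exact integral_Gamma_mul_smoothCutoff_of_re_pos hσ hR (by rw [hZre]; exact hδ)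
  exact tendsto_nhds_unique (hL1.congr' hEq) (hR1.const_mul _)

/-- The twisted exponential whose value at `0` is recovered by Fourier inversion. -/
noncomputable def expPhase (s x ξ : ℝ) : ℂ :=
  Complex.exp (-(ξ : ℂ) ^ 2 / 4 - s * ξ + x * Real.exp ξ * Complex.I)

/-- The logarithmic derivative of `expPhase`. -/
noncomputable def expPhaseLogDeriv (s x ξ : ℝ) : ℂ := -(ξ : ℂ) / 2 - s + x * Real.exp ξ * Complex.I

theorem hasDerivAt_expPhase (s x ξ : ℝ) :
    HasDerivAt (expPhase s x) (expPhaseLogDeriv s x ξ * expPhase s x ξ) ξ := by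
  have h0 : HasDerivAt (fun ξ : ℝ => (ξ : ℂ)) 1 ξ := Complex.ofRealCLM.hasDerivAt
  have h1 : HasDerivAt (fun ξ : ℝ => ((Real.exp ξ : ℝ) : ℂ)) (Real.exp ξ : ℝ) ξ :=
    (Real.hasDerivAt_exp ξ).ofReal_comp
  have h2 : HasDerivAt (fun ξ : ℝ => -(ξ : ℂ) ^ 2 / 4 - s * ξ + x * Real.exp ξ * Complex.I)
      (expPhaseLogDeriv s x ξ) ξ := by
    have := (((h0.fun_pow 2).fun_neg.div_const 4).fun_sub (h0.const_mul (s : ℂ))).fun_add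
      ((h1.const_mul (x : ℂ)).mul_const Complex.I)
    refine this.congr_deriv ?_
    simp only [expPhaseLogDeriv]
    push_cast
    ring
  rw [mul_comm]
  exact h2.cexp

theorem hasDerivAt_expPhaseLogDeriv (s x ξ : ℝ) :
    HasDerivAt (expPhaseLogDeriv s x) (-1 / 2 + x * Real.exp ξ * Complex.I) ξ := by
  have h0 : HasDerivAt (fun ξ : ℝ => (ξ : ℂ)) 1 ξ := Complex.ofRealCLM.hasDerivAt
  have h1 : HasDerivAt (fun ξ : ℝ => ((Real.exp ξ : ℝ) : ℂ)) (Real.exp ξ : ℝ) ξ :=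
    (Real.hasDerivAt_exp ξ).ofReal_comp
  exact ((h0.fun_neg.div_const 2).sub_const (s : ℂ)).fun_add
      ((h1.const_mul (x : ℂ)).mul_const Complex.I)

theorem norm_expPhase_le {s : ℝ} (hs : |s| ≤ 1) (x ξ : ℝ) :
    ‖expPhase s x ξ‖ ≤ Real.exp (-ξ ^ 2 / 4) * Real.exp |ξ| := by
  rw [expPhase, Complex.norm_exp, ← Real.exp_add]
  refine Real.exp_le_exp.2 ?_
  have e : (-(ξ : ℂ) ^ 2 / 4 - s * ξ + x * Real.exp ξ * Complex.I).re = -ξ ^ 2 / 4 - s * ξ := by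
    have e1 : (-(ξ : ℂ) ^ 2 / 4 - s * ξ + x * Real.exp ξ * Complex.I) =
      ((-ξ ^ 2 / 4 - s * ξ : ℝ) : ℂ) + ((x * Real.exp ξ : ℝ) : ℂ) * Complex.I := by
      push_cast; ring
    rw [e1, Complex.add_re, Complex.ofReal_re, Complex.re_ofReal_mul]
    simp
  rw [e]
  have : -(s * ξ) ≤ |ξ| := by
    calc -(s * ξ) ≤ |s * ξ| := neg_le_abs _
      _ = |s| * |ξ| := abs_mul _ _
      _ ≤ 1 * |ξ| := by gcongr
      _ = |ξ| := one_mul _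
  linarith

theorem norm_expPhaseLogDeriv_le {s : ℝ} (hs : |s| ≤ 1) {x : ℝ} (hx : 0 ≤ x) (ξ : ℝ) :
    ‖expPhaseLogDeriv s x ξ‖ ≤ (1 + x) * Real.exp |ξ| := by
  have h1 : ‖expPhaseLogDeriv s x ξ‖ ≤ |ξ| / 2 + |s| + x * Real.exp ξ := by
    rw [expPhaseLogDeriv]
    refine (norm_add_le _ _).trans (add_le_add ((norm_sub_le _ _).trans (add_le_add ?_ ?_)) ?_)
    · simp
    · simp
    · rw [norm_mul, norm_mul, Complex.norm_I, mul_one, Complex.norm_real, Complex.norm_real,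
        Real.norm_of_nonneg hx, Real.norm_of_nonneg (Real.exp_pos _).le]
  have h2 : |ξ| + 1 ≤ Real.exp |ξ| := Real.add_one_le_exp _
  have h3 : Real.exp ξ ≤ Real.exp |ξ| := Real.exp_le_exp.2 (le_abs_self _)
  nlinarith [abs_nonneg ξ]

theorem norm_expPhase_deriv_deriv_le {s : ℝ} (hs : |s| ≤ 1) {x : ℝ} (hx : 0 ≤ x) (ξ : ℝ) :
    ‖(-1 / 2 + x * Real.exp ξ * Complex.I) * expPhase s x ξ + expPhaseLogDeriv s x ξ *
      (expPhaseLogDeriv s x ξ * expPhase s x ξ)‖ ≤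
      2 * Real.exp 16 * (1 + x) ^ 2 * Real.exp (-1 * |ξ|) := by
  have h0 := norm_expPhase_le hs x ξ
  have h1 := norm_expPhaseLogDeriv_le hs hx ξ
  have he1 : 1 ≤ Real.exp |ξ| := Real.one_le_exp (abs_nonneg _)
  have h2 : ‖(-1 / 2 + x * Real.exp ξ * Complex.I : ℂ)‖ ≤ (1 + x) * Real.exp |ξ| := by
    refine (norm_add_le _ _).trans ?_
    rw [norm_mul, norm_mul, Complex.norm_I, mul_one, Complex.norm_real, Complex.norm_real,
        Real.norm_of_nonneg hx, Real.norm_of_nonneg (Real.exp_pos _).le]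
    have h3 : Real.exp ξ ≤ Real.exp |ξ| := Real.exp_le_exp.2 (le_abs_self _)
    have : ‖(-1 / 2 : ℂ)‖ = 1 / 2 := by norm_num
    rw [this]
    nlinarith
  have h3 : (1 + x) * Real.exp |ξ| ≤ ((1 + x) * Real.exp |ξ|) ^ 2 := by
    have : 1 ≤ (1 + x) * Real.exp |ξ| := by nlinarith
    nlinarith
  calc _ ≤ ‖(-1 / 2 + x * Real.exp ξ * Complex.I : ℂ)‖ * ‖expPhase s x ξ‖ +
        ‖expPhaseLogDeriv s x ξ‖ * (‖expPhaseLogDeriv s x ξ‖ * ‖expPhase s x ξ‖) := by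
        refine (norm_add_le _ _).trans (le_of_eq ?_)
        rw [norm_mul, norm_mul, norm_mul]
    _ ≤ ((1 + x) * Real.exp |ξ|) ^ 2 * ‖expPhase s x ξ‖ + ((1 + x) * Real.exp |ξ|) *
        (((1 + x) * Real.exp |ξ|) * ‖expPhase s x ξ‖) := by
        gcongr
        exact h2.trans h3
    _ = 2 * (1 + x) ^ 2 * (Real.exp |ξ|) ^ 2 * ‖expPhase s x ξ‖ := by ring
    _ ≤ 2 * (1 + x) ^ 2 * (Real.exp |ξ|) ^ 2 * (Real.exp (-ξ ^ 2 / 4) * Real.exp |ξ|) := by gcongr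
    _ = 2 * (1 + x) ^ 2 * (Real.exp (-ξ ^ 2 / 4) * Real.exp (3 * |ξ|)) := by
        rw [show 3 * |ξ| = |ξ| + |ξ| + |ξ| by ring, Real.exp_add, Real.exp_add]; ring
    _ ≤ 2 * (1 + x) ^ 2 * (Real.exp 16 * Real.exp (-1 * |ξ|)) :=
        mul_le_mul_of_nonneg_left (exp_neg_sq_div_four_mul_exp_le ξ) (by positivity)
    _ = _ := by ring

theorem integral_exp_neg_abs : ∫ ξ : ℝ, Real.exp (-1 * |ξ|) = 2 := by
  rw [integral_comp_abs (f := fun x => Real.exp (-1 * x)), integral_exp_mul_Ioi (by norm_num)]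
  simp

open FourierTransform in
/-- The decay comes from two derivatives, each of which costs a factor `1 + x`. -/
theorem norm_fourier_expPhase_le {s : ℝ} (hs : |s| ≤ 1) {x : ℝ} (hx : 0 ≤ x) (w : ℝ) :
    MeasureTheory.Integrable (expPhase s x) ∧
    w ^ 2 * ‖𝓕 (expPhase s x) w‖ ≤ Real.exp 16 / Real.pi ^ 2 * (1 + x) ^ 2 ∧
      ‖𝓕 (expPhase s x) w‖ ≤ 2 * Real.exp 16 := by
  set F := expPhase s x
  set F1 : ℝ → ℂ := fun ξ => expPhaseLogDeriv s x ξ * expPhase s x ξ with hF1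
  set F2 : ℝ → ℂ := fun ξ => (-1 / 2 + x * Real.exp ξ * Complex.I) * expPhase s x ξ +
    expPhaseLogDeriv s x ξ * (expPhaseLogDeriv s x ξ * expPhase s x ξ) with hF2
  have d0 : ∀ ξ, HasDerivAt F (F1 ξ) ξ := hasDerivAt_expPhase s x
  have d1 : ∀ ξ, HasDerivAt F1 (F2 ξ) ξ := fun ξ =>
    (hasDerivAt_expPhaseLogDeriv s x ξ).mul (hasDerivAt_expPhase s x ξ)
  have c0 : Continuous F := continuous_iff_continuousAt.2 fun ξ => (d0 ξ).continuousAt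
  have c1 : Continuous F1 := continuous_iff_continuousAt.2 fun ξ => (d1 ξ).continuousAt
  have cL : Continuous (expPhaseLogDeriv s x) :=
    continuous_iff_continuousAt.2 fun ξ => (hasDerivAt_expPhaseLogDeriv s x ξ).continuousAt
  have c2 : Continuous F2 := by
    have : Continuous (expPhase s x) := c0
    simp only [hF2]
    fun_prop
  have hi := integrable_exp_neg_mul_abs one_pos
  have b0 : ∀ ξ, ‖F ξ‖ ≤ Real.exp 16 * Real.exp (-1 * |ξ|) := fun ξ => by
    refine (norm_expPhase_le hs x ξ).trans (le_trans ?_ (exp_neg_sq_div_four_mul_exp_le ξ))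
    gcongr
    linarith [abs_nonneg ξ]
  have b1 : ∀ ξ, ‖F1 ξ‖ ≤ (1 + x) * Real.exp 16 * Real.exp (-1 * |ξ|) := fun ξ => by
    simp only [hF1]
    rw [norm_mul]
    have h := exp_neg_sq_div_four_mul_exp_le ξ
    calc _ ≤ ((1 + x) * Real.exp |ξ|) * (Real.exp (-ξ ^ 2 / 4) * Real.exp |ξ|) := by
          gcongr
          · exact norm_expPhaseLogDeriv_le hs hx ξ
          · exact norm_expPhase_le hs x ξ
      _ = (1 + x) * (Real.exp (-ξ ^ 2 / 4) * Real.exp (2 * |ξ|)) := by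
          rw [show 2 * |ξ| = |ξ| + |ξ| by ring, Real.exp_add]; ring
      _ ≤ (1 + x) * (Real.exp (-ξ ^ 2 / 4) * Real.exp (3 * |ξ|)) := by
          gcongr; norm_num
      _ ≤ (1 + x) * (Real.exp 16 * Real.exp (-1 * |ξ|)) := by gcongr
      _ = _ := by ring
  have b2 : ∀ ξ, ‖F2 ξ‖ ≤ 2 * Real.exp 16 * (1 + x) ^ 2 * Real.exp (-1 * |ξ|) :=
    norm_expPhase_deriv_deriv_le hs hx
  have i0 : MeasureTheory.Integrable F :=
    (hi.const_mul _).mono' c0.aestronglyMeasurable (Eventually.of_forall b0)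
  have i1 : MeasureTheory.Integrable F1 :=
    (hi.const_mul _).mono' c1.aestronglyMeasurable (Eventually.of_forall b1)
  have i2 : MeasureTheory.Integrable F2 :=
    (hi.const_mul _).mono' c2.aestronglyMeasurable (Eventually.of_forall b2)
  have e0 : deriv F = F1 := funext fun ξ => (d0 ξ).deriv
  have e1 : deriv F1 = F2 := funext fun ξ => (d1 ξ).deriv
  have f1 := Real.fourier_deriv i0 (fun ξ => (d0 ξ).differentiableAt) (by rwa [e0])
  have f2 := Real.fourier_deriv i1 (fun ξ => (d1 ξ).differentiableAt) (by rwa [e1])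
  rw [e0] at f1
  rw [e1, f1] at f2
  have hnorm : ∀ f : ℝ → ℂ, ‖𝓕 f w‖ ≤ ∫ ξ, ‖f ξ‖ := fun f => by
    rw [Real.fourier_real_eq_integral_exp_smul]
    refine (MeasureTheory.norm_integral_le_integral_norm _).trans (le_of_eq ?_)
    congr 1 with ξ
    rw [norm_smul, Complex.norm_exp_ofReal_mul_I, one_mul]
  refine ⟨i0, ?_, ?_⟩
  · have h1 := (hnorm F2).trans (MeasureTheory.integral_mono i2.norm (hi.const_mul _) b2)
    rw [MeasureTheory.integral_const_mul, integral_exp_neg_abs, f2] at h1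
    simp only [norm_smul, norm_mul, Complex.norm_ofNat, Complex.norm_real, Complex.norm_I, mul_one,
      Real.norm_eq_abs, abs_of_pos Real.pi_pos] at h1
    have h3 : (2 * Real.pi) ^ 2 * (w ^ 2 * ‖𝓕 F w‖) ≤ 2 * Real.exp 16 * (1 + x) ^ 2 * 2 := by
      rw [← sq_abs w]; linarith
    rw [div_mul_eq_mul_div, le_div_iff₀ (by positivity)]
    linarith
  · have h1 := (hnorm F).trans (MeasureTheory.integral_mono i0.norm (hi.const_mul _) b0)
    rw [MeasureTheory.integral_const_mul, integral_exp_neg_abs] at h1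
    linarith

theorem norm_integral_Ioi_le_div {g : ℝ → ℂ} {A r : ℝ} (hr : 0 < r)
    (hg : ∀ w, w ^ 2 * ‖g w‖ ≤ A) : ‖∫ w in Set.Ioi r, g w‖ ≤ A / r := by
  have h1 : MeasureTheory.IntegrableOn (fun w : ℝ => A * w ^ (-2 : ℝ)) (Set.Ioi r) :=
    (integrableOn_Ioi_rpow_of_lt (by norm_num) hr).const_mul A
  have h2 := MeasureTheory.norm_integral_le_of_norm_le (f := g) h1 (by
    filter_upwards [MeasureTheory.ae_restrict_mem measurableSet_Ioi] with w hw
    have hw0 : 0 < w := hr.trans hw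
    have := hg w
    rw [show (-2 : ℝ) = -(2 : ℕ) by norm_num, Real.rpow_neg hw0.le, Real.rpow_natCast,
      ← div_eq_mul_inv, le_div_iff₀ (by positivity)]
    linarith)
  refine h2.trans (le_of_eq ?_)
  rw [MeasureTheory.integral_const_mul, integral_Ioi_rpow_of_lt (by norm_num) hr]
  rw [show (-2 + 1 : ℝ) = -1 by norm_num, Real.rpow_neg_one]
  ring

theorem norm_integral_Iic_le_div {g : ℝ → ℂ} {A r : ℝ} (hr : 0 < r)
    (hg : ∀ w, w ^ 2 * ‖g w‖ ≤ A) : ‖∫ w in Set.Iic (-r), g w‖ ≤ A / r := by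
  have e := integral_comp_neg_Iic (-r) (fun y => g (-y))
  simp only [neg_neg] at e
  rw [e]
  exact norm_integral_Ioi_le_div hr fun w => by simpa using hg (-w)

open FourierTransform in
/-- The smoothed exponential approximates `exp (i x)`, by Fourier inversion. -/
theorem norm_smoothedExp_sub_le {s : ℝ} (hs : |s| ≤ 1) {x : ℝ} (hx : 0 ≤ x) {R : ℝ} (hR : 0 < R) :
    ‖smoothedExp s R x - Complex.exp (x * Complex.I)‖ ≤ 4 * Real.exp 16 * (1 + x) ^ 2 / R := by
  have hpi := Real.pi_pos
  set F := expPhase s x with hF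
  set g : ℝ → ℂ := 𝓕 F with hg
  set A : ℝ := Real.exp 16 / Real.pi ^ 2 * (1 + x) ^ 2 with hA
  have hFi : MeasureTheory.Integrable F := (norm_fourier_expPhase_le hs hx 0).1
  have hFc : Continuous F := continuous_iff_continuousAt.2 fun ξ =>
    (hasDerivAt_expPhase s x ξ).continuousAt
  have hg2 : ∀ w, w ^ 2 * ‖g w‖ ≤ A := fun w => (norm_fourier_expPhase_le hs hx w).2.1
  have hg1 : ∀ w, ‖g w‖ ≤ 2 * Real.exp 16 := fun w => (norm_fourier_expPhase_le hs hx w).2.2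
  have hgf : g = fun w => ∫ v : ℝ, Complex.exp (↑(-2 * Real.pi * v * w) * Complex.I) * F v := by
    ext w
    rw [hg, Real.fourier_real_eq_integral_exp_smul]
    rfl
  have hgc : Continuous g := by
    rw [hgf]
    refine MeasureTheory.continuous_of_dominated (bound := fun v => ‖F v‖) ?_ ?_ hFi.norm ?_
    · exact fun w => Continuous.aestronglyMeasurable (by fun_prop)
    · exact fun w => Eventually.of_forall fun v => by
        rw [norm_mul, Complex.norm_exp_ofReal_mul_I, one_mul]
    · exact Eventually.of_forall fun v => by fun_prop
  have hgi : MeasureTheory.Integrable g := by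
    refine (integrable_inv_one_add_sq.const_mul (2 * Real.exp 16 + A)).mono'
      hgc.aestronglyMeasurable (Eventually.of_forall fun w => ?_)
    rw [← div_eq_mul_inv, le_div_iff₀ (by positivity)]
    have := hg1 w
    have := hg2 w
    linarith
  have hinv : ∫ w, g w = F 0 := by
    rw [← hFi.fourierInv_fourier_eq hgi hFc.continuousAt, Real.fourierInv_eq']
    congr 1 with w
    simp [hg]
  have hF0 : F 0 = Complex.exp (x * Complex.I) := by simp [hF, expPhase]
  set r : ℝ := R / (2 * Real.pi) with hr
  have hr0 : 0 < r := by positivity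
  -- by Fubini the smoothed exponential is the inversion integral over the frequencies `|w| ≤ r`
  have hS : smoothedExp s R x = ∫ w in -r..r, g w := by
    have e1 : ∀ ξ : ℝ, cutoffKernel R ξ * Complex.exp (-(s * ξ)) *
        Complex.exp (x * Real.exp ξ * Complex.I) =
        ∫ w in Set.Ioc (-r) r, Complex.exp (↑(-2 * Real.pi * ξ * w) * Complex.I) * F ξ := by
      intro ξ
      have h1 := intervalIntegral.integral_comp_mul_left
        (a := -r) (b := r) (fun y : ℝ => Complex.exp (y * ξ * Complex.I))
        (c := -(2 * Real.pi)) (by linarith)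
      have h2 : -(2 * Real.pi) * r = -R := by rw [hr]; field_simp
      have h3 : -(2 * Real.pi) * -r = R := by rw [hr]; field_simp
      rw [h2, h3, intervalIntegral.integral_symm (-R) R] at h1
      rw [MeasureTheory.integral_mul_const, ← intervalIntegral.integral_of_le (by linarith)]
      have h4 : ∀ w : ℝ, Complex.exp (↑(-2 * Real.pi * ξ * w) * Complex.I) =
          Complex.exp (((-(2 * Real.pi) * w : ℝ) : ℂ) * ξ * Complex.I) := fun w => by
        congr 1; push_cast; ring
      simp_rw [h4]
      rw [h1, cutoffKernel, hF, expPhase, sub_add, Complex.exp_sub, Complex.exp_sub, Complex.exp_neg,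
        div_eq_mul_inv, div_eq_mul_inv (Complex.exp _), Complex.real_smul]
      push_cast
      have hI := Complex.exp_ne_zero (x * Complex.exp ξ * Complex.I)
      have hI2 := Complex.exp_ne_zero (s * ξ)
      have hpi' : (Real.pi : ℂ) ≠ 0 := by exact_mod_cast hpi.ne'
      field_simp
      congr 1 with y
      congr 1
      ring
    rw [smoothedExp]
    simp_rw [e1]
    rw [MeasureTheory.integral_integral_swap, intervalIntegral.integral_of_le (by linarith), hgf]
    refine (hFi.norm.mul_prod (g := fun _ : ℝ => (1 : ℝ))
      (ν := MeasureTheory.volume.restrict (Set.Ioc (-r) r))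
      (MeasureTheory.integrable_const _)).mono' ?_ (Eventually.of_forall fun p => ?_)
    · simp only [Function.uncurry_def]
      exact Continuous.aestronglyMeasurable (by fun_prop)
    · simp only [Function.uncurry_def]
      rw [norm_mul, Complex.norm_exp_ofReal_mul_I, one_mul, mul_one]
  have hsplit : (∫ w in -r..r, g w) - F 0 = -((∫ w in Set.Iic (-r), g w) + ∫ w in Set.Ioi r, g w) := by
    rw [← hinv, ← intervalIntegral.integral_Iic_sub_Iic hgi.integrableOn
      hgi.integrableOn, ← MeasureTheory.setIntegral_univ (μ := MeasureTheory.volume),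
      ← Set.Iic_union_Ioi (a := r), MeasureTheory.setIntegral_union
        (Set.Iic_disjoint_Ioi le_rfl) measurableSet_Ioi hgi.integrableOn hgi.integrableOn]
    ring
  rw [hS, ← hF0, hsplit, norm_neg]
  refine (norm_add_le _ _).trans ((add_le_add (norm_integral_Iic_le_div hr0 hg2)
    (norm_integral_Ioi_le_div hr0 hg2)).trans ?_)
  rw [hr, hA]
  have h1 : 3 < Real.pi := Real.pi_gt_three
  calc _ = (4 / Real.pi) * (Real.exp 16 * (1 + x) ^ 2 / R) := by field_simp; ring
    _ ≤ 4 * (Real.exp 16 * (1 + x) ^ 2 / R) := by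
        gcongr
        rw [div_le_iff₀ hpi]; linarith
    _ = _ := by ring

theorem norm_exp_real_mul_I_real (x y : ℝ) : ‖Complex.exp (x * y * Complex.I)‖ = 1 := by
  rw [← Complex.ofReal_mul]; exact Complex.norm_exp_ofReal_mul_I _

theorem norm_cutoffKernel_mul_cexp (s R ξ : ℝ) :
    ‖cutoffKernel R ξ * Complex.exp (-(s * ξ))‖ = ‖cutoffKernel R ξ‖ * Real.exp (-(s * ξ)) := by
  rw [norm_mul, Complex.norm_exp]
  simp

theorem exp_neg_mul_le_exp_abs {s : ℝ} (hs : |s| ≤ 1) (ξ : ℝ) : Real.exp (-(s * ξ)) ≤ Real.exp |ξ| := by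
  refine Real.exp_le_exp.2 ?_
  calc -(s * ξ) ≤ |s * ξ| := neg_le_abs _
    _ = |s| * |ξ| := abs_mul _ _
    _ ≤ 1 * |ξ| := by gcongr
    _ = |ξ| := one_mul _

theorem continuous_smoothedExp {s : ℝ} (hs : |s| ≤ 1) {R : ℝ} (hR : 0 ≤ R) :
    Continuous (smoothedExp s R) := by
  have hk := continuous_cutoffKernel R
  refine MeasureTheory.continuous_of_dominated
    (bound := fun ξ => ‖cutoffKernel R ξ * Complex.exp (-(s * ξ))‖) ?_ ?_
    (integrable_cutoffKernel_mul (by linarith) hR).norm ?_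
  · exact fun w => Continuous.aestronglyMeasurable (by fun_prop)
  · exact fun w => Eventually.of_forall fun v => by
      rw [norm_mul, norm_exp_real_mul_I_real, mul_one]
  · exact Eventually.of_forall fun v => by fun_prop

theorem exists_norm_smoothedExp_le {s : ℝ} (hs : |s| ≤ 1) {ε : ℝ} (hε : 0 < ε) (hε1 : ε ≤ 1) :
    ∃ C > 0, ∀ R, 0 ≤ R → ∀ x, ‖smoothedExp s R x‖ ≤ C * R ^ ε := by
  obtain ⟨C, hC0, hC⟩ := exists_lintegral_cutoffKernel_le hε hε1
  refine ⟨C, hC0, fun R hR x => ?_⟩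
  have h := (hC R hR (fun ξ => Real.exp (-(s * ξ))) (by fun_prop) (fun ξ => by
    rw [abs_of_pos (Real.exp_pos _)]
    refine (exp_neg_mul_le_exp_abs hs ξ).trans (Real.exp_le_exp.2 ?_)
    linarith [abs_nonneg ξ])).2
  refine le_trans ?_ h
  refine (MeasureTheory.norm_integral_le_integral_norm _).trans (le_of_eq ?_)
  congr 1 with ξ
  rw [norm_mul, norm_exp_real_mul_I_real, mul_one, norm_cutoffKernel_mul_cexp,
    abs_of_pos (Real.exp_pos _)]

/-! ### The weighted `L²` space and trigonometric polynomials -/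

/-- The measure `(1 + t)⁻³ dt` on `(0, ∞)`.  The Fourier transform of a smooth sieving function is
bounded by a multiple of this weight. -/
noncomputable def weightMeasure : MeasureTheory.Measure ℝ :=
  (MeasureTheory.volume.restrict (Set.Ioi 0)).withDensity
    fun t => ENNReal.ofReal (1 / (1 + t) ^ 3)

theorem measurable_weight : Measurable fun t : ℝ => ENNReal.ofReal (1 / (1 + t) ^ 3) := by
  fun_prop

theorem lintegral_weightMeasure {f : ℝ → ENNReal} (hf : AEMeasurable f) :
    ∫⁻ t, f t ∂weightMeasure = ∫⁻ t in Set.Ioi 0, ENNReal.ofReal (1 / (1 + t) ^ 3) * f t := by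
  rw [weightMeasure, MeasureTheory.lintegral_withDensity_eq_lintegral_mul₀
    measurable_weight.aemeasurable hf.restrict]
  rfl

theorem weightMeasure_absolutelyContinuous : weightMeasure.AbsolutelyContinuous
    (MeasureTheory.volume.restrict (Set.Ioi 0)) :=
  MeasureTheory.withDensity_absolutelyContinuous _ _

theorem ae_weightMeasure_pos : ∀ᵐ t ∂weightMeasure, 0 < t :=
  weightMeasure_absolutelyContinuous (MeasureTheory.ae_restrict_mem measurableSet_Ioi)

theorem eLpNorm_two_sq {α : Type*} {m : MeasurableSpace α} (μ : MeasureTheory.Measure α)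
    (f : α → ℂ) : (MeasureTheory.eLpNorm f 2 μ) ^ 2 = ∫⁻ t, ‖f t‖ₑ ^ 2 ∂μ := by
  have h := MeasureTheory.eLpNorm_nnreal_pow_eq_lintegral (f := f) (μ := μ) (p := 2) (by norm_num)
  norm_num at h
  exact_mod_cast h

theorem eLpNorm_two_le_of_lintegral_le {α : Type*} {m : MeasurableSpace α}
    {μ : MeasureTheory.Measure α} {f : α → ℂ} {B : ℝ} (hB : 0 ≤ B)
    (h : ∫⁻ t, ‖f t‖ₑ ^ 2 ∂μ ≤ ENNReal.ofReal (B ^ 2)) :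
    MeasureTheory.eLpNorm f 2 μ ≤ ENNReal.ofReal B := by
  rw [← eLpNorm_two_sq, ENNReal.ofReal_pow hB] at h
  exact (ENNReal.pow_le_pow_left_iff (by norm_num)).1 h

theorem lintegral_weightMeasure_le {f : ℝ → ENNReal} (hf : AEMeasurable f) {g : ℝ → ℝ}
    (hg : MeasureTheory.IntegrableOn (fun t => g t / (1 + t) ^ 3) (Set.Ioi 0))
    (h0 : ∀ t, 0 < t → 0 ≤ g t) (h : ∀ t, 0 < t → f t ≤ ENNReal.ofReal (g t)) :
    ∫⁻ t, f t ∂weightMeasure ≤ ENNReal.ofReal (∫ t in Set.Ioi 0, g t / (1 + t) ^ 3) := by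
  rw [lintegral_weightMeasure hf, MeasureTheory.ofReal_integral_eq_lintegral_ofReal hg (by
    filter_upwards [MeasureTheory.ae_restrict_mem measurableSet_Ioi] with t ht
    have ht0 : 0 < t := ht
    have := h0 t ht0
    simp only [Pi.zero_apply]
    positivity)]
  refine MeasureTheory.setLIntegral_mono' measurableSet_Ioi fun t ht => ?_
  have ht0 : 0 < t := ht
  rw [div_eq_mul_one_div (g t), mul_comm (g t), ENNReal.ofReal_mul (by positivity)]
  gcongr
  exact h t ht

theorem eLpNorm_weightMeasure_le {f : ℝ → ℂ} (hf : MeasureTheory.AEStronglyMeasurable f) {g : ℝ → ℝ}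
    (hg : MeasureTheory.IntegrableOn (fun t => g t / (1 + t) ^ 3) (Set.Ioi 0))
    (h : ∀ t, 0 < t → ‖f t‖ ^ 2 ≤ g t) {B : ℝ} (hB0 : 0 ≤ B)
    (hB : ∫ t in Set.Ioi 0, g t / (1 + t) ^ 3 ≤ B ^ 2) :
    MeasureTheory.eLpNorm f 2 weightMeasure ≤ ENNReal.ofReal B := by
  refine eLpNorm_two_le_of_lintegral_le hB0 ?_
  refine (lintegral_weightMeasure_le (by fun_prop) hg (fun t ht => (by positivity : 0 ≤ ‖f t‖ ^ 2).trans (h t ht)) fun t ht => ?_).trans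
    (ENNReal.ofReal_le_ofReal hB)
  rw [← ofReal_norm, ← ENNReal.ofReal_pow (norm_nonneg _)]
  exact ENNReal.ofReal_le_ofReal (h t ht)

theorem integrableOn_weight_two :
    MeasureTheory.IntegrableOn (fun t : ℝ => (1 + t) / (1 + t) ^ 3) (Set.Ioi 0) := by
  refine (integrable_inv_one_add_sq.integrableOn (s := Set.Ioi 0)).mono'
    (Measurable.aestronglyMeasurable (by fun_prop)) ?_
  filter_upwards [MeasureTheory.ae_restrict_mem measurableSet_Ioi] with t ht
  have ht0 : 0 < t := ht
  rw [Real.norm_of_nonneg (by positivity), div_le_iff₀ (by positivity), inv_mul_eq_div,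
    le_div_iff₀ (by positivity)]
  nlinarith [sq_nonneg t, mul_pos ht0 ht0, mul_pos (mul_pos ht0 ht0) ht0]

theorem integrableOn_weight :
    MeasureTheory.IntegrableOn (fun t : ℝ => 1 / (1 + t) ^ 3) (Set.Ioi 0) := by
  refine integrableOn_weight_two.mono'
    (Measurable.aestronglyMeasurable (by fun_prop)) ?_
  filter_upwards [MeasureTheory.ae_restrict_mem measurableSet_Ioi] with t ht
  have ht0 : 0 < t := ht
  rw [Real.norm_of_nonneg (by positivity)]
  gcongr
  linarith

/-- A trigonometric polynomial with nonnegative frequencies. -/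
noncomputable def trigSum (F : Finset ℕ) (a : ℕ → ℂ) (x : ℝ) : ℂ :=
  ∑ n ∈ F, a n * Complex.exp ((n * x : ℝ) * Complex.I)

theorem continuous_trigSum (F : Finset ℕ) (a : ℕ → ℂ) : Continuous (trigSum F a) := by
  unfold trigSum
  fun_prop

theorem norm_trigSum_le (F : Finset ℕ) (a : ℕ → ℂ) (x : ℝ) : ‖trigSum F a x‖ ≤ ∑ n ∈ F, ‖a n‖ := by
  refine (norm_sum_le _ _).trans (le_of_eq (Finset.sum_congr rfl fun n _ => ?_))
  rw [norm_mul, Complex.norm_exp_ofReal_mul_I, mul_one]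

theorem integral_cexp_int_period (k : ℤ) (b : ℝ) :
    ∫ x in b..(b + 2 * Real.pi), Complex.exp ((k * x : ℝ) * Complex.I) =
      ((if k = 0 then 2 * Real.pi else 0 : ℝ) : ℂ) := by
  split_ifs with hk
  · subst hk
    simp
  · have hne : (k : ℂ) * Complex.I ≠ 0 := mul_ne_zero (by exact_mod_cast hk) Complex.I_ne_zero
    have e : ∀ x : ℝ, Complex.exp ((k * x : ℝ) * Complex.I) = Complex.exp ((k * Complex.I) * x) :=
      fun x => by congr 1; push_cast; ring
    simp_rw [e]
    rw [integral_exp_mul_complex hne]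
    have : (k * Complex.I : ℂ) * ((b + 2 * Real.pi : ℝ) : ℂ) =
        k * Complex.I * b + k * (2 * Real.pi * Complex.I) := by push_cast; ring
    rw [this, Complex.exp_add, Complex.exp_int_mul_two_pi_mul_I, mul_one, sub_self, zero_div,
      Complex.ofReal_zero]

/-- Parseval's identity over one period. -/
theorem integral_norm_trigSum_sq_period (F : Finset ℕ) (a : ℕ → ℂ) (b : ℝ) :
    ∫ x in b..(b + 2 * Real.pi), ‖trigSum F a x‖ ^ 2 = 2 * Real.pi * ∑ n ∈ F, ‖a n‖ ^ 2 := by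
  rw [← Complex.ofReal_inj, ← intervalIntegral.integral_ofReal]
  have e : ∀ x : ℝ, ((‖trigSum F a x‖ ^ 2 : ℝ) : ℂ) = ∑ n ∈ F, ∑ m ∈ F,
      a n * (starRingEnd ℂ) (a m) * Complex.exp ((((n : ℤ) - m : ℤ) * x : ℝ) * Complex.I) := by
    intro x
    rw [Complex.ofReal_pow, ← Complex.mul_conj', trigSum, map_sum, Finset.sum_mul_sum]
    refine Finset.sum_congr rfl fun n _ => Finset.sum_congr rfl fun m _ => ?_
    rw [map_mul, ← Complex.exp_conj, mul_mul_mul_comm, ← Complex.exp_add]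
    congr 2
    rw [map_mul, Complex.conj_ofReal, Complex.conj_I]
    push_cast
    ring
  simp_rw [e]
  rw [intervalIntegral.integral_finsetSum fun n _ =>
    Continuous.intervalIntegrable (by fun_prop) _ _]
  have e2 : ∀ n, ∫ x in b..(b + 2 * Real.pi), ∑ m ∈ F, a n * (starRingEnd ℂ) (a m) *
      Complex.exp ((((n : ℤ) - m : ℤ) * x : ℝ) * Complex.I) =
      ∑ m ∈ F, a n * (starRingEnd ℂ) (a m) * ((if n = m then 2 * Real.pi else 0 : ℝ) : ℂ) := by
    intro n
    rw [intervalIntegral.integral_finsetSum fun m _ =>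
      Continuous.intervalIntegrable (by fun_prop) _ _]
    refine Finset.sum_congr rfl fun m _ => ?_
    rw [intervalIntegral.integral_const_mul, integral_cexp_int_period]
    simp only [sub_eq_zero, Nat.cast_inj]
  simp_rw [e2]
  push_cast
  rw [Finset.mul_sum]
  refine Finset.sum_congr rfl fun n hn => ?_
  rw [Finset.sum_eq_single n (fun m _ hm => by rw [if_neg hm.symm]; simp)
    (fun h => (h hn).elim), if_pos rfl, Complex.mul_conj']
  push_cast
  ring

/-- A Riemann sum of mesh `P` for `∫ (1 + t)⁻³ dt`, bounded by telescoping. -/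
theorem sum_weight_le {P : ℝ} (hP : 0 < P) (K : ℕ) :
    ∑ k ∈ Finset.range K, P / (1 + k * P) ^ 3 ≤ P + 1 := by
  have key : ∀ K : ℕ, ∑ k ∈ Finset.range (K + 1), P / (1 + k * P) ^ 3 ≤
      P + 1 - 1 / (1 + K * P) := by
    intro K
    induction K with
    | zero => simp
    | succ K ih =>
      rw [Finset.sum_range_succ]
      have h1 : (0 : ℝ) < 1 + K * P := by positivity
      have h2 : (0 : ℝ) < 1 + (K + 1) * P := by positivity
      have h3 : P / (1 + ((K + 1 : ℕ) : ℝ) * P) ^ 3 ≤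
          1 / (1 + K * P) - 1 / (1 + ((K + 1 : ℕ) : ℝ) * P) := by
        push_cast
        have e : 1 / (1 + K * P) - 1 / (1 + (K + 1) * P) = P / ((1 + K * P) * (1 + (K + 1) * P)) := by
          field_simp; ring
        rw [e]
        gcongr
        have h4 : 1 ≤ 1 + (K + 1) * P := by nlinarith [mul_nonneg (Nat.cast_nonneg (α := ℝ) K) hP.le]
        have h5 : 1 + K * P ≤ 1 + (K + 1) * P := by linarith
        calc (1 + K * P) * (1 + (K + 1) * P) ≤ (1 + (K + 1) * P) * (1 + (K + 1) * P) := by gcongr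
          _ = (1 + (K + 1) * P) ^ 2 := by ring
          _ ≤ (1 + (K + 1) * P) ^ 3 := pow_le_pow_right₀ h4 (by norm_num)
      linarith
  have hK := key K
  rw [Finset.sum_range_succ] at hK
  have h1 : 0 ≤ P / (1 + (K : ℝ) * P) ^ 3 := by positivity
  have h2 : 0 ≤ 1 / (1 + (K : ℝ) * P) := by positivity
  linarith

/-- Mean values of trigonometric polynomials in the weighted `L²` space, by periodicity. -/
theorem integral_norm_trigSum_sq_weight_le (F : Finset ℕ) (a : ℕ → ℂ) {τ : ℝ} (hτ : 0 < τ) :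
    MeasureTheory.IntegrableOn (fun t => ‖trigSum F a (τ * t)‖ ^ 2 / (1 + t) ^ 3) (Set.Ioi 0) ∧
    ∫ t in Set.Ioi 0, ‖trigSum F a (τ * t)‖ ^ 2 / (1 + t) ^ 3 ≤
      7 * (1 + 1 / τ) * ∑ n ∈ F, ‖a n‖ ^ 2 := by
  have hpi := Real.pi_pos
  have hc := continuous_trigSum F a
  set f : ℝ → ℝ := fun t => ‖trigSum F a (τ * t)‖ ^ 2 with hf
  have hfc : Continuous f := by simp only [hf]; fun_prop
  set S := ∑ n ∈ F, ‖a n‖ ^ 2 with hS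
  have hS0 : 0 ≤ S := Finset.sum_nonneg fun n _ => by positivity
  set P := 2 * Real.pi / τ with hP
  have hP0 : 0 < P := by positivity
  have hint : MeasureTheory.IntegrableOn (fun t => f t / (1 + t) ^ 3) (Set.Ioi 0) := by
    refine (integrableOn_weight.const_mul ((∑ n ∈ F, ‖a n‖) ^ 2)).mono'
      (hfc.measurable.div (by fun_prop)).aestronglyMeasurable ?_
    filter_upwards [MeasureTheory.ae_restrict_mem measurableSet_Ioi] with t ht
    have ht0 : 0 < t := ht
    rw [Real.norm_of_nonneg (by positivity), div_eq_mul_one_div]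
    gcongr
    exact pow_le_pow_left₀ (norm_nonneg _) (norm_trigSum_le F a _) 2
  refine ⟨hint, ?_⟩
  have hper : ∀ b, ∫ t in b..(b + P), f t = P * S := by
    intro b
    simp only [hf]
    rw [intervalIntegral.integral_comp_mul_left (fun x => ‖trigSum F a x‖ ^ 2) hτ.ne']
    have : τ * (b + P) = τ * b + 2 * Real.pi := by rw [hP]; field_simp
    rw [this, integral_norm_trigSum_sq_period, smul_eq_mul, hP, hS]
    field_simp
  have hcont : ∀ a b : ℝ, 0 ≤ a → a ≤ b →
      ContinuousOn (fun t => f t / (1 + t) ^ 3) (Set.uIcc a b) := by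
    intro a b ha hab
    refine hfc.continuousOn.div (by fun_prop) fun t ht => ?_
    rw [Set.uIcc_of_le hab] at ht
    have : 0 ≤ t := ha.trans ht.1
    positivity
  have hpiece : ∀ k : ℕ, ∫ t in (k * P)..((k + 1 : ℕ) * P), f t / (1 + t) ^ 3 ≤
      S * (P / (1 + k * P) ^ 3) := by
    intro k
    have e : ((k + 1 : ℕ) : ℝ) * P = k * P + P := by push_cast; ring
    rw [e]
    have hk : 0 ≤ (k : ℝ) * P := by positivity
    calc ∫ t in (k * P)..(k * P + P), f t / (1 + t) ^ 3
        ≤ ∫ t in (k * P)..(k * P + P), f t * (1 / (1 + k * P) ^ 3) := by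
          refine intervalIntegral.integral_mono_on (by linarith)
            (hcont _ _ hk (by linarith)).intervalIntegrable
            (Continuous.intervalIntegrable (by fun_prop) _ _) fun t ht => ?_
          rw [div_eq_mul_one_div]
          have h0 : 0 ≤ f t := by simp only [hf]; positivity
          have h1 := ht.1
          gcongr
      _ = _ := by
          rw [intervalIntegral.integral_mul_const, hper]
          ring
  have hfin : ∀ K : ℕ, ∫ t in (0 : ℝ)..(K * P), f t / (1 + t) ^ 3 ≤ (P + 1) * S := by
    intro K
    have h := intervalIntegral.sum_integral_adjacent_intervals (n := K)
      (a := fun k : ℕ => (k : ℝ) * P) (f := fun t => f t / (1 + t) ^ 3)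
      (μ := MeasureTheory.volume) (fun k _ =>
        (hcont _ _ (by positivity) (by push_cast; nlinarith)).intervalIntegrable)
    simp only [Nat.cast_zero, zero_mul] at h
    rw [← h]
    refine (Finset.sum_le_sum fun k _ => hpiece k).trans ?_
    rw [← Finset.mul_sum, mul_comm]
    gcongr
    exact sum_weight_le hP0 K
  have hlim := MeasureTheory.intervalIntegral_tendsto_integral_Ioi (0 : ℝ) hint
    (tendsto_natCast_atTop_atTop.atTop_mul_const hP0)
  refine (le_of_tendsto' hlim hfin).trans ?_
  have h3 : Real.pi < 3.5 := by linarith [Real.pi_lt_d2]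
  have h4 : P + 1 ≤ 7 * (1 + 1 / τ) := by
    rw [hP]
    have : 2 * Real.pi / τ ≤ 7 / τ := by gcongr; linarith
    have e : 7 * (1 + 1 / τ) = 7 + 7 / τ := by ring
    linarith
  gcongr

/-! ### Convergence in the weighted `L²` space -/

theorem sum_mul_smoothedExp {s : ℝ} (hs : |s| ≤ 1) {R : ℝ} (hR : 0 ≤ R) (F : Finset ℕ) (a : ℕ → ℂ)
    (t : ℝ) :
    ∑ n ∈ F, a n * smoothedExp s R (n * t) =
      ∫ ξ : ℝ, cutoffKernel R ξ * Complex.exp (-(s * ξ)) * trigSum F a (t * Real.exp ξ) := by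
  have hk := integrable_cutoffKernel_mul (s := s) (by linarith) hR
  simp_rw [trigSum, Finset.mul_sum]
  rw [MeasureTheory.integral_finsetSum]
  · refine Finset.sum_congr rfl fun n _ => ?_
    rw [smoothedExp, ← MeasureTheory.integral_const_mul]
    congr 1 with ξ
    rw [mul_left_comm (a n)]
    congr 3
    push_cast
    ring
  · intro n _
    refine (hk.norm.mul_const ‖a n‖).mono' ?_ (Eventually.of_forall fun ξ => ?_)
    · have := continuous_cutoffKernel R
      exact Continuous.aestronglyMeasurable (by fun_prop)
    · rw [norm_mul, norm_mul (a n), Complex.norm_exp_ofReal_mul_I, mul_one]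

instance : MeasureTheory.SFinite weightMeasure := by
  unfold weightMeasure
  infer_instance

/-- The `L²` norm of a linear combination of smoothed exponentials is controlled by the `ℓ²` norm of
the coefficients, up to an arbitrarily small power of `R` (Schur's test). -/
theorem exists_eLpNorm_sum_smoothedExp_le {s : ℝ} (hs : |s| ≤ 1) {ε : ℝ} (hε : 0 < ε)
    (hε1 : ε ≤ 1) : ∃ C > 0, ∀ R, 0 ≤ R → ∀ (F : Finset ℕ) (a : ℕ → ℂ),
      MeasureTheory.eLpNorm (fun t : ℝ => ∑ n ∈ F, a n * smoothedExp s R (n * t)) 2 weightMeasure ≤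
        ENNReal.ofReal (C * R ^ ε * √(∑ n ∈ F, ‖a n‖ ^ 2)) := by
  obtain ⟨C, hC0, hC⟩ := exists_lintegral_cutoffKernel_le hε hε1
  refine ⟨4 * C, by positivity, fun R hR F a => ?_⟩
  set S := ∑ n ∈ F, ‖a n‖ ^ 2 with hS
  have hS0 : 0 ≤ S := Finset.sum_nonneg fun n _ => by positivity
  have hRε : 0 ≤ R ^ ε := Real.rpow_nonneg hR ε
  set κ : ℝ → ℝ := fun ξ => ‖cutoffKernel R ξ‖ * Real.exp (-(s * ξ)) with hκ
  have hκ0 : ∀ ξ, 0 ≤ κ ξ := fun ξ => by simp only [hκ]; positivity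
  have hκc : Continuous κ := by
    have := continuous_cutoffKernel R
    simp only [hκ]; fun_prop
  have hexp3 : ∀ ξ : ℝ, Real.exp (-(s * ξ)) ≤ Real.exp (3 * |ξ|) := fun ξ =>
    (exp_neg_mul_le_exp_abs hs ξ).trans (Real.exp_le_exp.2 (by linarith [abs_nonneg ξ]))
  have h1 := hC R hR (fun ξ => Real.exp (-(s * ξ))) (by fun_prop) (fun ξ => by
    rw [abs_of_pos (Real.exp_pos _)]; exact hexp3 ξ)
  have h2 := hC R hR (fun ξ => Real.exp (-(s * ξ)) * ((1 + Real.exp (-ξ)) / 2)) (by fun_prop)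
    (fun ξ => by
      rw [abs_of_pos (by positivity)]
      have h3 : Real.exp (-ξ) ≤ Real.exp |ξ| := Real.exp_le_exp.2 (neg_le_abs ξ)
      have h4 : 1 ≤ Real.exp |ξ| := Real.one_le_exp (abs_nonneg ξ)
      calc _ ≤ Real.exp |ξ| * Real.exp |ξ| := by
            refine mul_le_mul (exp_neg_mul_le_exp_abs hs ξ) (by linarith) (by positivity)
              (by positivity)
        _ ≤ Real.exp (3 * |ξ|) := by
            rw [← Real.exp_add]
            exact Real.exp_le_exp.2 (by linarith [abs_nonneg ξ]))
  set ν : MeasureTheory.Measure ℝ :=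
    MeasureTheory.volume.withDensity (fun ξ => ENNReal.ofReal (κ ξ)) with hν
  have hνf : ∀ f : ℝ → ENNReal, Measurable f →
      ∫⁻ ξ, f ξ ∂ν = ∫⁻ ξ, ENNReal.ofReal (κ ξ) * f ξ := fun f hf => by
    rw [hν, MeasureTheory.lintegral_withDensity_eq_lintegral_mul _ (by fun_prop) hf]
    rfl
  have hνuniv : ν Set.univ ≤ ENNReal.ofReal (C * R ^ ε) := by
    rw [hν, MeasureTheory.withDensity_apply _ MeasurableSet.univ, MeasureTheory.setLIntegral_univ,
      ← MeasureTheory.ofReal_integral_eq_lintegral_ofReal h1.1 (Eventually.of_forall hκ0)]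
    refine ENNReal.ofReal_le_ofReal (le_trans (le_of_eq ?_) h1.2)
    congr 1 with ξ
    rw [abs_of_pos (Real.exp_pos _)]
  have hQc := continuous_trigSum F a
  have hQm := hQc.measurable
  have hpt : ∀ t : ℝ, ‖∑ n ∈ F, a n * smoothedExp s R (n * t)‖ₑ ^ 2 ≤
      ν Set.univ * ∫⁻ ξ, ‖trigSum F a (t * Real.exp ξ)‖ₑ ^ 2 ∂ν := by
    intro t
    have e1 : ‖∑ n ∈ F, a n * smoothedExp s R (n * t)‖ₑ ≤
        MeasureTheory.eLpNorm (fun ξ => trigSum F a (t * Real.exp ξ)) 1 ν := by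
      rw [MeasureTheory.eLpNorm_one_eq_lintegral_enorm, hνf _ (by fun_prop),
        sum_mul_smoothedExp hs hR]
      refine (MeasureTheory.enorm_integral_le_lintegral_enorm _).trans (le_of_eq ?_)
      congr 1 with ξ
      rw [enorm_mul]
      congr 1
      rw [← ofReal_norm, norm_cutoffKernel_mul_cexp]
    have e2 := MeasureTheory.eLpNorm_le_eLpNorm_mul_rpow_measure_univ (μ := ν)
      (f := fun ξ => trigSum F a (t * Real.exp ξ)) (p := 1) (q := 2) (by norm_num)
      (Continuous.aestronglyMeasurable (by fun_prop))
    have e3 := pow_le_pow_left₀ zero_le (e1.trans e2) 2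
    rw [mul_pow, eLpNorm_two_sq, mul_comm] at e3
    refine e3.trans (le_of_eq ?_)
    congr 1
    rw [← ENNReal.rpow_natCast, ← ENNReal.rpow_mul]
    norm_num
  refine eLpNorm_two_le_of_lintegral_le (by positivity) ?_
  have hswap : ∫⁻ t, ∫⁻ ξ, ‖trigSum F a (t * Real.exp ξ)‖ₑ ^ 2 ∂ν ∂weightMeasure =
      ∫⁻ ξ, ∫⁻ t, ‖trigSum F a (t * Real.exp ξ)‖ₑ ^ 2 ∂weightMeasure ∂ν := by
    refine MeasureTheory.lintegral_lintegral_swap (Measurable.aemeasurable ?_)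
    simp only [Function.uncurry_def]
    fun_prop
  have hinner : ∀ ξ : ℝ, ∫⁻ t, ‖trigSum F a (t * Real.exp ξ)‖ₑ ^ 2 ∂weightMeasure ≤
      ENNReal.ofReal (7 * (1 + Real.exp (-ξ)) * S) := by
    intro ξ
    have h3 := integral_norm_trigSum_sq_weight_le F a (Real.exp_pos ξ)
    rw [one_div, ← Real.exp_neg] at h3
    refine (lintegral_weightMeasure_le (by fun_prop) h3.1 (fun t _ => by positivity)
      fun t _ => ?_).trans (ENNReal.ofReal_le_ofReal h3.2)
    rw [← ofReal_norm, ← ENNReal.ofReal_pow (norm_nonneg _), mul_comm t]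
  have houter : ∫⁻ ξ, ENNReal.ofReal (7 * (1 + Real.exp (-ξ)) * S) ∂ν ≤
      ENNReal.ofReal (14 * S * (C * R ^ ε)) := by
    rw [hνf _ (by fun_prop)]
    have e : ∀ ξ, ENNReal.ofReal (κ ξ) * ENNReal.ofReal (7 * (1 + Real.exp (-ξ)) * S) =
        ENNReal.ofReal (14 * S) * ENNReal.ofReal (‖cutoffKernel R ξ‖ *
          (Real.exp (-(s * ξ)) * ((1 + Real.exp (-ξ)) / 2))) := by
      intro ξ
      rw [← ENNReal.ofReal_mul (hκ0 ξ), ← ENNReal.ofReal_mul (by positivity)]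
      congr 1
      simp only [hκ]
      ring
    simp_rw [e]
    rw [MeasureTheory.lintegral_const_mul' _ _ ENNReal.ofReal_ne_top,
      ← MeasureTheory.ofReal_integral_eq_lintegral_ofReal h2.1
        (Eventually.of_forall fun ξ => by simp only [Pi.zero_apply]; positivity),
      ← ENNReal.ofReal_mul (by positivity)]
    refine ENNReal.ofReal_le_ofReal (mul_le_mul_of_nonneg_left (le_trans (le_of_eq ?_) h2.2)
      (by positivity))
    congr 1 with ξ
    rw [abs_of_pos (by positivity)]
  calc _ ≤ ∫⁻ t, ν Set.univ * ∫⁻ ξ, ‖trigSum F a (t * Real.exp ξ)‖ₑ ^ 2 ∂ν ∂weightMeasure :=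
        MeasureTheory.lintegral_mono hpt
    _ = ν Set.univ * ∫⁻ ξ, ∫⁻ t, ‖trigSum F a (t * Real.exp ξ)‖ₑ ^ 2 ∂weightMeasure ∂ν := by
        rw [MeasureTheory.lintegral_const_mul' _ _ (hνuniv.trans_lt ENNReal.ofReal_lt_top).ne, hswap]
    _ ≤ ENNReal.ofReal (C * R ^ ε) * ENNReal.ofReal (14 * S * (C * R ^ ε)) := by
        gcongr
        exact (MeasureTheory.lintegral_mono hinner).trans houter
    _ ≤ _ := by
        rw [← ENNReal.ofReal_mul (by positivity)]
        refine ENNReal.ofReal_le_ofReal ?_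
        rw [mul_pow, Real.sq_sqrt hS0]
        have : 0 ≤ (C * R ^ ε) ^ 2 * S := by positivity
        nlinarith

/-- Convergence in the weighted `L²` space, as the parameter tends to infinity. -/
def L2Converges (F : ℝ → ℝ → ℂ) : Prop :=
  (∀ᶠ R in atTop, MeasureTheory.AEStronglyMeasurable (F R) weightMeasure) ∧
  ∃ g : ℝ → ℂ, MeasureTheory.MemLp g 2 weightMeasure ∧
    Tendsto (fun R => MeasureTheory.eLpNorm (F R - g) 2 weightMeasure) atTop (𝓝 0)

theorem L2Converges.of_sub_tendsto_zero {F G : ℝ → ℝ → ℂ} (hF : L2Converges F)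
    (hG : ∀ᶠ R in atTop, MeasureTheory.AEStronglyMeasurable (G R) weightMeasure)
    (h : Tendsto (fun R => MeasureTheory.eLpNorm (G R - F R) 2 weightMeasure) atTop (𝓝 0)) :
    L2Converges G := by
  obtain ⟨hFm, g, hg, hgt⟩ := hF
  refine ⟨hG, g, hg, ?_⟩
  have h2 := h.add hgt
  rw [add_zero] at h2
  refine tendsto_of_tendsto_of_tendsto_of_le_of_le' tendsto_const_nhds h2
    (Eventually.of_forall fun _ => zero_le) ?_
  filter_upwards [hFm, hG] with R h3 h4
  have e : G R - g = (G R - F R) + (F R - g) := by abel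
  rw [e]
  exact MeasureTheory.eLpNorm_add_le (h4.sub h3) (h3.sub hg.1) (by norm_num)

theorem L2Converges.add {F G : ℝ → ℝ → ℂ} (hF : L2Converges F) (hG : L2Converges G) :
    L2Converges fun R => F R + G R := by
  obtain ⟨hFm, f, hf, hft⟩ := hF
  obtain ⟨hGm, g, hg, hgt⟩ := hG
  refine ⟨?_, f + g, hf.add hg, ?_⟩
  · filter_upwards [hFm, hGm] with R h1 h2 using h1.add h2
  have h2 := hft.add hgt
  rw [add_zero] at h2
  refine tendsto_of_tendsto_of_tendsto_of_le_of_le' tendsto_const_nhds h2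
    (Eventually.of_forall fun _ => zero_le) ?_
  filter_upwards [hFm, hGm] with R h3 h4
  have e : F R + G R - (f + g) = (F R - f) + (G R - g) := by abel
  rw [e]
  exact MeasureTheory.eLpNorm_add_le (h3.sub hf.1) (h4.sub hg.1) (by norm_num)

theorem L2Converges.const_smul {F : ℝ → ℝ → ℂ} (hF : L2Converges F) (c : ℂ) :
    L2Converges fun R => c • F R := by
  obtain ⟨hFm, f, hf, hft⟩ := hF
  refine ⟨?_, c • f, hf.const_smul c, ?_⟩
  · filter_upwards [hFm] with R h1 using h1.const_smul c
  have e : ∀ R, MeasureTheory.eLpNorm (c • F R - c • f) 2 weightMeasure =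
      ‖c‖ₑ * MeasureTheory.eLpNorm (F R - f) 2 weightMeasure := fun R => by
    rw [← smul_sub, MeasureTheory.eLpNorm_const_smul]
  simp_rw [e]
  have := ENNReal.Tendsto.const_mul (a := ‖c‖ₑ) hft (Or.inr (by simp))
  simpa using this

theorem l2Converges_const {g : ℝ → ℂ} (hg : MeasureTheory.MemLp g 2 weightMeasure) :
    L2Converges fun _ => g :=
  ⟨Eventually.of_forall fun _ => hg.1, g, hg, by simp⟩

theorem eLpNorm_le_of_tendsto {f : ℕ → ℝ → ℂ} {g : ℝ → ℂ} {B : ENNReal}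
    (hf : ∀ n, MeasureTheory.AEStronglyMeasurable (f n) weightMeasure)
    (hfB : ∀ᶠ n in atTop, MeasureTheory.eLpNorm (f n) 2 weightMeasure ≤ B)
    (h : ∀ t, 0 < t → Tendsto (fun n => f n t) atTop (𝓝 (g t))) :
    MeasureTheory.eLpNorm g 2 weightMeasure ≤ B := by
  refine (MeasureTheory.Lp.eLpNorm_lim_le_liminf_eLpNorm hf g ?_).trans ?_
  · filter_upwards [ae_weightMeasure_pos] with t ht using h t ht
  · exact liminf_le_of_frequently_le' hfB.frequently

/-! ### Trigonometric series with smoothed exponentials -/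

theorem sum_sq_le_of_le {a : ℕ → ℂ} {η : ℝ} (hη : 0 < η)
    (hsum : Summable fun n : ℕ => ‖a n‖ ^ 2 * (n : ℝ) ^ (2 * η)) {x : ℝ} (hx : 0 < x)
    (F : Finset ℕ) (hF : ∀ n ∈ F, x ≤ n) :
    √(∑ n ∈ F, ‖a n‖ ^ 2) ≤ √(∑' n : ℕ, ‖a n‖ ^ 2 * (n : ℝ) ^ (2 * η)) * x ^ (-η) := by
  have h0 : 0 ≤ ∑' n : ℕ, ‖a n‖ ^ 2 * (n : ℝ) ^ (2 * η) := tsum_nonneg fun n => by positivity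
  refine Real.sqrt_le_iff.2 ⟨by positivity, ?_⟩
  rw [mul_pow, Real.sq_sqrt h0, ← Real.rpow_natCast (x ^ (-η)), ← Real.rpow_mul hx.le]
  have h1 : x ^ (2 * η) * ∑ n ∈ F, ‖a n‖ ^ 2 ≤ ∑' n : ℕ, ‖a n‖ ^ 2 * (n : ℝ) ^ (2 * η) := by
    rw [Finset.mul_sum]
    refine le_trans (Finset.sum_le_sum fun n hn => ?_)
      (hsum.sum_le_tsum F fun n _ => by positivity)
    rw [mul_comm]
    gcongr
    exact hF n hn
  have e : x ^ (-η * ((2 : ℕ) : ℝ)) = (x ^ (2 * η))⁻¹ := by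
    rw [← Real.rpow_neg hx.le]; congr 1; push_cast; ring
  rw [e, ← div_eq_mul_inv, le_div_iff₀ (by positivity)]
  linarith

theorem eLpNorm_trigSum_le (F : Finset ℕ) (a : ℕ → ℂ) :
    MeasureTheory.eLpNorm (trigSum F a) 2 weightMeasure ≤
      ENNReal.ofReal (4 * √(∑ n ∈ F, ‖a n‖ ^ 2)) := by
  have hS0 : 0 ≤ ∑ n ∈ F, ‖a n‖ ^ 2 := Finset.sum_nonneg fun n _ => by positivity
  have h := integral_norm_trigSum_sq_weight_le F a one_pos
  simp only [one_mul] at h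
  refine eLpNorm_weightMeasure_le (continuous_trigSum F a).aestronglyMeasurable h.1
    (fun t _ => le_rfl) (by positivity) (h.2.trans ?_)
  rw [mul_pow, Real.sq_sqrt hS0]
  norm_num
  linarith

theorem memLp_trigSum (F : Finset ℕ) (a : ℕ → ℂ) :
    MeasureTheory.MemLp (trigSum F a) 2 weightMeasure :=
  ⟨(continuous_trigSum F a).aestronglyMeasurable,
    (eLpNorm_trigSum_le F a).trans_lt ENNReal.ofReal_lt_top⟩

/-- The partial sums of a trigonometric series with square-summable coefficients converge in the
weighted `L²` space. -/
theorem exists_tendsto_trigSum {a : ℕ → ℂ} {η : ℝ} (hη : 0 < η)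
    (hsum : Summable fun n : ℕ => ‖a n‖ ^ 2 * (n : ℝ) ^ (2 * η)) :
    ∃ g : ℝ → ℂ, MeasureTheory.MemLp g 2 weightMeasure ∧
      Tendsto (fun N : ℕ => MeasureTheory.eLpNorm (trigSum (Finset.range (N + 1)) a - g) 2
        weightMeasure) atTop (𝓝 0) := by
  set A := √(∑' n : ℕ, ‖a n‖ ^ 2 * (n : ℝ) ^ (2 * η)) with hA
  have key : ∀ N M : ℕ, N ≤ M → MeasureTheory.eLpNorm (trigSum (Finset.range (M + 1)) a -
      trigSum (Finset.range (N + 1)) a) 2 weightMeasure ≤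
        ENNReal.ofReal (4 * (A * ((N : ℝ) + 1) ^ (-η))) := by
    intro N M hNM
    have e : trigSum (Finset.range (M + 1)) a - trigSum (Finset.range (N + 1)) a =
        trigSum (Finset.range (M + 1) \ Finset.range (N + 1)) a := by
      ext t
      rw [Pi.sub_apply, sub_eq_iff_eq_add]
      simp only [trigSum]
      rw [Finset.sum_sdiff (Finset.range_mono (by omega))]
    rw [e]
    refine (eLpNorm_trigSum_le _ a).trans (ENNReal.ofReal_le_ofReal ?_)
    gcongr
    refine sum_sq_le_of_le hη hsum (by positivity) _ fun n hn => ?_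
    simp only [Finset.mem_sdiff, Finset.mem_range, not_lt] at hn
    exact_mod_cast hn.2
  have hlim : Tendsto (fun N : ℕ => 4 * (A * ((N : ℝ) + 1) ^ (-η))) atTop (𝓝 0) := by
    have h1 : Tendsto (fun N : ℕ => (N : ℝ) + 1) atTop atTop :=
      tendsto_atTop_add_const_right _ _ tendsto_natCast_atTop_atTop
    have := (((tendsto_rpow_neg_atTop hη).comp h1).const_mul A).const_mul 4
    simpa using this
  set u : ℕ → MeasureTheory.Lp ℂ 2 weightMeasure := fun N =>
    (memLp_trigSum (Finset.range (N + 1)) a).toLp with hu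
  have hdist : ∀ N M : ℕ, N ≤ M → dist (u N) (u M) ≤ 4 * (A * ((N : ℝ) + 1) ^ (-η)) := by
    intro N M hNM
    rw [dist_comm, dist_edist, hu, MeasureTheory.Lp.edist_toLp_toLp]
    exact ENNReal.toReal_le_of_le_ofReal (by positivity) (key N M hNM)
  have hcau : CauchySeq u := cauchySeq_of_le_tendsto_0' _ hdist hlim
  obtain ⟨v, hv⟩ := cauchySeq_tendsto_of_complete hcau
  refine ⟨v, MeasureTheory.Lp.memLp v, ?_⟩
  rw [MeasureTheory.Lp.tendsto_Lp_iff_tendsto_eLpNorm'] at hv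
  refine hv.congr fun N => MeasureTheory.eLpNorm_congr_ae ?_
  exact (MeasureTheory.MemLp.coeFn_toLp _).sub (EventuallyEq.refl _ _)

/-- Interpolation between Fourier inversion and the trivial bound. -/
theorem exists_norm_smoothedExp_sub_sq_le {s : ℝ} (hs : |s| ≤ 1) :
    ∃ K > 0, ∀ R, 1 ≤ R → ∀ x, 0 ≤ x →
      ‖smoothedExp s R x - Complex.exp (x * Complex.I)‖ ^ 2 ≤
        K * (1 + x) * R ^ (-(1 / 4) : ℝ) := by
  obtain ⟨C, hC0, hC⟩ := exists_norm_smoothedExp_le hs (ε := 1 / 6) (by norm_num) (by norm_num)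
  set A : ℝ := 4 * Real.exp 16 with hA
  set B : ℝ := C + 1 with hB
  have hA0 : 0 < A := by positivity
  have hB0 : 0 < B := by positivity
  refine ⟨A + B ^ 3, by positivity, fun R hR x hx => ?_⟩
  have hR0 : 0 < R := by linarith
  set d := ‖smoothedExp s R x - Complex.exp (x * Complex.I)‖ with hd
  have hd0 : 0 ≤ d := norm_nonneg _
  have h1 : d ≤ A * (1 + x) ^ 2 / R := norm_smoothedExp_sub_le hs hx hR0
  have hR6 : 1 ≤ R ^ (1 / 6 : ℝ) := Real.one_le_rpow hR (by norm_num)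
  have h2 : d ≤ B * R ^ (1 / 6 : ℝ) := by
    refine (norm_sub_le _ _).trans ?_
    rw [Complex.norm_exp_ofReal_mul_I]
    have := hC R hR0.le x
    rw [hB, add_mul, one_mul]
    linarith
  have e1 : (R ^ (1 / 6 : ℝ)) ^ 3 = R * (R ^ (-(1 / 4) : ℝ)) ^ 2 := by
    rw [← Real.rpow_natCast, ← Real.rpow_mul hR0.le, ← Real.rpow_natCast (R ^ (-(1 / 4) : ℝ)),
      ← Real.rpow_mul hR0.le]
    nth_rewrite 2 [← Real.rpow_one R]
    rw [← Real.rpow_add hR0]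
    norm_num
  -- `d ^ 4 = d * d ^ 3` balances the two bounds, so that the result is linear in `1 + x` and can be
  -- integrated against `(1 + t)⁻³`
  have h4 : (d ^ 2) ^ 2 ≤ ((A + B ^ 3) * (1 + x) * R ^ (-(1 / 4) : ℝ)) ^ 2 := by
    calc (d ^ 2) ^ 2 = d * d ^ 3 := by ring
      _ ≤ (A * (1 + x) ^ 2 / R) * (B * R ^ (1 / 6 : ℝ)) ^ 3 := by gcongr
      _ = A * B ^ 3 * ((1 + x) * R ^ (-(1 / 4) : ℝ)) ^ 2 := by
          rw [mul_pow B, e1]; field_simp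
      _ ≤ (A + B ^ 3) ^ 2 * ((1 + x) * R ^ (-(1 / 4) : ℝ)) ^ 2 := by
          gcongr
          nlinarith [mul_pos hA0 (pow_pos hB0 3), sq_nonneg A, sq_nonneg (B ^ 3)]
      _ = _ := by ring
  exact (pow_le_pow_iff_left₀ (by positivity) (by positivity) two_ne_zero).1 h4

theorem exists_eLpNorm_smoothedExp_sub_le {s : ℝ} (hs : |s| ≤ 1) :
    ∃ K > 0, ∀ R, 1 ≤ R → ∀ n : ℕ, 1 ≤ n →
      MeasureTheory.eLpNorm (fun t : ℝ => smoothedExp s R (n * t) -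
        Complex.exp ((n * t : ℝ) * Complex.I)) 2 weightMeasure ≤
        ENNReal.ofReal (K * n * R ^ (-(1 / 8) : ℝ)) := by
  obtain ⟨K, hK0, hK⟩ := exists_norm_smoothedExp_sub_sq_le hs
  set J := ∫ t : ℝ in Set.Ioi 0, (1 + t) / (1 + t) ^ 3 with hJ
  have hJ0 : 0 ≤ J := MeasureTheory.setIntegral_nonneg measurableSet_Ioi fun t ht => by
    have : (0 : ℝ) < t := ht
    positivity
  refine ⟨K * J + 1, by positivity, fun R hR n hn => ?_⟩
  have hR0 : 0 < R := by linarith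
  have hn1 : (1 : ℝ) ≤ n := by exact_mod_cast hn
  have hc := continuous_smoothedExp hs hR0.le
  have e : ∀ t : ℝ, K * n * R ^ (-(1 / 4) : ℝ) * (1 + t) / (1 + t) ^ 3 =
      K * n * R ^ (-(1 / 4) : ℝ) * ((1 + t) / (1 + t) ^ 3) := fun t => by ring
  refine eLpNorm_weightMeasure_le (g := fun t => K * n * R ^ (-(1 / 4) : ℝ) * (1 + t))
    (Continuous.aestronglyMeasurable (by fun_prop)) ?_ (fun t ht => ?_) (by positivity) ?_
  · simp_rw [e]
    exact integrableOn_weight_two.const_mul _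
  · refine (hK R hR (n * t) (by positivity)).trans ?_
    have : 0 ≤ K * R ^ (-(1 / 4) : ℝ) := by positivity
    have h2 : 1 + n * t ≤ n * (1 + t) := by linarith
    nlinarith [mul_le_mul_of_nonneg_left h2 this]
  · simp_rw [e]
    rw [MeasureTheory.integral_const_mul, ← hJ]
    have e2 : (R ^ (-(1 / 8) : ℝ)) ^ 2 = R ^ (-(1 / 4) : ℝ) := by
      rw [← Real.rpow_natCast, ← Real.rpow_mul hR0.le]; norm_num
    rw [mul_pow, mul_pow, e2]
    have h1 : K * J ≤ (K * J + 1) ^ 2 := by nlinarith [mul_nonneg hK0.le hJ0]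
    have h2 : (n : ℝ) ≤ (n : ℝ) ^ 2 := by nlinarith
    calc K * n * R ^ (-(1 / 4) : ℝ) * J = K * J * n * R ^ (-(1 / 4) : ℝ) := by ring
      _ ≤ (K * J + 1) ^ 2 * (n : ℝ) ^ 2 * R ^ (-(1 / 4) : ℝ) := by gcongr

/-- A trigonometric series with smoothed exponentials converges in the weighted `L²` space as the
smoothing is removed. -/
theorem l2Converges_sum_smoothedExp {s : ℝ} (hs : |s| ≤ 1) {a : ℕ → ℂ} (ha : ∀ n, ‖a n‖ ≤ n)
    {η : ℝ} (hη : 0 < η) (hη1 : η ≤ 1)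
    (hsum : Summable fun n : ℕ => ‖a n‖ ^ 2 * (n : ℝ) ^ (2 * η))
    {S : ℝ → ℝ → ℂ} (hS : ∀ R, 0 < R → ∀ t, 0 < t →
      HasSum (fun n : ℕ => a n * smoothedExp s R (n * t)) (S R t)) : L2Converges S := by
  obtain ⟨g, hg, hgt⟩ := exists_tendsto_trigSum hη hsum
  set A := √(∑' n : ℕ, ‖a n‖ ^ 2 * (n : ℝ) ^ (2 * η)) with hA
  obtain ⟨K, hK0, hK⟩ := exists_eLpNorm_smoothedExp_sub_le hs
  obtain ⟨C, hC0, hC⟩ := exists_eLpNorm_sum_smoothedExp_le hs (ε := η / 96) (by linarith)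
    (by linarith)
  -- the series is cut at `R ^ (1 / 48)`: the terms before are compared with exponentials one by one,
  -- and Schur's test bounds the tail, as `x ^ (-η)` with `x = R ^ (1 / 48)` beats `R ^ (η / 96)`
  set N : ℝ → ℕ := fun R => ⌊R ^ (1 / 48 : ℝ)⌋₊ with hN
  have hNt : Tendsto N atTop atTop :=
    tendsto_nat_floor_atTop.comp (tendsto_rpow_atTop (by norm_num))
  have hP : L2Converges fun R => trigSum (Finset.range (N R + 1)) a :=
    ⟨Eventually.of_forall fun R => (memLp_trigSum _ a).1, g, hg, hgt.comp hNt⟩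
  have hcont : ∀ R, 0 < R → ∀ n : ℕ, Continuous fun t : ℝ => smoothedExp s R (n * t) :=
    fun R hR n => (continuous_smoothedExp hs hR.le).comp (by fun_prop)
  have hcontF : ∀ R, 0 < R → ∀ F : Finset ℕ,
      Continuous fun t : ℝ => ∑ n ∈ F, a n * smoothedExp s R (n * t) := fun R hR F =>
    continuous_finsetSum F fun n _ => (hcont R hR n).const_mul _
  have hSm : ∀ R, 0 < R → MeasureTheory.AEStronglyMeasurable (S R) weightMeasure := by
    intro R hR
    refine aestronglyMeasurable_of_tendsto_ae atTop
      (f := fun k : ℕ => fun t : ℝ => ∑ n ∈ Finset.range k, a n * smoothedExp s R (n * t))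
      (fun k => (hcontF R hR _).aestronglyMeasurable) ?_
    filter_upwards [ae_weightMeasure_pos] with t ht
    exact (hS R hR t ht).tendsto_sum_nat
  refine hP.of_sub_tendsto_zero ?_ ?_
  · filter_upwards [eventually_gt_atTop 0] with R hR using hSm R hR
  have hbound : ∀ R, 1 ≤ R → MeasureTheory.eLpNorm (S R - trigSum (Finset.range (N R + 1)) a) 2
      weightMeasure ≤ ENNReal.ofReal (2 * K * R ^ (-(1 / 16) : ℝ)) +
        ENNReal.ofReal (C * A * R ^ (-(η / 96))) := by
    intro R hR
    have hR0 : 0 < R := by linarith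
    set x := R ^ (1 / 48 : ℝ) with hx
    have hx1 : 1 ≤ x := Real.one_le_rpow hR (by norm_num)
    have hx0 : 0 < x := by linarith
    set I := Finset.range (N R + 1) with hI
    set G : ℝ → ℂ := fun t => ∑ n ∈ I, a n * smoothedExp s R (n * t) with hG
    have hGm : MeasureTheory.AEStronglyMeasurable G weightMeasure :=
      (hcontF R hR0 I).aestronglyMeasurable
    have e : S R - trigSum I a = (G - trigSum I a) + (S R - G) := by abel
    rw [e]
    refine (MeasureTheory.eLpNorm_add_le (hGm.sub (memLp_trigSum I a).1) ((hSm R hR0).sub hGm)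
      (by norm_num)).trans (add_le_add ?_ ?_)
    · have e2 : G - trigSum I a = ∑ n ∈ I, a n • fun t : ℝ => smoothedExp s R (n * t) -
          Complex.exp ((n * t : ℝ) * Complex.I) := by
        ext t
        simp only [hG, trigSum, Pi.sub_apply, Finset.sum_apply, Pi.smul_apply, smul_eq_mul]
        rw [← Finset.sum_sub_distrib]
        exact Finset.sum_congr rfl fun n _ => by ring
      rw [e2]
      refine (MeasureTheory.eLpNorm_sum_le (fun n _ => ?_) (by norm_num)).trans ?_
      · exact Continuous.aestronglyMeasurable
          (((hcont R hR0 n).sub (by fun_prop)).const_smul (a n))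
      have hterm : ∀ n ∈ I, MeasureTheory.eLpNorm (a n • fun t : ℝ => smoothedExp s R (n * t) -
          Complex.exp ((n * t : ℝ) * Complex.I)) 2 weightMeasure ≤
          ENNReal.ofReal (x * (K * x * R ^ (-(1 / 8) : ℝ))) := by
        intro n hn
        rw [MeasureTheory.eLpNorm_const_smul]
        rcases Nat.eq_zero_or_pos n with rfl | hn0
        · have : a 0 = 0 := by
            have := ha 0
            simpa using this
          simp [this]
        · have hnx : (n : ℝ) ≤ x := by
            refine le_trans ?_ (Nat.floor_le hx0.le)
            have := Finset.mem_range.1 hn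
            exact_mod_cast Nat.lt_succ_iff.1 this
          rw [← ofReal_norm, ENNReal.ofReal_mul hx0.le]
          gcongr
          · exact (ha n).trans hnx
          · refine (hK R hR n hn0).trans (ENNReal.ofReal_le_ofReal ?_)
            gcongr
      refine (Finset.sum_le_sum hterm).trans ?_
      rw [Finset.sum_const, ← ENNReal.ofReal_nsmul, nsmul_eq_mul]
      refine ENNReal.ofReal_le_ofReal ?_
      have hcard : ((I.card : ℕ) : ℝ) ≤ 2 * x := by
        rw [hI, Finset.card_range]
        push_cast
        have := Nat.floor_le hx0.le
        simp only [hN]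
        linarith
      calc (I.card : ℝ) * (x * (K * x * R ^ (-(1 / 8) : ℝ))) ≤
            2 * x * (x * (K * x * R ^ (-(1 / 8) : ℝ))) := by gcongr
        _ = 2 * K * (x ^ 3 * R ^ (-(1 / 8) : ℝ)) := by ring
        _ = 2 * K * R ^ (-(1 / 16) : ℝ) := by
            rw [hx, ← Real.rpow_natCast, ← Real.rpow_mul hR0.le, ← Real.rpow_add hR0]
            norm_num
    · have hlim : ∀ t, 0 < t → Tendsto (fun k : ℕ => ∑ n ∈ Finset.range k \ I,
          a n * smoothedExp s R (n * t)) atTop (𝓝 ((S R - G) t)) := by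
        intro t ht
        have h1 := ((hS R hR0 t ht).tendsto_sum_nat).sub_const (G t)
        refine h1.congr' ?_
        filter_upwards [eventually_ge_atTop (N R + 1)] with k hk
        rw [sub_eq_iff_eq_add]
        simp only [hG]
        rw [Finset.sum_sdiff (Finset.range_mono hk)]
      refine eLpNorm_le_of_tendsto (f := fun k : ℕ => fun t : ℝ => ∑ n ∈ Finset.range k \ I,
          a n * smoothedExp s R (n * t)) (fun k => (hcontF R hR0 _).aestronglyMeasurable)
          (Eventually.of_forall fun k => ?_) hlim
      refine (hC R hR0.le _ a).trans (ENNReal.ofReal_le_ofReal ?_)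
      have h2 := sum_sq_le_of_le hη hsum hx0 (Finset.range k \ I) fun n hn => by
        simp only [Finset.mem_sdiff, hI, Finset.mem_range, not_lt] at hn
        have h3 := Nat.lt_floor_add_one x
        have h4 : ((N R + 1 : ℕ) : ℝ) ≤ n := by exact_mod_cast hn.2
        push_cast at h4
        simp only [hN] at h4
        linarith
      calc C * R ^ (η / 96) * √(∑ n ∈ Finset.range k \ I, ‖a n‖ ^ 2) ≤
            C * R ^ (η / 96) * (A * x ^ (-η)) := by gcongr
        _ = C * A * (R ^ (η / 96) * x ^ (-η)) := by ring
        _ = C * A * R ^ (-(η / 96)) := by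
            rw [hx, ← Real.rpow_mul hR0.le, ← Real.rpow_add hR0]
            ring_nf
  have hz : Tendsto (fun R : ℝ => ENNReal.ofReal (2 * K * R ^ (-(1 / 16) : ℝ)) +
        ENNReal.ofReal (C * A * R ^ (-(η / 96)))) atTop (𝓝 0) := by
    have h1 := (tendsto_rpow_neg_atTop (y := 1 / 16) (by norm_num)).const_mul (2 * K)
    have h2 := (tendsto_rpow_neg_atTop (y := η / 96) (by linarith)).const_mul (C * A)
    have h3 := (ENNReal.tendsto_ofReal h1).add (ENNReal.tendsto_ofReal h2)
    simpa using h3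
  refine tendsto_of_tendsto_of_tendsto_of_le_of_le' tendsto_const_nhds hz
    (Eventually.of_forall fun _ => zero_le) ?_
  filter_upwards [eventually_ge_atTop 1] with R hR using hbound R hR

/-! ### Contour integrals with the cutoff, and zeros in its transition zone -/

theorem integrableOn_rpow_mul_weight {α : ℝ} (h1 : -1 < α) (h2 : α < 2) :
    MeasureTheory.IntegrableOn (fun t : ℝ => t ^ α / (1 + t) ^ 3) (Set.Ioi 0) := by
  have hm : Measurable fun t : ℝ => t ^ α / (1 + t) ^ 3 := by fun_prop
  rw [← Set.Ioc_union_Ioi_eq_Ioi zero_le_one]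
  refine MeasureTheory.IntegrableOn.union ?_ ?_
  · have h := (intervalIntegral.intervalIntegrable_rpow' (a := 0) (b := 1) h1).1
    refine MeasureTheory.Integrable.mono' h hm.aestronglyMeasurable ?_
    filter_upwards [MeasureTheory.ae_restrict_mem measurableSet_Ioc] with t ht
    have ht0 : 0 < t := ht.1
    rw [Real.norm_of_nonneg (by positivity)]
    refine div_le_self (by positivity) ?_
    exact one_le_pow₀ (by linarith)
  · have h := integrableOn_Ioi_rpow_of_lt (a := α - 3) (by linarith) one_pos
    refine MeasureTheory.Integrable.mono' h hm.aestronglyMeasurable ?_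
    filter_upwards [MeasureTheory.ae_restrict_mem measurableSet_Ioi] with t ht
    have ht0 : 0 < t := one_pos.trans ht
    rw [Real.norm_of_nonneg (by positivity), Real.rpow_sub ht0, ← Real.rpow_natCast (1 + t)]
    push_cast
    gcongr
    linarith

theorem rpow_le_add_rpow {t α β e : ℝ} (ht : 0 < t) (h1 : β ≤ e) (h2 : e ≤ α) :
    t ^ e ≤ t ^ α + t ^ β := by
  rcases le_total 1 t with h | h
  · exact (Real.rpow_le_rpow_of_exponent_le h h2).trans (by linarith [Real.rpow_pos_of_pos ht β])
  · exact (Real.rpow_le_rpow_of_exponent_ge ht h h1).trans (by linarith [Real.rpow_pos_of_pos ht α])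

theorem norm_ofReal_cpow_sub_le {t s α β : ℝ} (ht : 0 < t) {u : ℂ} (h1 : s - α ≤ u.re)
    (h2 : u.re ≤ s - β) : ‖(t : ℂ) ^ (s - u)‖ ≤ t ^ α + t ^ β := by
  rw [Complex.norm_cpow_eq_rpow_re_of_pos ht]
  refine rpow_le_add_rpow ht ?_ ?_ <;> simp <;> linarith

/-- A function bounded by powers of moderate exponents lies in the weighted `L²` space. -/
theorem exists_eLpNorm_le_of_norm_le_rpow {α β : ℝ} (hα : α < 1) (hβ : -(1 / 2) < β)
    (hβα : β ≤ α) : ∃ H > 0, ∀ f : ℝ → ℂ, MeasureTheory.AEStronglyMeasurable f → ∀ B, 0 ≤ B →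
      (∀ t, 0 < t → ‖f t‖ ≤ B * (t ^ α + t ^ β)) →
      MeasureTheory.eLpNorm f 2 weightMeasure ≤ ENNReal.ofReal (B * H) := by
  have i1 := integrableOn_rpow_mul_weight (α := 2 * α) (by linarith) (by linarith)
  have i2 := integrableOn_rpow_mul_weight (α := 2 * β) (by linarith) (by linarith)
  set J := ∫ t in Set.Ioi (0 : ℝ), (t ^ (2 * α) / (1 + t) ^ 3 + t ^ (2 * β) / (1 + t) ^ 3) with hJ
  have hJ0 : 0 ≤ J := MeasureTheory.setIntegral_nonneg measurableSet_Ioi fun t ht => by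
    have : (0 : ℝ) < t := ht
    positivity
  refine ⟨2 * J + 1, by positivity, fun f hf B hB hfB => ?_⟩
  have e : ∀ t : ℝ, B ^ 2 * (2 * (t ^ (2 * α) + t ^ (2 * β))) / (1 + t) ^ 3 =
      2 * B ^ 2 * (t ^ (2 * α) / (1 + t) ^ 3 + t ^ (2 * β) / (1 + t) ^ 3) := fun t => by ring
  refine eLpNorm_weightMeasure_le (g := fun t => B ^ 2 * (2 * (t ^ (2 * α) + t ^ (2 * β)))) hf ?_
    (fun t ht => ?_) (by positivity) ?_
  · simp_rw [e]
    exact (i1.add i2).const_mul _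
  · have h1 := pow_le_pow_left₀ (norm_nonneg _) (hfB t ht) 2
    refine h1.trans ?_
    rw [mul_pow]
    gcongr
    have e1 : t ^ (2 * α) = (t ^ α) ^ 2 := by
      rw [← Real.rpow_natCast, ← Real.rpow_mul ht.le]; congr 1; push_cast; ring
    have e2 : t ^ (2 * β) = (t ^ β) ^ 2 := by
      rw [← Real.rpow_natCast, ← Real.rpow_mul ht.le]; congr 1; push_cast; ring
    rw [e1, e2]
    nlinarith [sq_nonneg (t ^ α - t ^ β)]
  · simp_rw [e]
    rw [MeasureTheory.integral_const_mul, ← hJ, mul_pow]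
    nlinarith [mul_nonneg (sq_nonneg B) hJ0, mul_nonneg (sq_nonneg B) (sq_nonneg J), sq_nonneg B]

/-- An absolutely convergent contour integral with the smooth cutoff converges in the weighted `L²`
space as the cutoff is removed. -/
theorem l2Converges_integral_smoothCutoff {X : Type*} {m : MeasurableSpace X}
    {ν : MeasureTheory.Measure X} [MeasureTheory.SFinite ν] {φ u : X → ℂ}
    (hφ : MeasureTheory.Integrable φ ν) (hu : Measurable u) {s α β : ℝ} (hα : α < 1)
    (hβ : -(1 / 2) < β) (hβα : β ≤ α) (hu1 : ∀ᵐ x ∂ν, s - α ≤ (u x).re)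
    (hu2 : ∀ᵐ x ∂ν, (u x).re ≤ s - β) :
    L2Converges fun R t => ∫ x, φ x * ((t : ℂ) ^ (s - u x) * smoothCutoff R (u x)) ∂ν := by
  obtain ⟨H, hH0, hH⟩ := exists_eLpNorm_le_of_norm_le_rpow hα hβ hβα
  have hΦm : ∀ R, Measurable fun x => smoothCutoff R (u x) := fun R =>
    (differentiable_smoothCutoff R).continuous.measurable.comp hu
  have hjoint : ∀ ψ : X → ℂ, MeasureTheory.AEStronglyMeasurable ψ ν →
      ∀ ψ' : X → ℂ, Measurable ψ' →
      ∀ (μ : MeasureTheory.Measure ℝ), MeasureTheory.SFinite μ → MeasureTheory.AEStronglyMeasurable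
      (fun t : ℝ => ∫ x, ψ x * ((t : ℂ) ^ (s - u x) * ψ' x) ∂ν) μ := by
    intro ψ hψ ψ' hψ' μ hμ
    refine MeasureTheory.AEStronglyMeasurable.integral_prod_right'
      (f := fun p : ℝ × X => ψ p.2 * ((p.1 : ℂ) ^ (s - u p.2) * ψ' p.2)) ?_
    refine (hψ.comp_snd).mul (Measurable.aestronglyMeasurable ?_)
    fun_prop
  set M : ℝ := Real.exp ((|s| + |α| + |β|) ^ 2) with hM
  have hre : ∀ᵐ x ∂ν, Real.exp ((u x).re ^ 2) ≤ M := by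
    filter_upwards [hu1, hu2] with x h1 h2
    refine Real.exp_le_exp.2 (sq_le_sq' ?_ ?_)
    · linarith [neg_abs_le s, le_abs_self α, abs_nonneg β]
    · linarith [le_abs_self s, neg_abs_le β, abs_nonneg α]
  -- `δ R` controls the distance to the limit, and tends to zero by dominated convergence
  set δ : ℝ → ℝ := fun R => ∫ x, ‖φ x‖ * ‖smoothCutoff R (u x) - 1‖ ∂ν with hδ
  have hdom : ∀ R, 0 ≤ R → ∀ᵐ x ∂ν,
      ‖‖φ x‖ * ‖smoothCutoff R (u x) - 1‖‖ ≤ ‖φ x‖ * (M + 1) := by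
    intro R hR
    filter_upwards [hre] with x h
    rw [Real.norm_of_nonneg (by positivity)]
    gcongr
    refine (norm_sub_le _ _).trans ?_
    rw [norm_one]
    linarith [norm_smoothCutoff_le R hR (u x)]
  have hmeas1 : ∀ R, MeasureTheory.AEStronglyMeasurable
      (fun x => ‖φ x‖ * ‖smoothCutoff R (u x) - 1‖) ν := fun R =>
    hφ.1.norm.mul ((hΦm R).sub_const 1).norm.aestronglyMeasurable
  have hδi : ∀ R, 0 ≤ R → MeasureTheory.Integrable
      (fun x => ‖φ x‖ * ‖smoothCutoff R (u x) - 1‖) ν := fun R hR =>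
    (hφ.norm.mul_const (M + 1)).mono' (hmeas1 R) (hdom R hR)
  have hδ0 : Tendsto δ atTop (𝓝 0) := by
    have h := MeasureTheory.tendsto_integral_filter_of_dominated_convergence
      (μ := ν) (l := atTop) (F := fun R : ℝ => fun x => ‖φ x‖ * ‖smoothCutoff R (u x) - 1‖)
      (f := fun _ => 0) (fun x => ‖φ x‖ * (M + 1)) (Eventually.of_forall hmeas1)
      (by filter_upwards [eventually_ge_atTop 0] with R hR using hdom R hR)
      (hφ.norm.mul_const _) (Eventually.of_forall fun x => by
        have h1 := ((tendsto_smoothCutoff (u x)).sub_const 1).norm.const_mul ‖φ x‖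
        simpa using h1)
    simpa using h
  have hcp : ∀ t : ℝ, 0 < t → ∀ᵐ x ∂ν, ‖(t : ℂ) ^ (s - u x)‖ ≤ t ^ α + t ^ β := by
    intro t ht
    filter_upwards [hu1, hu2] with x h1 h2 using norm_ofReal_cpow_sub_le ht h1 h2
  have hint : ∀ t : ℝ, 0 < t → ∀ ψ : X → ℂ, Measurable ψ → ∀ B : ℝ, (∀ᵐ x ∂ν, ‖ψ x‖ ≤ B) →
      MeasureTheory.Integrable (fun x => φ x * ((t : ℂ) ^ (s - u x) * ψ x)) ν := by
    intro t ht ψ hψ B hB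
    refine (hφ.norm.mul_const ((t ^ α + t ^ β) * B)).mono' (hφ.1.mul
      (Measurable.aestronglyMeasurable (by fun_prop))) ?_
    filter_upwards [hcp t ht, hB] with x h1 h2
    rw [norm_mul, norm_mul]
    gcongr
  set g : ℝ → ℂ := fun t => ∫ x, φ x * ((t : ℂ) ^ (s - u x) * 1) ∂ν with hg
  refine ⟨Eventually.of_forall fun R => hjoint φ hφ.1 _ (hΦm R) _ inferInstance, g,
    ⟨hjoint φ hφ.1 (fun _ => 1) measurable_const _ inferInstance, ?_⟩, ?_⟩
  · refine (hH g (hjoint φ hφ.1 (fun _ => 1) measurable_const _ inferInstance)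
      (∫ x, ‖φ x‖ ∂ν) (MeasureTheory.integral_nonneg fun x => norm_nonneg _)
      fun t ht => ?_).trans_lt ENNReal.ofReal_lt_top
    rw [← MeasureTheory.integral_mul_const]
    refine MeasureTheory.norm_integral_le_of_norm_le (hφ.norm.mul_const _) ?_
    filter_upwards [hcp t ht] with x h1
    rw [mul_one, norm_mul]
    gcongr
  · have hz : Tendsto (fun R => ENNReal.ofReal (δ R * H)) atTop (𝓝 0) := by
      have := ENNReal.tendsto_ofReal (hδ0.mul_const H)
      simpa using this
    refine tendsto_of_tendsto_of_tendsto_of_le_of_le' tendsto_const_nhds hz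
      (Eventually.of_forall fun _ => zero_le) ?_
    filter_upwards [eventually_ge_atTop 0] with R hR
    refine hH _ ((hjoint φ hφ.1 _ (hΦm R) _ inferInstance).sub
      (hjoint φ hφ.1 (fun _ => 1) measurable_const _ inferInstance)) (δ R)
      (MeasureTheory.integral_nonneg fun x => by positivity) fun t ht => ?_
    rw [Pi.sub_apply, ← MeasureTheory.integral_sub
      (hint t ht _ (hΦm R) M (by
        filter_upwards [hre] with x h using (norm_smoothCutoff_le R hR (u x)).trans h))
      (hint t ht (fun _ => 1) measurable_const 1 (by simp)), ← MeasureTheory.integral_mul_const]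
    refine MeasureTheory.norm_integral_le_of_norm_le ((hδi R hR).mul_const _) ?_
    filter_upwards [hcp t ht] with x h1
    rw [← mul_sub, ← mul_sub, norm_mul, norm_mul, mul_assoc, mul_comm ‖_ - 1‖]
    gcongr

/-- The twist at most compensates the exponential decay of `Γ`; it does so for `Im z → -∞`. -/
theorem exists_norm_twistedGamma_le : ∃ C > 0, ∀ z : ℂ, |z.re - 1| ≤ 5 / 2 → 1 ≤ |z.im| →
    ‖twistedGamma z‖ ≤ C * |z.im| ^ (z.re - 1 / 2) := by
  obtain ⟨C, hC0, hC⟩ := Complex.exists_norm_Gamma_le 2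
  refine ⟨C, hC0, fun z h1 h2 => ?_⟩
  have h3 := hC z (by norm_num; linarith) h2
  rw [twistedGamma, norm_mul, norm_cexp_pi_half_mul]
  calc _ ≤ C * |z.im| ^ (z.re - 1 / 2) * Real.exp (-(Real.pi * |z.im| / 2)) *
        Real.exp (-(Real.pi / 2 * z.im)) := by gcongr
    _ ≤ C * |z.im| ^ (z.re - 1 / 2) * 1 := by
        rw [mul_assoc, ← Real.exp_add]
        gcongr
        rw [Real.exp_le_one_iff]
        nlinarith [neg_abs_le z.im, Real.pi_pos]
    _ = _ := mul_one _

theorem summable_exp_neg_abs_int : Summable fun k : ℤ => Real.exp (-|(k : ℝ)|) := by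
  refine Summable.of_nat_of_neg ?_ ?_ <;> simpa using Real.summable_exp_neg_nat

theorem exists_sum_exp_neg_abs_sub_le : ∃ C > 0, ∀ (K : Finset ℕ) (R : ℝ),
    ∑ k ∈ K, Real.exp (-|(k : ℝ) - R|) ≤ C := by
  set T := ∑' k : ℤ, Real.exp (-|(k : ℝ)|) with hT
  have hT0 : 0 ≤ T := tsum_nonneg fun k => (Real.exp_pos _).le
  refine ⟨Real.exp 1 * T + 1, by positivity, fun K R => ?_⟩
  have h1 : ∀ k ∈ K, Real.exp (-|(k : ℝ) - R|) ≤
      Real.exp 1 * Real.exp (-|(((k : ℤ) - ⌊R⌋ : ℤ) : ℝ)|) := by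
    intro k _
    rw [← Real.exp_add]
    refine Real.exp_le_exp.2 ?_
    have h2 := Int.floor_le R
    have h3 := Int.lt_floor_add_one R
    push_cast
    have h4 : |(k : ℝ) - ⌊R⌋| ≤ |(k : ℝ) - R| + |R - ⌊R⌋| := abs_sub_le _ _ _
    rw [abs_of_nonneg (by linarith : 0 ≤ R - ⌊R⌋)] at h4
    linarith
  refine (Finset.sum_le_sum h1).trans ?_
  rw [← Finset.mul_sum]
  have hinj : Set.InjOn (fun k : ℕ => (k : ℤ) - ⌊R⌋) K := fun a _ b _ h => by
    simpa using h
  have h5 : ∑ k ∈ K, Real.exp (-|(((k : ℤ) - ⌊R⌋ : ℤ) : ℝ)|) ≤ T := by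
    rw [← Finset.sum_image (f := fun k : ℤ => Real.exp (-|(k : ℝ)|)) hinj]
    exact summable_exp_neg_abs_int.sum_le_tsum _ fun k _ => (Real.exp_pos _).le
  nlinarith [Real.exp_pos 1]

/-- The zeros in the transition zone of the cutoff carry little weight: they are grouped by the
integer part `k` of `|Im ρ|`, and each group has `O(log k)` members. -/
theorem exists_sum_zeros_transition_le {a : ℝ} (ha : 0 < a) (ha1 : a ≤ 1) :
    ∃ C > 0, ∀ R, 0 ≤ R → ∀ S : Finset ℂ, (∀ ρ ∈ S, ρ ∈ complexZetaZeros ∧ 1 ≤ |ρ.im|) →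
      ∑ ρ ∈ S, (zetaMult ρ : ℝ) * (|ρ.im| ^ (-a) * Real.exp (-2 * |(|ρ.im| - R)|)) ≤
        C * (R + 1) ^ (-(a / 2)) := by
  obtain ⟨C₁, hC₁, h₁⟩ := exists_sum_zetaMult_le
  obtain ⟨C₂, hC₂, h₂⟩ := exists_sum_exp_neg_abs_sub_le
  refine ⟨C₁ * (8 * (2 / a)) * Real.exp 2 * C₂, by positivity, fun R hR S hS => ?_⟩
  have hfib := Finset.sum_fiberwise_of_maps_to (s := S) (t := S.image fun ρ : ℂ => ⌊|ρ.im|⌋₊)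
    (g := fun ρ : ℂ => ⌊|ρ.im|⌋₊) (fun ρ hρ => Finset.mem_image_of_mem _ hρ)
    (fun ρ : ℂ => (zetaMult ρ : ℝ) * (|ρ.im| ^ (-a) * Real.exp (-2 * |(|ρ.im| - R)|)))
  rw [← hfib]
  have hkey : ∀ k ∈ S.image fun ρ : ℂ => ⌊|ρ.im|⌋₊,
      ∑ ρ ∈ S with ⌊|ρ.im|⌋₊ = k, (zetaMult ρ : ℝ) *
        (|ρ.im| ^ (-a) * Real.exp (-2 * |(|ρ.im| - R)|)) ≤
        (C₁ * (8 * (2 / a)) * Real.exp 2 * (R + 1) ^ (-(a / 2))) * Real.exp (-|(k : ℝ) - R|) := by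
    intro k hk
    have hk1 : 1 ≤ k := by
      obtain ⟨ρ, hρ, rfl⟩ := Finset.mem_image.1 hk
      exact (Nat.one_le_floor_iff _).2 (hS ρ hρ).2
    have hk1' : (1 : ℝ) ≤ k := by exact_mod_cast hk1
    have hk0 : (0 : ℝ) < k := by linarith
    have hwin : ∀ ρ ∈ S.filter (fun ρ : ℂ => ⌊|ρ.im|⌋₊ = k), (k : ℝ) ≤ |ρ.im| ∧ |ρ.im| < k + 1 := by
      intro ρ hρ
      have h := (Finset.mem_filter.1 hρ).2
      exact (Nat.floor_eq_iff (abs_nonneg _)).1 h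
    have hterm : ∀ ρ ∈ S.filter (fun ρ : ℂ => ⌊|ρ.im|⌋₊ = k),
        (zetaMult ρ : ℝ) * (|ρ.im| ^ (-a) * Real.exp (-2 * |(|ρ.im| - R)|)) ≤
        (zetaMult ρ : ℝ) * ((k : ℝ) ^ (-a) * (Real.exp 2 * Real.exp (-2 * |(k : ℝ) - R|))) := by
      intro ρ hρ
      obtain ⟨h3, h4⟩ := hwin ρ hρ
      refine mul_le_mul_of_nonneg_left ?_ (Nat.cast_nonneg _)
      refine mul_le_mul (Real.rpow_le_rpow_of_nonpos hk0 h3 (by linarith)) ?_ (Real.exp_pos _).le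
        (by positivity)
      rw [← Real.exp_add]
      refine Real.exp_le_exp.2 ?_
      have h5 : |(k : ℝ) - R| ≤ |((k : ℝ) - |ρ.im|)| + |(|ρ.im| - R)| := abs_sub_le _ _ _
      rw [abs_of_nonpos (by linarith : (k : ℝ) - |ρ.im| ≤ 0)] at h5
      linarith
    refine (Finset.sum_le_sum hterm).trans ?_
    rw [← Finset.sum_mul]
    have h6 := h₁ k (S.filter (fun ρ : ℂ => ⌊|ρ.im|⌋₊ = k)) fun ρ hρ =>
      ⟨(hS ρ (Finset.mem_filter.1 hρ).1).1, hwin ρ hρ⟩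
    have h7 : Real.log (k + 3) ≤ 4 * (2 / a) * (k : ℝ) ^ (a / 2) := by
      have := Real.log_le_rpow_div (x := (k : ℝ) + 3) (by positivity) (ε := a / 2) (by linarith)
      have h8 : ((k : ℝ) + 3) ^ (a / 2) ≤ 4 * (k : ℝ) ^ (a / 2) := by
        calc ((k : ℝ) + 3) ^ (a / 2) ≤ (4 * (k : ℝ)) ^ (a / 2) := by
              gcongr; linarith
          _ = (4 : ℝ) ^ (a / 2) * (k : ℝ) ^ (a / 2) := Real.mul_rpow (by norm_num) hk0.le
          _ ≤ (4 : ℝ) ^ (1 : ℝ) * (k : ℝ) ^ (a / 2) := by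
              gcongr
              · norm_num
              · linarith
          _ = _ := by rw [Real.rpow_one]
      calc _ ≤ _ := this
        _ ≤ 4 * (k : ℝ) ^ (a / 2) / (a / 2) := by gcongr
        _ = _ := by field_simp
    -- replacing `k` by `R + 1` costs half of the exponential decay
    have h9 : (k : ℝ) ^ (-(a / 2)) ≤ 2 * ((R + 1) ^ (-(a / 2)) * Real.exp |(k : ℝ) - R|) := by
      have h10 : R + 1 ≤ 2 * (k * Real.exp |(k : ℝ) - R|) := by
        have h11 := Real.add_one_le_exp |(k : ℝ) - R|
        have h12 : R - k ≤ |(k : ℝ) - R| := by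
          rw [abs_sub_comm]; exact le_abs_self _
        have h13 := abs_nonneg ((k : ℝ) - R)
        nlinarith [mul_le_mul_of_nonneg_left h11 hk0.le]
      have h14 : 0 < a / 2 := by linarith
      have h15 : (R + 1) ^ (a / 2) ≤ 2 * ((k : ℝ) ^ (a / 2) * Real.exp |(k : ℝ) - R|) := by
        calc (R + 1) ^ (a / 2) ≤ (2 * (k * Real.exp |(k : ℝ) - R|)) ^ (a / 2) := by gcongr
          _ = 2 ^ (a / 2) * ((k : ℝ) ^ (a / 2) * Real.exp |(k : ℝ) - R| ^ (a / 2)) := by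
              rw [Real.mul_rpow (by norm_num) (by positivity), Real.mul_rpow hk0.le (by positivity)]
          _ ≤ 2 ^ (1 : ℝ) * ((k : ℝ) ^ (a / 2) * Real.exp |(k : ℝ) - R| ^ (1 : ℝ)) := by
              have := Real.one_le_exp (abs_nonneg ((k : ℝ) - R))
              gcongr
              · norm_num
              · linarith
              · linarith
          _ = _ := by rw [Real.rpow_one, Real.rpow_one]
      rw [Real.rpow_neg hk0.le, Real.rpow_neg (by linarith), inv_le_iff_one_le_mul₀ (by positivity)]
      have h16 : 0 < (R + 1) ^ (a / 2) := by positivity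
      calc 1 = ((R + 1) ^ (a / 2))⁻¹ * (R + 1) ^ (a / 2) := by field_simp
        _ ≤ ((R + 1) ^ (a / 2))⁻¹ * (2 * ((k : ℝ) ^ (a / 2) * Real.exp |(k : ℝ) - R|)) := by gcongr
        _ = _ := by ring
    have h17 : (k : ℝ) ^ (a / 2) * (k : ℝ) ^ (-a) = (k : ℝ) ^ (-(a / 2)) := by
      rw [← Real.rpow_add hk0]; ring_nf
    have h18 : Real.exp |(k : ℝ) - R| * Real.exp (-2 * |(k : ℝ) - R|) =
        Real.exp (-|(k : ℝ) - R|) := by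
      rw [← Real.exp_add]; ring_nf
    calc _ ≤ (C₁ * (4 * (2 / a) * (k : ℝ) ^ (a / 2))) *
          ((k : ℝ) ^ (-a) * (Real.exp 2 * Real.exp (-2 * |(k : ℝ) - R|))) := by
          gcongr
          exact h6.trans (by gcongr)
      _ = C₁ * (4 * (2 / a)) * Real.exp 2 * ((k : ℝ) ^ (a / 2) * (k : ℝ) ^ (-a)) *
          Real.exp (-2 * |(k : ℝ) - R|) := by ring
      _ ≤ C₁ * (4 * (2 / a)) * Real.exp 2 * (2 * ((R + 1) ^ (-(a / 2)) * Real.exp |(k : ℝ) - R|)) *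
          Real.exp (-2 * |(k : ℝ) - R|) := by
          rw [h17]; gcongr
      _ = C₁ * (8 * (2 / a)) * Real.exp 2 * (R + 1) ^ (-(a / 2)) *
          (Real.exp |(k : ℝ) - R| * Real.exp (-2 * |(k : ℝ) - R|)) := by ring
      _ = _ := by rw [h18]
  refine (Finset.sum_le_sum hkey).trans ?_
  rw [← Finset.mul_sum]
  calc _ ≤ (C₁ * (8 * (2 / a)) * Real.exp 2 * (R + 1) ^ (-(a / 2))) * C₂ := by
        have : 0 ≤ (R + 1) ^ (-(a / 2)) := by positivity
        gcongr
        exact h₂ _ R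
    _ = _ := by ring

/-! ### The contour integrand -/

theorem differentiableAt_twistedGamma {z : ℂ} (hz : ∀ m : ℕ, z ≠ -m) :
    DifferentiableAt ℂ twistedGamma z :=
  (Complex.differentiableAt_Gamma z hz).mul (by fun_prop)

theorem ne_neg_natCast_of_im_ne_zero {z : ℂ} (hz : z.im ≠ 0) (m : ℕ) : z ≠ -m := by
  rintro rfl
  exact hz (by simp)

theorem ne_neg_natCast_of_re_pos {z : ℂ} (hz : 0 < z.re) (m : ℕ) : z ≠ -m := by
  rintro rfl
  have : (0 : ℝ) ≤ m := Nat.cast_nonneg m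
  simp at hz
  linarith

/-- The part of the contour integrand that does not depend on the variable `t` and the cutoff. -/
noncomputable def zetaWeight (s : ℝ) (u : ℂ) : ℂ :=
  deriv riemannZeta u / riemannZeta u * twistedGamma (u - s)

theorem continuousAt_zetaWeight {s : ℝ} {u : ℂ} (h1 : u ≠ 1) (hz : riemannZeta u ≠ 0)
    (hG : ∀ m : ℕ, u - s ≠ -m) : ContinuousAt (zetaWeight s) u := by
  have ha := analyticOn_riemannZeta u h1
  have h2 : ContinuousAt (fun u : ℂ => twistedGamma (u - s)) u :=
    ContinuousAt.comp (f := fun u : ℂ => u - s) (differentiableAt_twistedGamma hG).continuousAt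
      (by fun_prop)
  exact (ha.deriv.continuousAt.div ha.continuousAt hz).mul h2

theorem continuousAt_zetaWeight_of_im_ne_zero {s : ℝ} {u : ℂ} (hi : u.im ≠ 0)
    (hu : u ∉ complexZetaZeros) : ContinuousAt (zetaWeight s) u := by
  refine continuousAt_zetaWeight ?_ (fun h => hu ⟨h, hi⟩)
    fun m => ne_neg_natCast_of_im_ne_zero (by simpa using hi) m
  rintro rfl
  exact hi (by simp)

theorem continuousAt_zetaWeight_of_one_lt_re {s : ℝ} (hs : s < 1) {u : ℂ} (hu : 1 < u.re) :
    ContinuousAt (zetaWeight s) u := by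
  refine continuousAt_zetaWeight ?_ (riemannZeta_ne_zero_of_one_le_re hu.le)
    fun m => ne_neg_natCast_of_re_pos (by simp; linarith) m
  rintro rfl
  simp at hu

theorem integrableOn_abs_rpow {b y₀ : ℝ} (hb : b < -1) (hy : 0 < y₀) :
    MeasureTheory.IntegrableOn (fun y : ℝ => |y| ^ b) (Set.Ioi y₀) ∧
    MeasureTheory.IntegrableOn (fun y : ℝ => |y| ^ b) (Set.Iic (-y₀)) := by
  have h : MeasureTheory.IntegrableOn (fun y : ℝ => |y| ^ b) (Set.Ioi y₀) :=
    (integrableOn_Ioi_rpow_of_lt hb hy).congr_fun (fun y hy' => by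
      rw [abs_of_pos (hy.trans hy')]) measurableSet_Ioi
  refine ⟨h, ?_⟩
  rw [integrableOn_Iic_iff_integrableOn_Iio]
  have h3 := MeasureTheory.IntegrableOn.comp_neg h
  simpa using h3

/-- Absolute convergence on the left edge of the contour. -/
theorem integrableOn_zetaWeight_left {s σ : ℝ} (hs : 1 / 2 < s) (hs1 : s < 1)
    (hσ : σ = (s - 1) / 2) {y₀ : ℝ} (hy : 9 ≤ y₀) :
    MeasureTheory.IntegrableOn (fun y : ℝ => zetaWeight s (σ + y * Complex.I)) (Set.Ioi y₀) ∧
    MeasureTheory.IntegrableOn (fun y : ℝ => zetaWeight s (σ + y * Complex.I)) (Set.Iic (-y₀)) := by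
  obtain ⟨C₁, hC₁, h₁⟩ := exists_norm_logDeriv_zeta_left_le (σ := σ) (by linarith) (by linarith)
  obtain ⟨C₂, hC₂, h₂⟩ := exists_norm_twistedGamma_le
  have hre : ∀ y : ℝ, (σ + y * Complex.I : ℂ).re = σ := fun y => by simp
  have him : ∀ y : ℝ, (σ + y * Complex.I : ℂ).im = y := fun y => by simp
  have hbd : ∀ y : ℝ, 9 ≤ |y| → ‖zetaWeight s (σ + y * Complex.I)‖ ≤
      C₁ * 8 * C₂ * |y| ^ (-(9 / 8) : ℝ) := by
    intro y hy9
    have hy0 : 0 < |y| := by linarith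
    have h3 := h₁ y hy9
    have h4 := h₂ (σ + y * Complex.I - s) (by
      simp only [Complex.sub_re, hre, Complex.ofReal_re]
      rw [abs_le]; constructor <;> linarith) (by simp; linarith)
    simp only [Complex.sub_re, hre, Complex.ofReal_re, Complex.sub_im, him, Complex.ofReal_im,
      sub_zero] at h4
    have h5 : Real.log |y| ≤ 8 * |y| ^ (1 / 8 : ℝ) := by
      have := Real.log_le_rpow_div hy0.le (ε := 1 / 8) (by norm_num)
      linarith
    -- `σ - s - 1 / 2 = -1 - s / 2 < -5 / 4` leaves room for the logarithm
    have h6 : |y| ^ (σ - s - 1 / 2) ≤ |y| ^ (-(5 / 4) : ℝ) :=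
      Real.rpow_le_rpow_of_exponent_le (by linarith) (by linarith)
    rw [zetaWeight, norm_mul]
    calc _ ≤ (C₁ * (8 * |y| ^ (1 / 8 : ℝ))) * (C₂ * |y| ^ (-(5 / 4) : ℝ)) := by
          gcongr
          · exact h3.trans (by gcongr)
          · exact h4.trans (by gcongr)
      _ = C₁ * 8 * C₂ * (|y| ^ (1 / 8 : ℝ) * |y| ^ (-(5 / 4) : ℝ)) := by ring
      _ = _ := by rw [← Real.rpow_add hy0]; norm_num
  have hcont : ∀ S : Set ℝ, MeasurableSet S → (∀ y ∈ S, y ≠ 0) →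
      MeasureTheory.AEStronglyMeasurable (fun y : ℝ => zetaWeight s (σ + y * Complex.I))
        (MeasureTheory.volume.restrict S) := by
    intro S hS hS0
    refine ContinuousOn.aestronglyMeasurable (fun y hy' => ContinuousAt.continuousWithinAt ?_) hS
    refine ContinuousAt.comp (f := fun y : ℝ => (σ + y * Complex.I : ℂ))
      (continuousAt_zetaWeight_of_im_ne_zero (by rw [him]; exact hS0 y hy') fun h => ?_)
      (by fun_prop)
    have := (complexZetaZeros_re_mem h).1
    rw [hre] at this
    linarith
  obtain ⟨i1, i2⟩ := integrableOn_abs_rpow (b := -(9 / 8)) (y₀ := y₀) (by norm_num) (by linarith)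
  constructor
  · refine (i1.const_mul (C₁ * 8 * C₂)).mono' (hcont _ measurableSet_Ioi fun y h => ?_) ?_
    · have : y₀ < y := h
      linarith
    · filter_upwards [MeasureTheory.ae_restrict_mem measurableSet_Ioi] with y h
      have h' : y₀ < y := h
      exact hbd y (by rw [abs_of_pos (by linarith)]; linarith)
  · refine (i2.const_mul (C₁ * 8 * C₂)).mono' (hcont _ measurableSet_Iic fun y h => ?_) ?_
    · have : y ≤ -y₀ := h
      linarith
    · filter_upwards [MeasureTheory.ae_restrict_mem measurableSet_Iic] with y h
      have h' : y ≤ -y₀ := h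
      exact hbd y (by rw [abs_of_neg (by linarith)]; linarith)

/-- The coefficients `Λ(n) n⁻ˢ`. -/
noncomputable def mangoldtCoeff (s : ℝ) (n : ℕ) : ℂ :=
  (ArithmeticFunction.vonMangoldt n : ℂ) * (n : ℂ) ^ (-(s : ℂ))

theorem norm_mangoldtCoeff (s : ℝ) (n : ℕ) :
    ‖mangoldtCoeff s n‖ = ArithmeticFunction.vonMangoldt n * (n : ℝ) ^ (-s) := by
  rcases Nat.eq_zero_or_pos n with rfl | hn
  · simp [mangoldtCoeff]
  · rw [mangoldtCoeff, norm_mul, Complex.norm_real,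
      Real.norm_of_nonneg ArithmeticFunction.vonMangoldt_nonneg,
      ← Complex.ofReal_natCast, Complex.norm_cpow_eq_rpow_re_of_pos (by exact_mod_cast hn)]
    simp

theorem norm_mangoldtCoeff_le {s : ℝ} (hs : 0 ≤ s) (n : ℕ) : ‖mangoldtCoeff s n‖ ≤ n := by
  rw [norm_mangoldtCoeff]
  rcases Nat.eq_zero_or_pos n with rfl | hn
  · simp
  have hn1 : (1 : ℝ) ≤ n := by exact_mod_cast hn
  have h1 : ArithmeticFunction.vonMangoldt n ≤ n :=
    ArithmeticFunction.vonMangoldt_le_log.trans ((Real.log_le_sub_one_of_pos (by linarith)).trans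
      (by linarith))
  have h2 : (n : ℝ) ^ (-s) ≤ 1 := Real.rpow_le_one_of_one_le_of_nonpos hn1 (by linarith)
  calc _ ≤ (n : ℝ) * 1 := by
        gcongr
    _ = n := mul_one _

/-- As `s > 1 / 2`, the coefficients are square-summable, with room for a small power of `n`. -/
theorem summable_mangoldtCoeff_sq {s : ℝ} (hs : 1 / 2 < s) :
    Summable fun n : ℕ => ‖mangoldtCoeff s n‖ ^ 2 * (n : ℝ) ^ (2 * ((s - 1 / 2) / 4)) := by
  set δ := (s - 1 / 2) / 4 with hδ
  have hδ0 : 0 < δ := by linarith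
  have h := Real.summable_nat_rpow (p := -(1 + 2 * δ)) |>.2 (by linarith)
  refine Summable.of_nonneg_of_le (fun n => by positivity) (fun n => ?_)
    (h.mul_left ((2 / δ) ^ 2))
  rcases Nat.eq_zero_or_pos n with rfl | hn
  · rw [norm_mangoldtCoeff]
    simp
    positivity
  have hn0 : (0 : ℝ) < n := by exact_mod_cast hn
  have h1 : ArithmeticFunction.vonMangoldt n ≤ 2 / δ * (n : ℝ) ^ (δ / 2) := by
    refine ArithmeticFunction.vonMangoldt_le_log.trans ?_
    refine (Real.log_le_rpow_div hn0.le (ε := δ / 2) (by linarith)).trans (le_of_eq ?_)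
    field_simp
  rw [norm_mangoldtCoeff]
  calc _ ≤ (2 / δ * (n : ℝ) ^ (δ / 2) * (n : ℝ) ^ (-s)) ^ 2 * (n : ℝ) ^ (2 * δ) := by
        have := ArithmeticFunction.vonMangoldt_nonneg (n := n)
        gcongr
    _ = (2 / δ) ^ 2 * ((n : ℝ) ^ (δ / 2) * (n : ℝ) ^ (-s) * ((n : ℝ) ^ (δ / 2) * (n : ℝ) ^ (-s)) *
          (n : ℝ) ^ (2 * δ)) := by ring
    _ = (2 / δ) ^ 2 * (n : ℝ) ^ (-2 * s + 3 * δ) := by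
        rw [← Real.rpow_add hn0, ← Real.rpow_add hn0, ← Real.rpow_add hn0]
        congr 2; ring
    _ ≤ _ := by
        have hn1 : (1 : ℝ) ≤ n := by exact_mod_cast hn
        gcongr
        linarith

theorem norm_logDeriv_zeta_le_of_one_lt {c : ℝ} (hc : 1 < c) (v : ℝ) :
    ‖deriv riemannZeta (c + v * Complex.I) / riemannZeta (c + v * Complex.I)‖ ≤
      ∑' n : ℕ, ‖mangoldtCoeff c n‖ := by
  have hre : (c + v * Complex.I : ℂ).re = c := by simp
  have h1 := ArithmeticFunction.LSeries_vonMangoldt_eq_deriv_riemannZeta_div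
    (s := c + v * Complex.I) (by rw [hre]; exact hc)
  rw [neg_div] at h1
  rw [← norm_neg, ← h1, LSeries]
  have hs := ArithmeticFunction.LSeriesSummable_vonMangoldt (s := c + v * Complex.I)
    (by rw [hre]; exact hc)
  have hn : ∀ n : ℕ, ‖LSeries.term (fun n => (ArithmeticFunction.vonMangoldt n : ℂ))
      (c + v * Complex.I) n‖ = ‖mangoldtCoeff c n‖ := by
    intro n
    rw [LSeries.norm_term_eq, norm_mangoldtCoeff, hre]
    split_ifs with h
    · subst h; simp
    · rw [Complex.norm_real, Real.norm_of_nonneg ArithmeticFunction.vonMangoldt_nonneg,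
        Real.rpow_neg (Nat.cast_nonneg n), div_eq_mul_inv]
  simp_rw [← hn]
  exact norm_tsum_le_tsum_norm hs.norm

theorem summable_norm_mangoldtCoeff {c : ℝ} (hc : 1 < c) : Summable fun n => ‖mangoldtCoeff c n‖ := by
  have hs := ArithmeticFunction.LSeriesSummable_vonMangoldt (s := (c : ℂ)) (by simpa using hc)
  refine (hs.norm).congr fun n => ?_
  rw [LSeries.norm_term_eq, norm_mangoldtCoeff]
  split_ifs with h
  · subst h; simp
  · rw [Complex.norm_real, Real.norm_of_nonneg ArithmeticFunction.vonMangoldt_nonneg,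
      Complex.ofReal_re, Real.rpow_neg (Nat.cast_nonneg n), div_eq_mul_inv]

theorem continuous_twistedGamma_line {σ : ℝ} (hσ : 0 < σ) :
    Continuous fun v : ℝ => twistedGamma (σ + v * Complex.I) := by
  have := continuous_Gamma_line hσ
  unfold twistedGamma
  fun_prop

theorem integrable_twistedGamma_mul_smoothCutoff {σ c R : ℝ} (hσ : 0 < σ) (hR : 0 ≤ R) :
    MeasureTheory.Integrable fun v : ℝ =>
      twistedGamma (σ + v * Complex.I) * smoothCutoff R (c + v * Complex.I) := by
  have hpi : Real.pi / 2 < 2 := by linarith [Real.pi_lt_d2]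
  refine ((integrable_exp_mul_norm_smoothCutoff hR hpi c).const_mul (Real.Gamma σ)).mono' ?_
    (Eventually.of_forall fun v => ?_)
  · have h1 := continuous_twistedGamma_line hσ
    have h2 := (differentiable_smoothCutoff R).continuous
    exact Continuous.aestronglyMeasurable (by fun_prop)
  · have := norm_twistedGamma_le (z := σ + v * Complex.I) (by simpa using hσ)
    simp only [Complex.add_re, Complex.ofReal_re, Complex.mul_re, Complex.I_re, mul_zero,
      Complex.ofReal_im, Complex.I_im, mul_one, sub_self, add_zero, Complex.add_im, Complex.mul_im,
      zero_add] at this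
    rw [norm_mul, ← mul_assoc]
    gcongr

/-- On the right edge of the contour the Dirichlet series of `ζ'/ζ` may be integrated term by
term. -/
theorem integrable_and_hasSum_right_line {s c : ℝ} (hs : |s| ≤ 3) (hsc : s < c) (hc : 1 < c) {R : ℝ}
    (hR : 0 ≤ R) {t : ℝ} (ht : 0 < t) :
    MeasureTheory.Integrable (fun v : ℝ => zetaWeight s (c + v * Complex.I) *
      ((t : ℂ) ^ (s - (c + v * Complex.I)) * smoothCutoff R (c + v * Complex.I))) ∧
    HasSum (fun n : ℕ => mangoldtCoeff s n * smoothedExp s R (n * t))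
      (-(1 / (2 * Real.pi)) * ∫ v : ℝ, zetaWeight s (c + v * Complex.I) *
      ((t : ℂ) ^ (s - (c + v * Complex.I)) * smoothCutoff R (c + v * Complex.I))) := by
  set σ := c - s with hσ
  have hσ0 : 0 < σ := by linarith
  have htne : (t : ℂ) ≠ 0 := by exact_mod_cast ht.ne'
  have hw : ∀ v : ℝ, (c + v * Complex.I : ℂ) - s = σ + v * Complex.I := fun v => by
    rw [hσ]; push_cast; ring
  have hre : ∀ v : ℝ, (c + v * Complex.I : ℂ).re = c := fun v => by simp
  set B : ℝ → ℂ := fun v => twistedGamma (σ + v * Complex.I) * smoothCutoff R (c + v * Complex.I)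
    with hB
  have hBi : MeasureTheory.Integrable B := integrable_twistedGamma_mul_smoothCutoff hσ0 hR
  have hBc : Continuous B := by
    have h1 := continuous_twistedGamma_line hσ0
    have h2 := (differentiable_smoothCutoff R).continuous
    simp only [hB]
    fun_prop
  have htn : ∀ v : ℝ, ‖(t : ℂ) ^ (s - (c + v * Complex.I))‖ = t ^ (-σ) := fun v => by
    rw [Complex.norm_cpow_eq_rpow_re_of_pos ht]
    congr 1
    simp [hσ]
  have htc : Continuous fun v : ℝ => (t : ℂ) ^ (s - (c + v * Complex.I)) :=
    Continuous.const_cpow (by fun_prop) (Or.inl htne)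
  set M := ∑' n : ℕ, ‖mangoldtCoeff c n‖ with hM
  have hM0 : 0 ≤ M := tsum_nonneg fun n => norm_nonneg _
  have eK : ∀ v : ℝ, zetaWeight s (c + v * Complex.I) *
      ((t : ℂ) ^ (s - (c + v * Complex.I)) * smoothCutoff R (c + v * Complex.I)) =
      deriv riemannZeta (c + v * Complex.I) / riemannZeta (c + v * Complex.I) *
        ((t : ℂ) ^ (s - (c + v * Complex.I)) * B v) := by
    intro v
    rw [zetaWeight, hw]
    simp only [hB]
    ring
  have hint : MeasureTheory.Integrable (fun v : ℝ => zetaWeight s (c + v * Complex.I) *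
      ((t : ℂ) ^ (s - (c + v * Complex.I)) * smoothCutoff R (c + v * Complex.I))) := by
    simp_rw [eK]
    refine (hBi.norm.const_mul (M * t ^ (-σ))).mono' ?_ (Eventually.of_forall fun v => ?_)
    · refine Continuous.aestronglyMeasurable (Continuous.mul ?_ (htc.mul hBc))
      refine continuous_iff_continuousAt.2 fun v => ?_
      have hne : (c + v * Complex.I : ℂ) ≠ 1 := fun h => by
        have := congrArg Complex.re h
        rw [hre, Complex.one_re] at this
        linarith
      have ha := analyticOn_riemannZeta _ hne
      exact ContinuousAt.comp (f := fun v : ℝ => (c + v * Complex.I : ℂ))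
        (g := fun u => deriv riemannZeta u / riemannZeta u)
        (ha.deriv.continuousAt.div ha.continuousAt
          (riemannZeta_ne_zero_of_one_le_re (by rw [hre]; exact hc.le))) (by fun_prop)
    · rw [norm_mul, norm_mul, htn, ← mul_assoc]
      gcongr
      exact norm_logDeriv_zeta_le_of_one_lt hc v
  refine ⟨hint, ?_⟩
  set F : ℕ → ℝ → ℂ := fun n v => LSeries.term (fun n => (ArithmeticFunction.vonMangoldt n : ℂ))
      (c + v * Complex.I) n * ((t : ℂ) ^ (s - (c + v * Complex.I)) * B v) with hF
  have eF : ∀ n : ℕ, ∀ v : ℝ, F n v = mangoldtCoeff s n * (twistedGamma (σ + v * Complex.I) *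
      ((n * t : ℝ) : ℂ) ^ (-(σ + v * Complex.I)) * smoothCutoff R ((s + σ : ℝ) + v * Complex.I)) := by
    intro n v
    have e1 : s + σ = c := by rw [hσ]; ring
    simp only [hF, hB]
    rcases Nat.eq_zero_or_pos n with rfl | hn
    · simp [mangoldtCoeff]
    have hn0 : (0 : ℝ) < n := by exact_mod_cast hn
    have hnne : (n : ℂ) ≠ 0 := by exact_mod_cast hn0.ne'
    rw [LSeries.term_of_ne_zero hn.ne', e1, mangoldtCoeff, Complex.ofReal_mul,
      Complex.mul_cpow_ofReal_nonneg hn0.le ht.le, div_eq_mul_inv, ← Complex.cpow_neg]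
    have e2 : (n : ℂ) ^ (-(c + v * Complex.I)) = (n : ℂ) ^ (-(s : ℂ)) *
        (n : ℂ) ^ (-(σ + v * Complex.I)) := by
      rw [← Complex.cpow_add _ _ hnne, hσ]
      congr 1
      push_cast
      ring
    have e3 : (s : ℂ) - (c + v * Complex.I) = -(σ + v * Complex.I) := by rw [hσ]; push_cast; ring
    rw [e2, e3, Complex.ofReal_natCast]
    ring
  have hFn : ∀ n v, ‖F n v‖ = ‖mangoldtCoeff c n‖ * t ^ (-σ) * ‖B v‖ := by
    intro n v
    simp only [hF]
    rw [norm_mul, norm_mul, htn, LSeries.norm_term_eq, norm_mangoldtCoeff, hre, mul_assoc]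
    congr 1
    split_ifs with h
    · subst h; simp
    · rw [Complex.norm_real, Real.norm_of_nonneg ArithmeticFunction.vonMangoldt_nonneg,
        Real.rpow_neg (Nat.cast_nonneg n), div_eq_mul_inv]
  have hFi : ∀ n, MeasureTheory.Integrable (F n) := by
    intro n
    refine (hBi.norm.const_mul (‖mangoldtCoeff c n‖ * t ^ (-σ))).mono' ?_
      (Eventually.of_forall fun v => (hFn n v).le)
    simp only [hF]
    refine Continuous.aestronglyMeasurable (Continuous.mul ?_ (htc.mul hBc))
    rcases Nat.eq_zero_or_pos n with rfl | hn
    · simp only [LSeries.term_zero]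
      exact continuous_const
    have hnne : (n : ℂ) ≠ 0 := by exact_mod_cast hn.ne'
    simp only [LSeries.term_of_ne_zero hn.ne']
    refine Continuous.div continuous_const (Continuous.const_cpow (by fun_prop) (Or.inl hnne))
      fun v => ?_
    rw [Complex.cpow_ne_zero_iff]
    exact Or.inl hnne
  have hsum := MeasureTheory.hasSum_integral_of_summable_integral_norm hFi (by
    simp_rw [hFn, MeasureTheory.integral_const_mul]
    exact ((summable_norm_mangoldtCoeff hc).mul_right _).mul_right _)
  have e4 : ∀ v, ∑' n, F n v = -(zetaWeight s (c + v * Complex.I) *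
      ((t : ℂ) ^ (s - (c + v * Complex.I)) * smoothCutoff R (c + v * Complex.I))) := by
    intro v
    have h1 := ArithmeticFunction.LSeries_vonMangoldt_eq_deriv_riemannZeta_div
      (s := c + v * Complex.I) (by rw [hre]; exact hc)
    rw [eK]
    simp only [hF]
    rw [tsum_mul_right]
    rw [neg_div] at h1
    change LSeries _ _ * _ = _
    rw [h1]
    ring
  simp_rw [e4] at hsum
  rw [MeasureTheory.integral_neg] at hsum
  have e5 : ∀ n, ∫ v, F n v = (2 * Real.pi) * (mangoldtCoeff s n * smoothedExp s R (n * t)) := by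
    intro n
    rcases Nat.eq_zero_or_pos n with rfl | hn
    · simp_rw [eF]
      simp [mangoldtCoeff]
    have hn0 : (0 : ℝ) < n := by exact_mod_cast hn
    simp_rw [eF]
    rw [MeasureTheory.integral_const_mul, integral_twistedGamma_mul_smoothCutoff hs hσ0 hR
      (by positivity)]
    ring
  simp_rw [e5] at hsum
  have h2pi : (2 * Real.pi : ℂ) ≠ 0 := by
    exact_mod_cast (by positivity : (2 * Real.pi : ℝ) ≠ 0)
  have := hsum.mul_left (1 / (2 * Real.pi : ℂ))
  have e6 : ∀ x : ℂ, 1 / (2 * Real.pi : ℂ) * (2 * Real.pi * x) = x := fun x => by field_simp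
  simp only [e6] at this
  rw [neg_mul, ← mul_neg]
  exact this

/-! ### Smoothed sums over the zeros as contour integrals -/

/-- The residue theorem for the contour integrand, on a rectangle that avoids the real axis. -/
theorem rectIntegral_zetaWeight (s R : ℝ) {t : ℝ} (ht : 0 < t) {a b c d : ℝ} (ha : a < 0)
    (hb : 1 < b) (hcd : c ≤ d) (h0 : 0 < c ∨ d < 0)
    (hnz : ∀ ρ ∈ complexZetaZeros, ρ.im ≠ c ∧ ρ.im ≠ d) (Z : Finset ℂ)
    (hZ : ∀ ρ, ρ ∈ Z ↔ ρ ∈ complexZetaZeros ∧ c < ρ.im ∧ ρ.im < d) :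
    rectIntegral (fun u => zetaWeight s u * ((t : ℂ) ^ (s - u) * smoothCutoff R u)) a b c d =
      2 * Real.pi * Complex.I * ∑ ρ ∈ Z, (zetaMult ρ : ℂ) *
        (twistedGamma (ρ - s) * ((t : ℂ) ^ (s - ρ) * smoothCutoff R ρ)) := by
  have htne : (t : ℂ) ≠ 0 := by exact_mod_cast ht.ne'
  have him : ∀ u : ℂ, u.im ∈ Set.Icc c d → u.im ≠ 0 := by
    intro u hu h
    rw [h] at hu
    rcases h0 with h0 | h0
    · linarith [hu.1]
    · linarith [hu.2]
  have h := rectIntegral_logDeriv_mul (a := a) (b := b) (by linarith) hcd (U := {u : ℂ | u.im ≠ 0})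
    (isOpen_ne_fun Complex.continuous_im continuous_const) (fun u hu => him u hu.2)
    (f := riemannZeta)
    (Ψ := fun u => twistedGamma (u - s) * ((t : ℂ) ^ (s - u) * smoothCutoff R u))
    (fun u hu => (differentiableAt_riemannZeta (by
      rintro rfl
      exact hu (by simp))).differentiableWithinAt)
    (fun u hu => by
      have hu0 : u.im ≠ 0 := hu
      have h1 : DifferentiableAt ℂ (fun u : ℂ => twistedGamma (u - s)) u :=
        DifferentiableAt.comp (f := fun u : ℂ => u - s) u (differentiableAt_twistedGamma fun m =>
          ne_neg_natCast_of_im_ne_zero (by simpa using hu0) m) (by fun_prop)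
      have h2 : DifferentiableAt ℂ (fun u : ℂ => (t : ℂ) ^ (s - u)) u :=
        DifferentiableAt.const_cpow (by fun_prop) (Or.inl htne)
      exact (h1.mul (h2.mul (differentiable_smoothCutoff R u))).differentiableWithinAt)
    Z (fun ρ hρ => by
      obtain ⟨h1, h2, h3⟩ := (hZ ρ).1 hρ
      have h4 := complexZetaZeros_re_mem h1
      exact ⟨⟨by linarith [h4.1], by linarith [h4.2]⟩, h2, h3⟩)
    (fun u hu => by
      constructor
      · intro hz
        have h1 : u ∈ complexZetaZeros := ⟨hz, him u hu.2⟩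
        obtain ⟨h2, h3⟩ := hnz u h1
        exact (hZ u).2 ⟨h1, lt_of_le_of_ne hu.2.1 h2.symm, lt_of_le_of_ne hu.2.2 h3⟩
      · exact fun hρ => ((hZ u).1 hρ).1.1)
    (fun ρ hρ => analyticOrderAt_riemannZeta_ne_top
      (ne_one_of_mem_complexZetaZeros ((hZ ρ).1 hρ).1))
  simp only [zetaMult]
  rw [← h]
  congr 1 with u
  rw [zetaWeight]
  ring

/-- Smoothed sums over all zeros above a fixed height are limits of contour integrals, and converge
in the weighted `L²` space as the cutoff is removed. -/
theorem exists_l2Converges_tendsto_smoothed_sum {s : ℝ} (hs : 1 / 2 < s) (hs1 : s < 1) :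
    ∃ y₀ : ℝ, 9 ≤ y₀ ∧ ∃ T : ℕ → ℝ, (∀ j : ℕ, 14 ≤ j → (j : ℝ) ≤ T j) ∧
      ∃ D : ℝ → ℝ → ℂ, L2Converges D ∧ ∀ R : ℝ, 0 < R → ∀ t : ℝ, 0 < t →
        Tendsto (fun j : ℕ => ∑ ρ ∈ zetaZerosBelow (T j) \ zetaZerosBelow y₀, (zetaMult ρ : ℂ) *
          (twistedGamma (ρ - s) * ((t : ℂ) ^ (s - ρ) * smoothCutoff R ρ))) atTop (𝓝 (D R t)) := by
  obtain ⟨C₁, hC₁, hgood⟩ := exists_good_height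
  choose! T hT1 hT2 hT3 hT4 using hgood
  obtain ⟨C₂, hC₂, hG⟩ := exists_norm_twistedGamma_le
  -- the vertical edges are at `σ < 0` and `c > 1`; for `σ ≤ Re u ≤ c` the size of `t ^ (s - u)` lies
  -- between `t ^ β` and `t ^ α`, both of which are in the weighted `L²` space
  set σ : ℝ := (s - 1) / 2 with hσ
  set c : ℝ := (s + 3 / 2) / 2 with hc
  set α : ℝ := (s + 1) / 2 with hα
  set β : ℝ := (s - 3 / 2) / 2 with hβ
  have hα1 : α < 1 := by linarith
  have hβ1 : -(1 / 2) < β := by linarith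
  have hβα : β ≤ α := by linarith
  have hsα : s - α = σ := by rw [hα, hσ]; ring
  have hsβ : s - β = c := by rw [hβ, hc]; ring
  have hσc : σ ≤ c := by linarith
  have hc1 : 1 < c := by linarith
  set y₀ : ℝ := T 12 with hy₀
  have hy12 : 12 ≤ y₀ := by simpa using hT1 12 le_rfl
  have hy13 : y₀ ≤ 13 := by
    have := hT2 12 le_rfl
    norm_num at this
    linarith
  have hynz : ∀ ρ ∈ complexZetaZeros, |ρ.im| ≠ y₀ := hT3 12 le_rfl
  -- the four boundary pieces that survive in the limit
  set ν₁ := MeasureTheory.volume.restrict (Set.Ioi y₀) with hν₁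
  set ν₂ := MeasureTheory.volume.restrict (Set.Iic (-y₀)) with hν₂
  set ν₃ := MeasureTheory.volume.restrict (Set.Ioc σ c) with hν₃
  set ν₄ := MeasureTheory.volume.restrict (Set.Ioc (-y₀) y₀) with hν₄
  have hvert : ∀ a v : ℝ, (a + v * Complex.I : ℂ).re = a := fun a v => by simp
  have hverti : ∀ a v : ℝ, (a + v * Complex.I : ℂ).im = v := fun a v => by simp
  obtain ⟨iL1, iL2⟩ := integrableOn_zetaWeight_left hs hs1 hσ (y₀ := y₀) (by linarith)
  have hline : ∀ (a : ℝ), σ ≤ a → a ≤ c → ∀ ν : MeasureTheory.Measure ℝ,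
      MeasureTheory.SFinite ν →
      MeasureTheory.Integrable (fun y : ℝ => zetaWeight s (a + y * Complex.I)) ν →
      L2Converges fun R t => ∫ y : ℝ, zetaWeight s (a + y * Complex.I) *
        ((t : ℂ) ^ (s - (a + y * Complex.I)) * smoothCutoff R (a + y * Complex.I)) ∂ν := by
    intro a ha1 ha2 ν hν hi
    refine l2Converges_integral_smoothCutoff hi (by fun_prop) hα1 hβ1 hβα
      (Eventually.of_forall fun y => ?_) (Eventually.of_forall fun y => ?_)
    · rw [hvert, hsα]; exact ha1
    · rw [hvert, hsβ]; exact ha2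
  have L1 := hline σ le_rfl hσc ν₁ inferInstance iL1
  have L2 := hline σ le_rfl hσc ν₂ inferInstance iL2
  have i4 : MeasureTheory.Integrable (fun y : ℝ => zetaWeight s (c + y * Complex.I)) ν₄ := by
    have hcont : Continuous fun y : ℝ => zetaWeight s (c + y * Complex.I) :=
      continuous_iff_continuousAt.2 fun y => ContinuousAt.comp (f := fun y : ℝ => (c + y * Complex.I : ℂ))
        (continuousAt_zetaWeight_of_one_lt_re hs1 (by rw [hvert]; exact hc1)) (by fun_prop)
    exact (hcont.integrableOn_Icc (a := -y₀) (b := y₀)).mono_set Set.Ioc_subset_Icc_self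
  have L4 := hline c hσc le_rfl ν₄ inferInstance i4
  have hhor : ∀ y : ℝ, |y| = y₀ → L2Converges fun R t => ∫ x : ℝ,
      zetaWeight s (x + y * Complex.I) * ((t : ℂ) ^ (s - (x + y * Complex.I)) *
        smoothCutoff R (x + y * Complex.I)) ∂ν₃ := by
    intro y hy
    have hy0 : y ≠ 0 := by
      rintro rfl
      rw [abs_zero] at hy
      linarith
    have hcont : Continuous fun x : ℝ => zetaWeight s (x + y * Complex.I) :=
      continuous_iff_continuousAt.2 fun x => ContinuousAt.comp (f := fun x : ℝ => (x + y * Complex.I : ℂ))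
        (continuousAt_zetaWeight_of_im_ne_zero (by rw [hverti]; exact hy0) fun h => hynz _ h (by
          rw [hverti]; exact hy)) (by fun_prop)
    refine l2Converges_integral_smoothCutoff
      ((hcont.integrableOn_Icc (a := σ) (b := c)).mono_set Set.Ioc_subset_Icc_self)
      (by fun_prop) hα1 hβ1 hβα ?_ ?_
    · filter_upwards [MeasureTheory.ae_restrict_mem measurableSet_Ioc] with x hx
      rw [hvert, hsα]; exact hx.1.le
    · filter_upwards [MeasureTheory.ae_restrict_mem measurableSet_Ioc] with x hx
      rw [hvert, hsβ]; exact hx.2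
  have L3 := hhor y₀ (abs_of_pos (by linarith))
  have L5 := hhor (-y₀) (by rw [abs_neg, abs_of_pos (by linarith)])
  -- the complete right edge
  have hright := fun (R : ℝ) (hR : 0 < R) (t : ℝ) (ht : 0 < t) =>
    integrable_and_hasSum_right_line (s := s) (c := c) (by rw [abs_of_pos (by linarith)]; linarith)
      (by linarith) hc1 (R := R) hR.le (t := t) ht
  have L6 := l2Converges_sum_smoothedExp (s := s) (by rw [abs_of_pos (by linarith)]; linarith)
    (norm_mangoldtCoeff_le (s := s) (by linarith)) (η := (s - 1 / 2) / 4) (by linarith)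
    (by linarith) (summable_mangoldtCoeff_sq hs) fun R hR t ht => (hright R hR t ht).2
  refine ⟨y₀, by linarith, T, fun j hj => hT1 j (by omega), fun R => (1 / (2 * Real.pi * Complex.I)) •
    ((fun t : ℝ => ∫ x : ℝ, zetaWeight s (x + y₀ * Complex.I) *
      ((t : ℂ) ^ (s - (x + y₀ * Complex.I)) * smoothCutoff R (x + y₀ * Complex.I)) ∂ν₃) +
    (-1 : ℂ) • (fun t : ℝ => ∫ x : ℝ, zetaWeight s (x + (-y₀ : ℝ) * Complex.I) *
      ((t : ℂ) ^ (s - (x + (-y₀ : ℝ) * Complex.I)) *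
        smoothCutoff R (x + (-y₀ : ℝ) * Complex.I)) ∂ν₃) +
    (-(2 * Real.pi) * Complex.I) • (fun t : ℝ => -(1 / (2 * Real.pi)) *
      ∫ v : ℝ, zetaWeight s (c + v * Complex.I) *
      ((t : ℂ) ^ (s - (c + v * Complex.I)) * smoothCutoff R (c + v * Complex.I))) +
    (-Complex.I) • (fun t : ℝ => ∫ v : ℝ, zetaWeight s (c + v * Complex.I) *
      ((t : ℂ) ^ (s - (c + v * Complex.I)) * smoothCutoff R (c + v * Complex.I)) ∂ν₄) +
    (-Complex.I) • (fun t : ℝ => ∫ v : ℝ, zetaWeight s (σ + v * Complex.I) *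
      ((t : ℂ) ^ (s - (σ + v * Complex.I)) * smoothCutoff R (σ + v * Complex.I)) ∂ν₁) +
    (-Complex.I) • (fun t : ℝ => ∫ v : ℝ, zetaWeight s (σ + v * Complex.I) *
      ((t : ℂ) ^ (s - (σ + v * Complex.I)) * smoothCutoff R (σ + v * Complex.I)) ∂ν₂)),
    (((((L3.add (L5.const_smul _)).add (L6.const_smul _)).add (L4.const_smul _)).add
      (L1.const_smul _)).add (L2.const_smul _)).const_smul _, fun R hR t ht => ?_⟩
  set K : ℂ → ℂ := fun u => zetaWeight s u * ((t : ℂ) ^ (s - u) * smoothCutoff R u) with hK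
  obtain ⟨iR, -⟩ := hright R hR t ht
  have iLK : ∀ S : Set ℝ, MeasurableSet S → MeasureTheory.IntegrableOn
      (fun y : ℝ => zetaWeight s (σ + y * Complex.I)) S →
      MeasureTheory.IntegrableOn (fun y : ℝ => K (σ + y * Complex.I)) S := by
    intro S hS hi
    have h2 := (differentiable_smoothCutoff R).continuous
    have h3 : Continuous fun y : ℝ => (t : ℂ) ^ (s - (σ + y * Complex.I)) :=
      Continuous.const_cpow (by fun_prop) (Or.inl (by exact_mod_cast ht.ne'))
    have h4 : Continuous fun y : ℝ => (t : ℂ) ^ (s - (σ + y * Complex.I)) *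
      smoothCutoff R (σ + y * Complex.I) := by fun_prop
    refine MeasureTheory.Integrable.mul_bdd (c := (t ^ α + t ^ β) * Real.exp (σ ^ 2)) hi
      h4.aestronglyMeasurable (Eventually.of_forall fun y => ?_)
    rw [norm_mul]
    have h5 := norm_ofReal_cpow_sub_le ht (u := σ + y * Complex.I) (s := s) (α := α) (β := β)
      (by rw [hvert, hsα]) (by rw [hvert, hsβ]; exact hσc)
    have h6 := norm_smoothCutoff_le R hR.le (σ + y * Complex.I)
    rw [hvert] at h6
    gcongr
  have iK1 := iLK _ measurableSet_Ioi iL1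
  have iK2 := iLK _ measurableSet_Iic iL2
  have hTt : Tendsto T atTop atTop := by
    refine tendsto_atTop_mono' atTop ?_ tendsto_natCast_atTop_atTop
    filter_upwards [eventually_ge_atTop 12] with j hj using hT1 j hj
  have hTn : Tendsto (fun j => -T j) atTop atBot := tendsto_neg_atTop_atBot.comp hTt
  -- the horizontal edges at the moving height disappear
  have hhor0 : ∀ ε : ℝ, |ε| = 1 → Tendsto (fun j : ℕ => ∫ x in σ..c, K (x + (ε * T j : ℝ) * Complex.I))
      atTop (𝓝 0) := by
    intro ε hε
    set B : ℝ := C₁ * C₂ * ((t ^ α + t ^ β) * (2 * Real.exp 4 * Real.exp (2 * R))) * (c - σ) with hB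
    have hlim : Tendsto (fun j : ℕ => B * ((j : ℝ) ^ 2 * Real.exp (-(j : ℝ)))) atTop (𝓝 0) := by
      have := ((Real.tendsto_pow_mul_exp_neg_atTop_nhds_zero 2).comp
        (tendsto_natCast_atTop_atTop (R := ℝ))).const_mul B
      simpa using this
    refine squeeze_zero_norm' ?_ hlim
    filter_upwards [eventually_ge_atTop 12] with j hj
    have hj1 := hT1 j hj
    have hj12 : (12 : ℝ) ≤ j := by exact_mod_cast hj
    have hTpos : 0 < T j := by linarith
    have habs : |ε * T j| = T j := by rw [abs_mul, hε, one_mul, abs_of_pos hTpos]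
    have hpt : ∀ x ∈ Set.uIoc σ c, ‖K (x + (ε * T j : ℝ) * Complex.I)‖ ≤
        C₁ * C₂ * ((t ^ α + t ^ β) * (2 * Real.exp 4 * Real.exp (2 * R))) *
          ((j : ℝ) ^ 2 * Real.exp (-(j : ℝ))) := by
      intro x hx
      rw [Set.uIoc_of_le hσc] at hx
      obtain ⟨hx1, hx2⟩ := hx
      set u : ℂ := x + (ε * T j : ℝ) * Complex.I with hu
      have hure : u.re = x := hvert _ _
      have huim : u.im = ε * T j := hverti _ _
      have b1 := hT4 j hj u (by rw [huim, habs]) (by rw [hure]; linarith) (by rw [hure]; linarith)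
      have b2 : ‖twistedGamma (u - s)‖ ≤ C₂ * 1 := by
        refine (hG (u - s) (by
          simp only [Complex.sub_re, hure, Complex.ofReal_re]
          rw [abs_le]; constructor <;> linarith) (by
          simp only [Complex.sub_im, huim, Complex.ofReal_im, sub_zero, habs]; linarith)).trans ?_
        gcongr
        simp only [Complex.sub_im, huim, Complex.ofReal_im, sub_zero, habs, Complex.sub_re, hure,
          Complex.ofReal_re]
        exact Real.rpow_le_one_of_one_le_of_nonpos (by linarith) (by linarith)
      have b3 := norm_ofReal_cpow_sub_le ht (u := u) (s := s) (α := α) (β := β)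
        (by rw [hure, hsα]; exact hx1.le) (by rw [hure, hsβ]; exact hx2)
      have b4 : ‖smoothCutoff R u‖ ≤ 2 * Real.exp 4 * Real.exp (2 * R) * Real.exp (-(j : ℝ)) := by
        refine (norm_smoothCutoff_le_of_le hR.le u).trans ?_
        rw [huim, habs, hure, mul_assoc (2 * Real.exp 4), ← Real.exp_add]
        gcongr
        · nlinarith
        · linarith
      simp only [hK]
      rw [zetaWeight, norm_mul, norm_mul, norm_mul]
      calc _ ≤ (C₁ * (j : ℝ) ^ 2) * (C₂ * 1) * ((t ^ α + t ^ β) *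
            (2 * Real.exp 4 * Real.exp (2 * R) * Real.exp (-(j : ℝ)))) := by gcongr
        _ = _ := by ring
    refine (intervalIntegral.norm_integral_le_of_norm_le_const hpt).trans (le_of_eq ?_)
    rw [abs_of_nonneg (by linarith), hB]
    ring
  have hup : Tendsto (fun j => rectIntegral K σ c y₀ (T j)) atTop (𝓝
      ((∫ x in σ..c, K (x + y₀ * Complex.I)) - 0 +
        Complex.I * (∫ y in Set.Ioi y₀, K (c + y * Complex.I)) -
        Complex.I * ∫ y in Set.Ioi y₀, K (σ + y * Complex.I))) := by
    have h1 := hhor0 1 (by simp)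
    simp only [one_mul] at h1
    exact ((tendsto_const_nhds.sub h1).add ((MeasureTheory.intervalIntegral_tendsto_integral_Ioi y₀
      iR.integrableOn hTt).const_mul _)).sub
      ((MeasureTheory.intervalIntegral_tendsto_integral_Ioi y₀ iK1 hTt).const_mul _)
  have hlow : Tendsto (fun j => rectIntegral K σ c (-T j) (-y₀)) atTop (𝓝
      (0 - (∫ x in σ..c, K (x + (-y₀ : ℝ) * Complex.I)) +
        Complex.I * (∫ y in Set.Iic (-y₀), K (c + y * Complex.I)) -
        Complex.I * ∫ y in Set.Iic (-y₀), K (σ + y * Complex.I))) := by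
    have h1 := hhor0 (-1) (by simp)
    simp only [neg_one_mul] at h1
    exact ((h1.sub tendsto_const_nhds).add ((MeasureTheory.intervalIntegral_tendsto_integral_Iic (-y₀)
      iR.integrableOn hTn).const_mul _)).sub
      ((MeasureTheory.intervalIntegral_tendsto_integral_Iic (-y₀) iK2 hTn).const_mul _)
  have h2pi : (2 * Real.pi * Complex.I : ℂ) ≠ 0 := Complex.two_pi_I_ne_zero
  have htot := (hup.add hlow).const_mul (1 / (2 * Real.pi * Complex.I))
  have hsplit : ∫ v : ℝ, K (c + v * Complex.I) = (∫ y in Set.Iic (-y₀), K (c + y * Complex.I)) +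
      (∫ y in Set.Ioc (-y₀) y₀, K (c + y * Complex.I)) + ∫ y in Set.Ioi y₀, K (c + y * Complex.I) := by
    have iR' : MeasureTheory.Integrable fun v : ℝ => K (c + v * Complex.I) := iR
    rw [← MeasureTheory.setIntegral_univ (μ := MeasureTheory.volume),
      ← Set.Iic_union_Ioi (a := -y₀), ← Set.Ioc_union_Ioi_eq_Ioi (a := -y₀) (b := y₀) (by linarith),
      MeasureTheory.setIntegral_union _ (measurableSet_Ioc.union measurableSet_Ioi)
        iR'.integrableOn iR'.integrableOn, MeasureTheory.setIntegral_union Set.Ioc_disjoint_Ioi_same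
        measurableSet_Ioi iR'.integrableOn iR'.integrableOn, add_assoc]
    rw [Set.Ioc_union_Ioi_eq_Ioi (by linarith)]
    exact Set.Iic_disjoint_Ioi le_rfl
  refine Tendsto.congr' ?_ (htot.trans (le_of_eq ?_))
  · filter_upwards [eventually_ge_atTop 14] with j hj
    have hj1 := hT1 j (by omega)
    have hj14 : (14 : ℝ) ≤ j := by exact_mod_cast hj
    have hyT : y₀ < T j := by linarith
    set W := zetaZerosBelow (T j) \ zetaZerosBelow y₀ with hW
    have hWm : ∀ ρ, ρ ∈ W ↔ ρ ∈ complexZetaZeros ∧ y₀ < |ρ.im| ∧ |ρ.im| < T j := by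
      intro ρ
      rw [hW, Finset.mem_sdiff, mem_zetaZerosBelow, mem_zetaZerosBelow]
      constructor
      · rintro ⟨⟨h1, h2⟩, h3⟩
        refine ⟨h1, lt_of_le_of_ne (not_lt.1 fun h => h3 ⟨h1, h⟩) (hynz ρ h1).symm, h2⟩
      · rintro ⟨h1, h2, h3⟩
        exact ⟨⟨h1, h3⟩, fun h => absurd h.2 (not_lt.2 h2.le)⟩
    have r1 := rectIntegral_zetaWeight s R ht (a := σ) (b := c) (by linarith) hc1 hyT.le
      (Or.inl (by linarith)) (fun ρ hρ => by
        constructor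
        · intro h
          exact hynz ρ hρ (by rw [h, abs_of_pos (by linarith)])
        · intro h
          exact hT3 j (by omega) ρ hρ (by rw [h, abs_of_pos (by linarith)]))
      (W.filter fun ρ => 0 < ρ.im) (fun ρ => by
        rw [Finset.mem_filter, hWm]
        constructor
        · rintro ⟨⟨h1, h2, h3⟩, h4⟩
          rw [abs_of_pos h4] at h2 h3
          exact ⟨h1, h2, h3⟩
        · rintro ⟨h1, h2, h3⟩
          have h4 : 0 < ρ.im := by linarith
          rw [abs_of_pos h4]
          exact ⟨⟨h1, h2, h3⟩, h4⟩)
    have r2 := rectIntegral_zetaWeight s R ht (a := σ) (b := c) (by linarith) hc1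
      (neg_le_neg hyT.le) (Or.inr (by linarith)) (fun ρ hρ => by
        constructor
        · intro h
          exact hT3 j (by omega) ρ hρ (by rw [h, abs_neg, abs_of_pos (by linarith)])
        · intro h
          exact hynz ρ hρ (by rw [h, abs_neg, abs_of_pos (by linarith)]))
      (W.filter fun ρ => ¬0 < ρ.im) (fun ρ => by
        rw [Finset.mem_filter, hWm]
        constructor
        · rintro ⟨⟨h1, h2, h3⟩, h4⟩
          rw [abs_of_nonpos (not_lt.1 h4)] at h2 h3
          exact ⟨h1, by linarith, by linarith⟩
        · rintro ⟨h1, h2, h3⟩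
          have h4 : ρ.im < 0 := by linarith
          rw [abs_of_neg h4]
          exact ⟨⟨h1, by linarith, by linarith⟩, not_lt.2 h4.le⟩)
    rw [← Finset.sum_filter_add_sum_filter_not W (fun ρ => 0 < ρ.im)]
    change 1 / (2 * Real.pi * Complex.I) * (rectIntegral K σ c y₀ (T j) +
      rectIntegral K σ c (-T j) (-y₀)) = _
    rw [r1, r2, ← mul_add, ← mul_assoc, one_div, inv_mul_cancel₀ h2pi, one_mul]
  · congr 1
    simp only [Pi.smul_apply, Pi.add_apply, smul_eq_mul]
    change _ = 1 / (2 * Real.pi * Complex.I) * ((∫ x in Set.Ioc σ c, K (x + y₀ * Complex.I)) +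
      -1 * (∫ x in Set.Ioc σ c, K (x + (-y₀ : ℝ) * Complex.I)) +
      -(2 * Real.pi) * Complex.I * (-(1 / (2 * Real.pi)) * ∫ v : ℝ, K (c + v * Complex.I)) +
      -Complex.I * (∫ v in Set.Ioc (-y₀) y₀, K (c + v * Complex.I)) +
      -Complex.I * (∫ v in Set.Ioi y₀, K (σ + v * Complex.I)) +
      -Complex.I * (∫ v in Set.Iic (-y₀), K (σ + v * Complex.I)))
    rw [intervalIntegral.integral_of_le hσc, intervalIntegral.integral_of_le hσc, hsplit]
    have hpi : (Real.pi : ℂ) ≠ 0 := by exact_mod_cast Real.pi_ne_zero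
    have hcancel : ∀ x : ℂ, -(2 * Real.pi) * Complex.I * (-(1 / (2 * Real.pi)) * x) =
        Complex.I * x := fun x => by field_simp
    rw [hcancel]
    ring

/-! ### Sums over the zeros -/

/-- The sum `∑ Γ(ρ-s) e^{iπ(ρ-s)/2} t^{s-ρ}` over the complex zeros with `|Im ρ| < R`, with
multiplicity.  The square partial sums of `Σ₂` are weighted mean squares of this function. -/
noncomputable def zeroSum (s R t : ℝ) : ℂ :=
  ∑ ρ ∈ zetaZerosBelow R, (zetaMult ρ : ℂ) * (twistedGamma (ρ - s) * (t : ℂ) ^ (s - ρ))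

theorem measurable_zeroSum (s R : ℝ) : Measurable (zeroSum s R) := by
  unfold zeroSum
  fun_prop

theorem zetaZerosBelow_mono {R T : ℝ} (h : R ≤ T) : zetaZerosBelow R ⊆ zetaZerosBelow T := by
  intro ρ hρ
  rw [mem_zetaZerosBelow] at hρ ⊢
  exact ⟨hρ.1, hρ.2.trans_le h⟩

theorem memLp_zeroSum {s : ℝ} (hs : 1 / 2 < s) (hs1 : s < 1) (R : ℝ) :
    MeasureTheory.MemLp (zeroSum s R) 2 weightMeasure := by
  obtain ⟨H, hH0, hH⟩ := exists_eLpNorm_le_of_norm_le_rpow (α := (s + 1) / 2)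
    (β := (s - 3 / 2) / 2) (by linarith) (by linarith) (by linarith)
  refine ⟨(measurable_zeroSum s R).aestronglyMeasurable, (hH _
    (measurable_zeroSum s R).aestronglyMeasurable
    (∑ ρ ∈ zetaZerosBelow R, zetaMult ρ * ‖twistedGamma (ρ - s)‖)
    (Finset.sum_nonneg fun _ _ => by positivity) fun t ht => ?_).trans_lt ENNReal.ofReal_lt_top⟩
  rw [Finset.sum_mul]
  refine (norm_sum_le _ _).trans (Finset.sum_le_sum fun ρ hρ => ?_)
  have h1 := complexZetaZeros_re_mem (mem_zetaZerosBelow.1 hρ).1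
  have h2 := norm_ofReal_cpow_sub_le ht (u := ρ) (s := s) (α := (s + 1) / 2)
    (β := (s - 3 / 2) / 2) (by linarith [h1.1]) (by linarith [h1.2])
  rw [norm_mul, norm_mul, Complex.norm_natCast, ← mul_assoc]
  gcongr

/-- The smooth cutoff is exponentially close to the sharp one away from `|Im u| = R`. -/
theorem norm_ite_sub_smoothCutoff_le {R : ℝ} (hR : 0 ≤ R) (u : ℂ) :
    ‖(if |u.im| < R then 1 else 0) - smoothCutoff R u‖ ≤
      2 * Real.exp (u.re ^ 2) * Real.exp (-2 * |(|u.im| - R)|) := by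
  split_ifs with h
  · rw [norm_sub_rev, abs_of_neg (by linarith), neg_sub]
    exact norm_smoothCutoff_sub_one_le R u
  · rw [zero_sub, norm_neg, abs_of_nonneg (by linarith)]
    exact norm_smoothCutoff_le_of_le hR u

/-- The sums over zeros converge in the weighted `L²` space: they differ from their smoothed
versions by little, as only zeros near the height of truncation contribute to the difference. -/
theorem l2Converges_zeroSum {s : ℝ} (hs : 1 / 2 < s) (hs1 : s < 1) : L2Converges (zeroSum s) := by
  obtain ⟨y₀, hy₀, T, hT, D, hD, hDt⟩ := exists_l2Converges_tendsto_smoothed_sum hs hs1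
  obtain ⟨C₂, hC₂, hG⟩ := exists_norm_twistedGamma_le
  obtain ⟨C₃, hC₃, hZ⟩ := exists_sum_zeros_transition_le (a := s - 1 / 2) (by linarith)
    (by linarith)
  obtain ⟨H, hH0, hH⟩ := exists_eLpNorm_le_of_norm_le_rpow (α := (s + 1) / 2)
    (β := (s - 3 / 2) / 2) (by linarith) (by linarith) (by linarith)
  refine (hD.add (l2Converges_const (memLp_zeroSum hs hs1 y₀))).of_sub_tendsto_zero
    (Eventually.of_forall fun R => (measurable_zeroSum s R).aestronglyMeasurable) ?_
  set B : ℝ → ℝ := fun R => C₂ * (2 * Real.exp 1) * (C₃ * (R + 1) ^ (-((s - 1 / 2) / 2))) with hB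
  have hBt : Tendsto (fun R => ENNReal.ofReal (B R * H)) atTop (𝓝 0) := by
    have h1 : Tendsto (fun R : ℝ => (R + 1) ^ (-((s - 1 / 2) / 2))) atTop (𝓝 0) :=
      (tendsto_rpow_neg_atTop (by linarith)).comp (tendsto_atTop_add_const_right _ _ tendsto_id)
    have h2 := ((h1.const_mul C₃).const_mul (C₂ * (2 * Real.exp 1))).mul_const H
    simp only [mul_zero, zero_mul] at h2
    have h3 := ENNReal.tendsto_ofReal h2
    rwa [ENNReal.ofReal_zero] at h3
  refine tendsto_of_tendsto_of_tendsto_of_le_of_le' tendsto_const_nhds hBt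
    (Eventually.of_forall fun _ => zero_le) ?_
  filter_upwards [eventually_ge_atTop y₀] with R hR
  have hR0 : 0 < R := by linarith
  have hRB : 0 ≤ B R := by simp only [hB]; positivity
  set W : ℕ → Finset ℂ := fun j => zetaZerosBelow (T j) \ zetaZerosBelow y₀ with hW
  set f : ℕ → ℝ → ℂ := fun j t => zeroSum s R t - (∑ ρ ∈ W j, (zetaMult ρ : ℂ) *
    (twistedGamma (ρ - s) * ((t : ℂ) ^ (s - ρ) * smoothCutoff R ρ)) + zeroSum s y₀ t) with hf
  have hfm : ∀ j, Measurable (f j) := fun j => by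
    have := measurable_zeroSum s
    simp only [hf]
    fun_prop
  refine eLpNorm_le_of_tendsto (f := f) (fun j => (hfm j).aestronglyMeasurable) ?_
    fun t ht => tendsto_const_nhds.sub ((hDt R hR0 t ht).add tendsto_const_nhds)
  filter_upwards [eventually_ge_atTop (max 14 ⌈R⌉₊)] with j hj
  have hRT : R ≤ T j := (Nat.le_ceil R).trans ((Nat.cast_le.2 ((le_max_right _ _).trans hj)).trans
    (hT j ((le_max_left _ _).trans hj)))
  have hWm : ∀ ρ ∈ W j, ρ ∈ complexZetaZeros ∧ 1 ≤ |ρ.im| := by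
    intro ρ hρ
    rw [hW, Finset.mem_sdiff, mem_zetaZerosBelow, mem_zetaZerosBelow] at hρ
    refine ⟨hρ.1.1, ?_⟩
    by_contra! h
    exact hρ.2 ⟨hρ.1.1, by linarith⟩
  have hWR : (W j).filter (fun ρ => |ρ.im| < R) = zetaZerosBelow R \ zetaZerosBelow y₀ := by
    ext ρ
    simp only [hW, Finset.mem_filter, Finset.mem_sdiff, mem_zetaZerosBelow]
    constructor
    · rintro ⟨⟨h1, h2⟩, h3⟩
      exact ⟨⟨h1.1, h3⟩, h2⟩
    · rintro ⟨⟨h1, h3⟩, h2⟩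
      exact ⟨⟨⟨h1, h3.trans_le hRT⟩, h2⟩, h3⟩
  have hfeq : ∀ t, f j t = ∑ ρ ∈ W j, (zetaMult ρ : ℂ) * (twistedGamma (ρ - s) *
      ((t : ℂ) ^ (s - ρ) * ((if |ρ.im| < R then 1 else 0) - smoothCutoff R ρ))) := by
    intro t
    have h1 : zeroSum s R t = ∑ ρ ∈ W j, (zetaMult ρ : ℂ) * (twistedGamma (ρ - s) *
        ((t : ℂ) ^ (s - ρ) * (if |ρ.im| < R then 1 else 0))) + zeroSum s y₀ t := by
      rw [zeroSum, ← Finset.sum_sdiff (zetaZerosBelow_mono hR), ← hWR, Finset.sum_filter]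
      congr 1
      refine Finset.sum_congr rfl fun ρ _ => ?_
      split_ifs <;> simp
    simp only [hf]
    rw [h1, add_sub_add_right_eq_sub, ← Finset.sum_sub_distrib]
    refine Finset.sum_congr rfl fun ρ _ => ?_
    ring
  refine hH _ (hfm j).aestronglyMeasurable _ hRB fun t ht => ?_
  rw [hfeq]
  have hsum := hZ R hR0.le (W j) hWm
  calc _ ≤ ∑ ρ ∈ W j, C₂ * (2 * Real.exp 1) * ((zetaMult ρ : ℝ) *
        (|ρ.im| ^ (-(s - 1 / 2)) * Real.exp (-2 * |(|ρ.im| - R)|))) *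
          (t ^ ((s + 1) / 2) + t ^ ((s - 3 / 2) / 2)) := by
        refine (norm_sum_le _ _).trans (Finset.sum_le_sum fun ρ hρ => ?_)
        obtain ⟨h0, h1⟩ := hWm ρ hρ
        have hre := complexZetaZeros_re_mem h0
        have b1 : ‖twistedGamma (ρ - s)‖ ≤ C₂ * |ρ.im| ^ (-(s - 1 / 2)) := by
          refine (hG (ρ - s) (by
            simp only [Complex.sub_re, Complex.ofReal_re]
            rw [abs_le]; constructor <;> linarith [hre.1, hre.2]) (by simpa using h1)).trans ?_
          simp only [Complex.sub_re, Complex.ofReal_re, Complex.sub_im, Complex.ofReal_im, sub_zero]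
          gcongr
          linarith [hre.2]
        have b2 := norm_ofReal_cpow_sub_le ht (u := ρ) (s := s) (α := (s + 1) / 2)
          (β := (s - 3 / 2) / 2) (by linarith [hre.1]) (by linarith [hre.2])
        have b3 : ‖((if |ρ.im| < R then 1 else 0) - smoothCutoff R ρ : ℂ)‖ ≤
            2 * Real.exp 1 * Real.exp (-2 * |(|ρ.im| - R)|) := by
          refine (norm_ite_sub_smoothCutoff_le hR0.le ρ).trans ?_
          gcongr
          nlinarith [hre.1, hre.2]
        rw [norm_mul, norm_mul, norm_mul, Complex.norm_natCast]
        calc _ ≤ (zetaMult ρ : ℝ) * ((C₂ * |ρ.im| ^ (-(s - 1 / 2))) *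
              ((t ^ ((s + 1) / 2) + t ^ ((s - 3 / 2) / 2)) *
                (2 * Real.exp 1 * Real.exp (-2 * |(|ρ.im| - R)|)))) := by gcongr
          _ = _ := by ring
    _ ≤ _ := by
        rw [← Finset.sum_mul, ← Finset.mul_sum]
        simp only [hB]
        gcongr

/-! ### The double sum as a weighted mean square -/

theorem conj_mem_complexZetaZeros {ρ : ℂ} (h : ρ ∈ complexZetaZeros) :
    (starRingEnd ℂ) ρ ∈ complexZetaZeros := by
  refine ⟨?_, by simpa using h.2⟩
  rw [riemannZeta_conj, h.1, map_zero]

theorem zetaMult_conj {ρ : ℂ} (h : ρ ∈ complexZetaZeros) :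
    zetaMult ((starRingEnd ℂ) ρ) = zetaMult ρ := by
  have han : ∀ z : ℂ, z ≠ 1 → AnalyticAt ℂ riemannZeta z := fun z hz => by
    rw [Complex.analyticAt_iff_eventually_differentiableAt]
    filter_upwards [isOpen_ne.mem_nhds hz] with w hw using differentiableAt_riemannZeta hw
  have h1 := ne_one_of_mem_complexZetaZeros h
  have h2 := ne_one_of_mem_complexZetaZeros (conj_mem_complexZetaZeros h)
  obtain ⟨g, hg, hg0, hgz⟩ := ((han ρ h1).analyticOrderAt_ne_top).1
    (analyticOrderAt_riemannZeta_ne_top h1)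
  refine ((han _ h2).analyticOrderNatAt_eq_iff (analyticOrderAt_riemannZeta_ne_top h2)).2
    ⟨(starRingEnd ℂ) ∘ g ∘ (starRingEnd ℂ), ?_, by simpa using hg0, ?_⟩
  · rw [Complex.analyticAt_iff_eventually_differentiableAt] at hg ⊢
    have hc : Tendsto (starRingEnd ℂ) (𝓝 ((starRingEnd ℂ) ρ)) (𝓝 ρ) := by
      have := Complex.continuous_conj.tendsto ((starRingEnd ℂ) ρ)
      rwa [Complex.conj_conj] at this
    filter_upwards [hc.eventually hg] with z hz
    have := hz.conj_conj
    rwa [Complex.conj_conj] at this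
  · have hc : Tendsto (starRingEnd ℂ) (𝓝 ((starRingEnd ℂ) ρ)) (𝓝 ρ) := by
      have := Complex.continuous_conj.tendsto ((starRingEnd ℂ) ρ)
      rwa [Complex.conj_conj] at this
    filter_upwards [hc.eventually hgz] with z hz
    rw [riemannZeta_conj] at hz
    have := congrArg (starRingEnd ℂ) hz
    rw [Complex.conj_conj] at this
    rw [this, zetaMult]
    simp

/-- Conjugation permutes the zeros, so the conjugate of `zeroSum` is a sum over the same zeros with
the opposite twist. -/
theorem conj_zeroSum (s R : ℝ) {t : ℝ} (ht : 0 < t) : (starRingEnd ℂ) (zeroSum s R t) =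
    ∑ ρ ∈ zetaZerosBelow R, (zetaMult ρ : ℂ) * (Complex.Gamma (ρ - s) *
      Complex.exp (-(Real.pi / 2 * Complex.I * (ρ - s))) * (t : ℂ) ^ (s - ρ)) := by
  have hmem : ∀ ρ ∈ zetaZerosBelow R, (starRingEnd ℂ) ρ ∈ zetaZerosBelow R := fun ρ hρ => by
    rw [mem_zetaZerosBelow] at hρ ⊢
    exact ⟨conj_mem_complexZetaZeros hρ.1, by simpa using hρ.2⟩
  rw [zeroSum, map_sum]
  refine Finset.sum_nbij' (starRingEnd ℂ) (starRingEnd ℂ) hmem hmem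
    (fun _ _ => Complex.conj_conj _) (fun _ _ => Complex.conj_conj _) fun ρ hρ => ?_
  have harg : (t : ℂ).arg ≠ Real.pi := by
    rw [Complex.arg_ofReal_of_nonneg ht.le]
    exact Real.pi_ne_zero.symm
  rw [zetaMult_conj (mem_zetaZerosBelow.1 hρ).1, twistedGamma, map_mul, map_mul, map_mul,
    ← Complex.Gamma_conj, ← Complex.exp_conj, Complex.conj_natCast]
  have e1 : (starRingEnd ℂ) ((t : ℂ) ^ (s - ρ)) = (t : ℂ) ^ (s - (starRingEnd ℂ) ρ) := by
    have := Complex.cpow_conj (t : ℂ) (s - ρ) harg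
    rw [Complex.conj_ofReal] at this
    rw [← this, map_sub, Complex.conj_ofReal]
  rw [e1]
  simp only [map_sub, map_mul, Complex.conj_ofReal, Complex.conj_I, map_div₀, map_ofNat]
  congr 4
  ring

/-- The square partial sums of `Σ₂` are weighted mean squares of `zeroSum`. -/
theorem sigmaTwoPartial_eq_integral {E : ℝ → ℝ} {lam s : ℝ}
    (hM : ∀ ρ ∈ complexZetaZeros, ∀ ρ' ∈ complexZetaZeros,
      MellinConvergent (fun t : ℝ => (sieveFourier E lam t : ℂ)) (1 - (ρ + ρ' - 2 * s))) (R : ℝ) :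
    sigmaTwoPartial E lam s R = ((1 / Real.pi * ∫ t in Set.Ioi (0 : ℝ),
      sieveFourier E lam t * ‖zeroSum s R t‖ ^ 2 : ℝ) : ℂ) := by
  set Z := zetaZerosBelow R with hZ
  set c : ℂ → ℂ → ℂ := fun ρ ρ' => (zetaMult ρ : ℂ) * (zetaMult ρ' : ℂ) *
    (Complex.Gamma (ρ - s) * Complex.Gamma (ρ' - s) * sieveMellin E lam (ρ + ρ' - 2 * s)) with hc
  set e : ℂ → ℂ → ℂ := fun ρ ρ' => Complex.exp (Real.pi * (ρ - ρ') / 2 * Complex.I) with he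
  have hcsymm : ∀ ρ ρ', c ρ ρ' = c ρ' ρ := fun ρ ρ' => by
    simp only [hc]
    rw [add_comm ρ ρ']
    ring
  -- expand the square
  have hexp : ∀ t ∈ Set.Ioi (0 : ℝ), ((sieveFourier E lam t * ‖zeroSum s R t‖ ^ 2 : ℝ) : ℂ) =
      ∑ ρ ∈ Z, ∑ ρ' ∈ Z, (zetaMult ρ : ℂ) * (zetaMult ρ' : ℂ) * (Complex.Gamma (ρ - s) *
        Complex.Gamma (ρ' - s)) * e ρ ρ' *
        ((t : ℂ) ^ (1 - (ρ + ρ' - 2 * s) - 1) • (sieveFourier E lam t : ℂ)) := by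
    intro t ht
    have ht0 : 0 < t := ht
    rw [Complex.ofReal_mul, Complex.ofReal_pow, ← Complex.mul_conj', conj_zeroSum s R ht0, zeroSum,
      Finset.sum_mul_sum, Finset.mul_sum]
    refine Finset.sum_congr rfl fun ρ _ => ?_
    rw [Finset.mul_sum]
    refine Finset.sum_congr rfl fun ρ' _ => ?_
    have e1 : (t : ℂ) ^ (1 - (ρ + ρ' - 2 * s) - 1) = (t : ℂ) ^ (s - ρ) * (t : ℂ) ^ (s - ρ') := by
      rw [← Complex.cpow_add _ _ (by exact_mod_cast ht0.ne')]
      congr 1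
      ring
    have e2 : e ρ ρ' = Complex.exp (Real.pi / 2 * Complex.I * (ρ - s)) *
        Complex.exp (-(Real.pi / 2 * Complex.I * (ρ' - s))) := by
      rw [← Complex.exp_add]
      simp only [he]
      congr 1
      ring
    rw [e1, e2, twistedGamma, smul_eq_mul]
    ring
  have hint : (∫ t in Set.Ioi (0 : ℝ), ((sieveFourier E lam t * ‖zeroSum s R t‖ ^ 2 : ℝ) : ℂ)) =
      Real.pi * ∑ ρ ∈ Z, ∑ ρ' ∈ Z, c ρ ρ' * e ρ ρ' := by
    have hpi : (Real.pi : ℂ) ≠ 0 := by exact_mod_cast Real.pi_ne_zero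
    have hconv : ∀ ρ ∈ Z, ∀ ρ' ∈ Z, MeasureTheory.IntegrableOn (fun t : ℝ =>
        (zetaMult ρ : ℂ) * (zetaMult ρ' : ℂ) * (Complex.Gamma (ρ - s) *
        Complex.Gamma (ρ' - s)) * e ρ ρ' *
        ((t : ℂ) ^ (1 - (ρ + ρ' - 2 * s) - 1) • (sieveFourier E lam t : ℂ))) (Set.Ioi 0) :=
      fun ρ hρ ρ' hρ' => MeasureTheory.Integrable.const_mul
        (hM ρ (mem_zetaZerosBelow.1 hρ).1 ρ' (mem_zetaZerosBelow.1 hρ').1) _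
    rw [MeasureTheory.setIntegral_congr_fun measurableSet_Ioi hexp,
      MeasureTheory.integral_finsetSum _ fun ρ hρ =>
        MeasureTheory.integrable_finsetSum _ fun ρ' hρ' => hconv ρ hρ ρ' hρ', Finset.mul_sum]
    refine Finset.sum_congr rfl fun ρ hρ => ?_
    rw [MeasureTheory.integral_finsetSum _ fun ρ' hρ' => hconv ρ hρ ρ' hρ', Finset.mul_sum]
    refine Finset.sum_congr rfl fun ρ' hρ' => ?_
    rw [MeasureTheory.integral_const_mul]
    simp only [hc]
    rw [sieveMellin, mellin]
    field_simp
  have hsymm : ∑ ρ ∈ Z, ∑ ρ' ∈ Z, c ρ ρ' * e ρ ρ' = ∑ ρ ∈ Z, ∑ ρ' ∈ Z, c ρ ρ' * e ρ' ρ := by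
    rw [Finset.sum_comm]
    exact Finset.sum_congr rfl fun ρ _ => Finset.sum_congr rfl fun ρ' _ => by rw [hcsymm]
  have hcos : sigmaTwoPartial E lam s R = ∑ ρ ∈ Z, ∑ ρ' ∈ Z, c ρ ρ' * e ρ ρ' := by
    have h2 : 2 * sigmaTwoPartial E lam s R = 2 * ∑ ρ ∈ Z, ∑ ρ' ∈ Z, c ρ ρ' * e ρ ρ' := by
      rw [two_mul (∑ ρ ∈ Z, _)]
      nth_rewrite 2 [hsymm]
      rw [← Finset.sum_add_distrib, sigmaTwoPartial, Finset.mul_sum]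
      refine Finset.sum_congr rfl fun ρ _ => ?_
      rw [← Finset.sum_add_distrib, Finset.mul_sum]
      refine Finset.sum_congr rfl fun ρ' _ => ?_
      rw [sigmaTwoTerm, Complex.cos]
      have e3 : e ρ' ρ = Complex.exp (-(Real.pi * (ρ - ρ') / 2) * Complex.I) := by
        simp only [he]
        congr 1
        ring
      rw [e3]
      simp only [hc, he]
      ring
    exact mul_left_cancel₀ two_ne_zero h2
  rw [hcos, Complex.ofReal_mul, ← integral_complex_ofReal, hint]
  have hpi : (Real.pi : ℂ) ≠ 0 := by exact_mod_cast Real.pi_ne_zero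
  push_cast
  field_simp

/-- Convergence in the weighted `L²` space implies convergence of mean squares with respect to any
non-negative weight that is bounded by a multiple of `(1 + t)⁻³`. -/
theorem L2Converges.exists_tendsto_integral {F : ℝ → ℝ → ℂ} (hF : L2Converges F)
    (hFm : ∀ R, MeasureTheory.MemLp (F R) 2 weightMeasure) (hF' : ∀ R, Measurable (F R))
    {w : ℝ → ℝ} (hw : Measurable w) (hw0 : ∀ t, 0 ≤ w t) {C : ℝ}
    (hwC : ∀ t, 0 < t → w t ≤ C / (1 + t) ^ 3) :
    ∃ L : ℝ, 0 ≤ L ∧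
      Tendsto (fun R => ∫ t in Set.Ioi (0 : ℝ), w t * ‖F R t‖ ^ 2) atTop (𝓝 L) := by
  obtain ⟨-, g, hg, hgt⟩ := hF
  set μ : MeasureTheory.Measure ℝ := (MeasureTheory.volume.restrict (Set.Ioi 0)).withDensity
    fun t => ENNReal.ofReal (w t) with hμ
  have hC0 : 0 ≤ C := by
    have h1 := (hw0 1).trans (hwC 1 one_pos)
    norm_num at h1
    linarith
  have hle : μ ≤ ENNReal.ofReal C • weightMeasure := by
    rw [hμ, weightMeasure, ← MeasureTheory.withDensity_smul _ measurable_weight]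
    refine MeasureTheory.withDensity_mono ?_
    filter_upwards [MeasureTheory.ae_restrict_mem measurableSet_Ioi] with t ht
    rw [Pi.smul_apply, smul_eq_mul, ← ENNReal.ofReal_mul hC0, mul_one_div]
    exact ENNReal.ofReal_le_ofReal (hwC t ht)
  have hL : ∀ f : ℝ → ℂ, MeasureTheory.MemLp f 2 weightMeasure → MeasureTheory.MemLp f 2 μ :=
    fun f hf => hf.of_measure_le_smul ENNReal.ofReal_ne_top hle
  have hconv : Tendsto (fun R => MeasureTheory.eLpNorm (F R - g) 2 μ) atTop (𝓝 0) := by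
    have h1 := ENNReal.Tendsto.const_mul (a := ENNReal.ofReal C ^ (1 / 2 : ℝ)) hgt
      (Or.inr (ENNReal.rpow_ne_top_of_nonneg (by norm_num) ENNReal.ofReal_ne_top))
    rw [mul_zero] at h1
    refine tendsto_of_tendsto_of_tendsto_of_le_of_le tendsto_const_nhds h1 (fun _ => zero_le)
      fun R => (MeasureTheory.eLpNorm_mono_measure _ hle).trans (le_of_eq ?_)
    rw [MeasureTheory.eLpNorm_smul_measure_of_ne_top (by norm_num), smul_eq_mul]
    norm_num
  have hnorm := ((MeasureTheory.Lp.tendsto_Lp_iff_tendsto_eLpNorm'' F (fun R => hL _ (hFm R)) g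
    (hL g hg)).2 hconv).norm
  simp only [MeasureTheory.Lp.norm_toLp] at hnorm
  refine ⟨(MeasureTheory.eLpNorm g 2 μ).toReal ^ 2, by positivity, (hnorm.pow 2).congr fun R => ?_⟩
  rw [← ENNReal.toReal_pow, eLpNorm_two_sq, hμ,
    MeasureTheory.lintegral_withDensity_eq_lintegral_mul _ (by fun_prop)
      ((hF' R).enorm.pow_const 2),
    MeasureTheory.integral_eq_lintegral_of_nonneg_ae]
  · congr 2 with t
    rw [Pi.mul_apply, ENNReal.ofReal_mul (hw0 t), ← ofReal_norm, ENNReal.ofReal_pow (norm_nonneg _)]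
  · exact Eventually.of_forall fun t => mul_nonneg (hw0 t) (by positivity)
  · have := hF' R
    exact Measurable.aestronglyMeasurable (by fun_prop)

/-! ### Fourier transforms of sieving functions -/

theorem integrable_mul_of_hasCompactSupport {f g : ℝ → ℝ} (hf : Continuous f)
    (hs : HasCompactSupport f) (hg : Continuous g) : MeasureTheory.Integrable fun x => f x * g x :=
  (hf.mul hg).integrable_of_hasCompactSupport hs.mul_right

/-- Two integrations by parts in a cosine transform. -/
theorem integral_mul_cos_eq {f : ℝ → ℝ} (hf : ContDiff ℝ 2 f) (hs : HasCompactSupport f) {t : ℝ}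
    (ht : t ≠ 0) : ∫ x, f x * Real.cos (t * x) =
      -(1 / t ^ 2) * ∫ x, deriv (deriv f) x * Real.cos (t * x) := by
  have hf1 : ContDiff ℝ 1 (deriv f) := ContDiff.deriv' (n := 1) (by exact_mod_cast hf)
  have hf2 : Continuous (deriv (deriv f)) := hf1.continuous_deriv le_rfl
  have hs1 := hs.deriv
  have hs2 := hs1.deriv
  have hsin : ∀ x : ℝ, HasDerivAt (fun x => Real.sin (t * x) / t) (Real.cos (t * x)) x := by
    intro x
    have h := (((hasDerivAt_id x).const_mul t).sin).div_const t
    refine h.congr_deriv ?_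
    simp only [id, mul_one]
    field_simp
  have hcos : ∀ x : ℝ, HasDerivAt (fun x => -Real.cos (t * x) / t) (Real.sin (t * x)) x := by
    intro x
    have h := ((((hasDerivAt_id x).const_mul t).cos).fun_neg).div_const t
    refine h.congr_deriv ?_
    simp only [id, mul_one]
    field_simp
  have h1 := MeasureTheory.integral_mul_deriv_eq_deriv_mul_of_integrable
    (u := f) (v := fun x => Real.sin (t * x) / t)
    (fun x _ => ((hf.differentiable (by norm_num)) x).hasDerivAt) (fun x _ => hsin x)
    (integrable_mul_of_hasCompactSupport hf.continuous hs (by fun_prop))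
    (integrable_mul_of_hasCompactSupport hf1.continuous hs1 (by fun_prop))
    (integrable_mul_of_hasCompactSupport hf.continuous hs (by fun_prop))
  have h2 := MeasureTheory.integral_mul_deriv_eq_deriv_mul_of_integrable
    (u := deriv f) (v := fun x => -Real.cos (t * x) / t)
    (fun x _ => ((hf1.differentiable (by norm_num)) x).hasDerivAt) (fun x _ => hcos x)
    (integrable_mul_of_hasCompactSupport hf1.continuous hs1 (by fun_prop))
    (integrable_mul_of_hasCompactSupport hf2 hs2 (by fun_prop))
    (integrable_mul_of_hasCompactSupport hf1.continuous hs1 (by fun_prop))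
  have e1 : ∀ x, deriv f x * (Real.sin (t * x) / t) = (1 / t) * (deriv f x * Real.sin (t * x)) :=
    fun x => by ring
  have e2 : ∀ x, deriv (deriv f) x * (-Real.cos (t * x) / t) =
    -(1 / t) * (deriv (deriv f) x * Real.cos (t * x)) := fun x => by ring
  simp_rw [e1] at h1
  simp_rw [e2] at h2
  rw [h1, MeasureTheory.integral_const_mul, h2, MeasureTheory.integral_const_mul]
  ring

/-- The cosine transform of a compactly supported `C²` function with Lipschitz second derivative
has cubic decay: after two integrations by parts, compare the integral with its translate by half a
period. -/
theorem exists_abs_integral_mul_cos_le {f : ℝ → ℝ} (hf : ContDiff ℝ 2 f) (hs : HasCompactSupport f)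
    {K : ℝ} (hK : ∀ x y, |deriv (deriv f) y - deriv (deriv f) x| ≤ K * |y - x|) :
    ∃ C, ∀ t, 0 < t → |∫ x, f x * Real.cos (t * x)| ≤ C / (1 + t) ^ 3 := by
  have hf2 : Continuous (deriv (deriv f)) := (ContDiff.deriv' (n := 1) (by exact_mod_cast hf)).continuous_deriv le_rfl
  have hs2 := hs.deriv.deriv
  have hK0 : 0 ≤ K := by
    have := (abs_nonneg _).trans (hK 0 1)
    simpa using this
  obtain ⟨r, hr⟩ : ∃ r : ℝ, ∀ x, r < |x| → deriv (deriv f) x = 0 := by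
    obtain ⟨r, hr⟩ := hs2.isBounded.subset_closedBall 0
    refine ⟨r, fun x hx => image_eq_zero_of_notMem_tsupport fun h => ?_⟩
    have := hr h
    rw [mem_closedBall_zero_iff, Real.norm_eq_abs] at this
    linarith
  set I := ∫ x, |f x| with hI
  have hI0 : 0 ≤ I := MeasureTheory.integral_nonneg fun _ => abs_nonneg _
  set r' := |r| + Real.pi with hr'
  have hr'0 : 0 ≤ r' := by have := Real.pi_pos; positivity
  refine ⟨8 * (I + K * Real.pi * r'), fun t ht => ?_⟩
  have hA : 0 ≤ K * Real.pi * r' := by have := Real.pi_pos; positivity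
  rcases le_or_gt t 1 with h1 | h1
  · have h2 : |∫ x, f x * Real.cos (t * x)| ≤ I := by
      refine (MeasureTheory.abs_integral_le_integral_abs).trans ?_
      refine MeasureTheory.integral_mono
        (integrable_mul_of_hasCompactSupport hf.continuous hs (by fun_prop)).abs
        (hf.continuous.integrable_of_hasCompactSupport hs).abs fun x => ?_
      simp only [abs_mul]
      exact mul_le_of_le_one_right (abs_nonneg _) (Real.abs_cos_le_one _)
    refine h2.trans ?_
    rw [le_div_iff₀ (by positivity)]
    have h3 : (1 + t) ^ 3 ≤ 2 ^ 3 := by gcongr; linarith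
    nlinarith
  · set h := Real.pi / t with hh
    have hh0 : 0 < h := by have := Real.pi_pos; positivity
    have hhpi : h ≤ Real.pi := div_le_self Real.pi_pos.le h1.le
    set Q := ∫ x, deriv (deriv f) x * Real.cos (t * x) with hQ
    have hi : MeasureTheory.Integrable fun x => deriv (deriv f) x * Real.cos (t * x) :=
      integrable_mul_of_hasCompactSupport hf2 hs2 (by fun_prop)
    have hcos : ∀ x, Real.cos (t * (x + h)) = -Real.cos (t * x) := fun x => by
      rw [mul_add, hh, mul_div_cancel₀ _ ht.ne', Real.cos_add_pi]
    have hi' : MeasureTheory.Integrable fun x => deriv (deriv f) (x + h) * Real.cos (t * x) := by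
      have := (hi.comp_add_right h).neg
      refine this.congr (Eventually.of_forall fun x => ?_)
      simp only [Pi.neg_apply, hcos]
      ring
    have hshift : Q = -∫ x, deriv (deriv f) (x + h) * Real.cos (t * x) := by
      rw [hQ, ← MeasureTheory.integral_add_right_eq_self _ h, ← MeasureTheory.integral_neg]
      congr 1 with x
      rw [hcos]
      ring
    have h2Q : 2 * Q = ∫ x, (deriv (deriv f) x - deriv (deriv f) (x + h)) * Real.cos (t * x) := by
      simp_rw [sub_mul]
      rw [MeasureTheory.integral_sub hi hi']
      linarith
    have hb : |2 * Q| ≤ K * h * (2 * r') := by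
      have hsupp : ∀ x, x ∉ Set.Icc (-r') r' →
          (deriv (deriv f) x - deriv (deriv f) (x + h)) * Real.cos (t * x) = 0 := by
        intro x hx
        have hx' : r' < |x| := by
          by_contra! hc
          exact hx (abs_le.1 hc)
        have h3 : |x| ≤ |x + h| + h := by
          have := abs_sub (x + h) h
          rw [add_sub_cancel_right, abs_of_pos hh0] at this
          exact this
        rw [hr x (by linarith [le_abs_self r, Real.pi_pos]), hr (x + h) (by linarith [le_abs_self r])]
        simp
      rw [h2Q, ← MeasureTheory.setIntegral_eq_integral_of_forall_compl_eq_zero hsupp,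
        ← Real.norm_eq_abs]
      refine (MeasureTheory.norm_setIntegral_le_of_norm_le_const (C := K * h)
        (by simp) fun x _ => ?_).trans (le_of_eq ?_)
      · rw [norm_mul, Real.norm_eq_abs, Real.norm_eq_abs]
        refine (mul_le_of_le_one_right (abs_nonneg _) (Real.abs_cos_le_one _)).trans ?_
        have := hK (x + h) x
        rwa [sub_add_cancel_left, abs_neg, abs_of_pos hh0] at this
      · rw [MeasureTheory.measureReal_def, Real.volume_Icc, ENNReal.toReal_ofReal (by linarith)]
        ring
    rw [integral_mul_cos_eq hf hs ht.ne', abs_mul, abs_neg, abs_of_pos (by positivity)]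
    have hQb : |Q| ≤ K * Real.pi * r' / t := by
      rw [abs_mul, abs_two] at hb
      calc |Q| ≤ K * h * r' := by linarith
        _ = _ := by rw [hh]; ring
    calc 1 / t ^ 2 * |Q| ≤ 1 / t ^ 2 * (K * Real.pi * r' / t) := by gcongr
      _ = 8 * (K * Real.pi * r') / (2 * t) ^ 3 := by field_simp; norm_num
      _ ≤ 8 * (I + K * Real.pi * r') / (1 + t) ^ 3 := by
        gcongr
        · linarith
        · linarith

theorem BoundedVariationOn.exists_abs_le {g : ℝ → ℝ} (hg : BoundedVariationOn g Set.univ) :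
    ∃ G, ∀ x, |g x| ≤ G := by
  refine ⟨|g 0| + (eVariationOn g Set.univ).toReal, fun x => ?_⟩
  have h := hg.dist_le (Set.mem_univ x) (Set.mem_univ 0)
  rw [Real.dist_eq] at h
  have := abs_add_le (g 0) (g x - g 0)
  rw [add_sub_cancel] at this
  linarith

theorem sieveFourier_eq_scale (E : ℝ → ℝ) {lam : ℝ} (h : 0 < lam) (t : ℝ) :
    sieveFourier E lam t = lam * ∫ x, E x * Real.cos (lam * t * x) := by
  have e := MeasureTheory.Measure.integral_comp_div (fun x => E x * Real.cos (lam * t * x)) lam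
  rw [abs_of_pos h, smul_eq_mul] at e
  rw [← e, sieveFourier]
  congr 1 with x
  congr 2
  field_simp

theorem IsSmoothSievingFunction.hasCompactSupport {E : ℝ → ℝ} (hE : IsSmoothSievingFunction E) :
    HasCompactSupport E := by
  rw [HasCompactSupport, hE.support_eq]
  exact isCompact_Icc

theorem IsSmoothSievingFunction.exists_abs_sieveFourier_le {E : ℝ → ℝ}
    (hE : IsSmoothSievingFunction E) {lam : ℝ} (hlam : 0 < lam) :
    ∃ C, ∀ t, 0 < t → |sieveFourier E lam t| ≤ C / (1 + t) ^ 3 := by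
  obtain ⟨g, hg, hgi⟩ := hE.third_deriv_bv
  obtain ⟨G, hG⟩ := hg.exists_abs_le
  obtain ⟨C, hC⟩ := exists_abs_integral_mul_cos_le hE.contDiff hE.hasCompactSupport (K := G)
    fun x y => by
      have := hgi x y
      rw [iteratedDeriv_succ, iteratedDeriv_one] at this
      rw [this]
      exact intervalIntegral.norm_integral_le_of_norm_le_const (f := g) fun x _ => hG x
  have hC0 : 0 ≤ C := by
    have := (abs_nonneg _).trans (hC 1 one_pos)
    norm_num at this
    linarith
  set m := min 1 lam with hm
  have hm0 : 0 < m := lt_min one_pos hlam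
  refine ⟨lam * (C / m ^ 3), fun t ht => ?_⟩
  have h1 := hC (lam * t) (by positivity)
  rw [sieveFourier_eq_scale E hlam, abs_mul, abs_of_pos hlam]
  calc _ ≤ lam * (C / (1 + lam * t) ^ 3) := by gcongr
    _ ≤ lam * (C / (m * (1 + t)) ^ 3) := by
      gcongr
      nlinarith [min_le_left 1 lam, min_le_right 1 lam]
    _ = _ := by rw [mul_pow]; field_simp

theorem IsSmoothSievingFunction.measurable_sieveFourier {E : ℝ → ℝ}
    (hE : IsSmoothSievingFunction E) (lam : ℝ) : Measurable (sieveFourier E lam) := by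
  have hc := hE.contDiff.continuous
  have h : Continuous fun p : ℝ × ℝ => E (p.2 / lam) * Real.cos (p.1 * p.2) := by fun_prop
  exact (h.stronglyMeasurable.integral_prod_right' (ν := MeasureTheory.volume)).measurable

/-- The Mellin transform of the Fourier transform of a sieving function converges absolutely. -/
theorem IsSmoothSievingFunction.mellinConvergent {E : ℝ → ℝ} (hE : IsSmoothSievingFunction E)
    {lam : ℝ} (hlam : 0 < lam) {z : ℂ} (h0 : 0 < z.re) (h3 : z.re < 3) :
    MellinConvergent (fun t : ℝ => (sieveFourier E lam t : ℂ)) z := by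
  obtain ⟨C, hC⟩ := hE.exists_abs_sieveFourier_le hlam
  have hm := hE.measurable_sieveFourier lam
  have hi := (integrableOn_rpow_mul_weight (α := z.re - 1) (by linarith) (by linarith)).const_mul C
  refine MeasureTheory.Integrable.mono' hi (Measurable.aestronglyMeasurable (by fun_prop)) ?_
  filter_upwards [MeasureTheory.ae_restrict_mem measurableSet_Ioi] with t ht
  have ht0 : 0 < t := ht
  rw [norm_smul, Complex.norm_real, Real.norm_eq_abs, Complex.norm_cpow_eq_rpow_re_of_pos ht0,
    Complex.sub_re, Complex.one_re]
  calc _ ≤ t ^ (z.re - 1) * (C / (1 + t) ^ 3) := by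
        gcongr
        exact hC t ht0
    _ = _ := by ring

/-- The double sum exists and is non-negative for every sieving function with non-negative Fourier
transform, being a limit of weighted mean squares. -/
theorem exists_hasSigmaTwo {E : ℝ → ℝ} (hE : IsSmoothSievingFunction E) {lam : ℝ} (hlam : 0 < lam)
    (h0 : ∀ t : ℝ, 0 ≤ sieveFourier E lam t) {s : ℝ} (hs : 1 / 2 < s) (hs1 : s < 1) :
    (∀ ρ ∈ complexZetaZeros, ∀ ρ' ∈ complexZetaZeros,
      MellinConvergent (fun t : ℝ => (sieveFourier E lam t : ℂ)) (1 - (ρ + ρ' - 2 * s))) ∧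
    ∃ L : ℝ, HasSigmaTwo E lam s (L : ℂ) ∧ 0 ≤ L := by
  have hM : ∀ ρ ∈ complexZetaZeros, ∀ ρ' ∈ complexZetaZeros,
      MellinConvergent (fun t : ℝ => (sieveFourier E lam t : ℂ)) (1 - (ρ + ρ' - 2 * s)) := by
    intro ρ hρ ρ' hρ'
    have h1 := complexZetaZeros_re_mem hρ
    have h2 := complexZetaZeros_re_mem hρ'
    have e : (1 - (ρ + ρ' - 2 * s) : ℂ).re = 1 - (ρ.re + ρ'.re - 2 * s) := by simp
    refine hE.mellinConvergent hlam ?_ ?_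
    · rw [e]; linarith [h1.2, h2.2]
    · rw [e]; linarith [h1.1, h2.1]
  refine ⟨hM, ?_⟩
  obtain ⟨C, hC⟩ := hE.exists_abs_sieveFourier_le hlam
  obtain ⟨L, hL0, hL⟩ := (l2Converges_zeroSum hs hs1).exists_tendsto_integral
    (memLp_zeroSum hs hs1) (measurable_zeroSum s) (hE.measurable_sieveFourier lam) h0
    fun t ht => (le_abs_self _).trans (hC t ht)
  refine ⟨1 / Real.pi * L, ?_, by have := Real.pi_pos; positivity⟩
  refine ((Complex.continuous_ofReal.tendsto _).comp (hL.const_mul (1 / Real.pi))).congr fun R => ?_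
  exact (sigmaTwoPartial_eq_integral hM R).symm

/-! ### The Jackson function -/

theorem BoundedVariationOn.sub_real {f g : ℝ → ℝ} {S : Set ℝ} (hf : BoundedVariationOn f S)
    (hg : BoundedVariationOn g S) : BoundedVariationOn (fun x => f x - g x) S := by
  refine ne_top_of_le_ne_top (ENNReal.add_ne_top.2 ⟨hf, hg⟩) (iSup_le fun p => ?_)
  calc _ ≤ ∑ i ∈ Finset.range p.1, (edist (f (p.2.1 (i + 1))) (f (p.2.1 i)) +
        edist (g (p.2.1 (i + 1))) (g (p.2.1 i))) := Finset.sum_le_sum fun i _ => by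
        simp only [edist_eq_enorm_sub]
        rw [sub_sub_sub_comm]
        exact enorm_sub_le
    _ ≤ _ := by
        rw [Finset.sum_add_distrib]
        exact add_le_add (eVariationOn.sum_le p.2.2.1 p.2.2.2)
          (eVariationOn.sum_le p.2.2.1 p.2.2.2)

/-- The fourth central difference with step `1 / 2`. -/
noncomputable def fourthDiff (φ : ℝ → ℝ) (x : ℝ) : ℝ :=
  φ (x + 1) - 4 * φ (x + 1 / 2) + 6 * φ x - 4 * φ (x - 1 / 2) + φ (x - 1)

theorem HasDerivAt.fourthDiff {φ φ' : ℝ → ℝ} (h : ∀ x, HasDerivAt φ (φ' x) x) (x : ℝ) :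
    HasDerivAt (fourthDiff φ) (fourthDiff φ' x) x :=
  (((((h (x + 1)).comp_add_const x 1).fun_sub (((h (x + 1 / 2)).comp_add_const x (1 / 2)).const_mul
    4)).fun_add ((h x).const_mul 6)).fun_sub
    (((h (x - 1 / 2)).comp_sub_const x (1 / 2)).const_mul 4)).fun_add
    ((h (x - 1)).comp_sub_const x 1)

theorem Continuous.fourthDiff {φ : ℝ → ℝ} (h : Continuous φ) : Continuous (fourthDiff φ) := by
  unfold _root_.fourthDiff
  fun_prop

theorem hasDerivAt_max_zero_pow (n : ℕ) (x : ℝ) :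
    HasDerivAt (fun y : ℝ => max y 0 ^ (n + 2)) ((n + 2 : ℕ) * max x 0 ^ (n + 1)) x := by
  have hne : ∀ y : ℝ, y ≠ 0 →
      HasDerivAt (fun y : ℝ => max y 0 ^ (n + 2)) ((n + 2 : ℕ) * max y 0 ^ (n + 1)) y := by
    intro y hy
    rcases lt_or_gt_of_ne hy with h | h
    · rw [max_eq_right h.le, zero_pow (by omega), mul_zero]
      refine (hasDerivAt_const y (0 : ℝ)).congr_of_eventuallyEq ?_
      filter_upwards [eventually_lt_nhds h] with z hz
      rw [max_eq_right hz.le, zero_pow (by omega)]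
    · rw [max_eq_left h.le]
      refine (hasDerivAt_pow (n + 2) y).congr_of_eventuallyEq ?_
      filter_upwards [eventually_gt_nhds h] with z hz
      rw [max_eq_left hz.le]
  exact hasDerivAt_of_hasDerivAt_of_ne' (f := fun y : ℝ => max y 0 ^ (n + 2))
    (g := fun y : ℝ => (n + 2 : ℕ) * max y 0 ^ (n + 1)) hne
    (Continuous.continuousAt (by fun_prop)) (Continuous.continuousAt (by fun_prop)) x

/-- The Jackson function is a cubic B-spline: a fourth difference of truncated cubes. -/
theorem jacksonE_eq_fourthDiff (x : ℝ) : jacksonE x = 2 * fourthDiff (fun y => max y 0 ^ 3) x := by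
  rw [jacksonE, fourthDiff]
  have hl : ∀ y : ℝ, 0 ≤ y → max y 0 = y := fun y h => max_eq_left h
  have hr : ∀ y : ℝ, y ≤ 0 → max y 0 = 0 := fun y h => max_eq_right h
  rcases le_total 0 x with h0 | h0
  · rw [abs_of_nonneg h0, hl (x + 1) (by linarith), hl (x + 1 / 2) (by linarith), hl x h0]
    split_ifs with h1 h2
    · rw [hr (x - 1 / 2) (by linarith), hr (x - 1) (by linarith)]; ring
    · rw [hl (x - 1 / 2) (by linarith), hr (x - 1) (by linarith)]; ring
    · rw [hl (x - 1 / 2) (by linarith), hl (x - 1) (by linarith)]; ring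
  · rw [abs_of_nonpos h0, hr (x - 1) (by linarith), hr (x - 1 / 2) (by linarith), hr x h0]
    split_ifs with h1 h2
    · rw [hl (x + 1 / 2) (by linarith), hl (x + 1) (by linarith)]; ring
    · rw [hr (x + 1 / 2) (by linarith), hl (x + 1) (by linarith)]; ring
    · rw [hr (x + 1 / 2) (by linarith), hr (x + 1) (by linarith)]; ring

theorem hasDerivAt_jacksonE (x : ℝ) :
    HasDerivAt jacksonE (6 * fourthDiff (fun y => max y 0 ^ 2) x) x := by
  have h := (HasDerivAt.fourthDiff (fun x => hasDerivAt_max_zero_pow 1 x) x).const_mul 2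
  rw [show jacksonE = fun x => 2 * fourthDiff (fun y => max y 0 ^ 3) x from
    funext jacksonE_eq_fourthDiff]
  refine h.congr_deriv ?_
  simp only [fourthDiff]
  push_cast
  ring

theorem hasDerivAt_deriv_jacksonE (x : ℝ) :
    HasDerivAt (deriv jacksonE) (12 * fourthDiff (fun y => max y 0) x) x := by
  have h := (HasDerivAt.fourthDiff (fun x => hasDerivAt_max_zero_pow 0 x) x).const_mul 6
  rw [show deriv jacksonE = fun x => 6 * fourthDiff (fun y => max y 0 ^ 2) x from
    funext fun x => (hasDerivAt_jacksonE x).deriv]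
  refine h.congr_deriv ?_
  simp only [fourthDiff]
  push_cast
  ring

theorem deriv_deriv_jacksonE :
    deriv (deriv jacksonE) = fun x => 12 * fourthDiff (fun y => max y 0) x :=
  funext fun x => (hasDerivAt_deriv_jacksonE x).deriv

theorem contDiff_jacksonE : ContDiff ℝ 2 jacksonE := by
  have h1 : ContDiff ℝ 1 (deriv jacksonE) := contDiff_one_iff_deriv.2
    ⟨fun x => (hasDerivAt_deriv_jacksonE x).differentiableAt, by
      rw [deriv_deriv_jacksonE]
      exact (Continuous.fourthDiff (by fun_prop)).const_mul 12⟩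
  have h2 := (contDiff_succ_iff_deriv (n := 1)).2
    ⟨fun x => (hasDerivAt_jacksonE x).differentiableAt, fun h => absurd h (by norm_num), h1⟩
  exact_mod_cast h2

theorem support_jacksonE : Function.support jacksonE = Set.Ioo (-1) 1 := by
  ext x
  rw [Function.mem_support, Set.mem_Ioo, ← abs_lt, jacksonE]
  constructor
  · intro h
    by_contra! hx
    refine h ?_
    rw [if_neg (by linarith)]
    split_ifs with h1
    · rw [le_antisymm h1 hx]; norm_num
    · rfl
  · intro h
    have h0 := abs_nonneg x
    rw [if_pos h.le]
    refine ne_of_gt ?_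
    split_ifs with h1
    · have : x ^ 2 = |x| ^ 2 := (sq_abs x).symm
      nlinarith [mul_nonneg h0 h0, mul_nonneg (mul_nonneg h0 h0) h0]
    · have : 0 < 1 - |x| := by linarith
      positivity

theorem tsupport_jacksonE : tsupport jacksonE = Set.Icc (-1) 1 := by
  rw [tsupport, support_jacksonE, closure_Ioo (by norm_num)]

theorem hasCompactSupport_jacksonE : HasCompactSupport jacksonE := by
  rw [HasCompactSupport, tsupport_jacksonE]
  exact isCompact_Icc

theorem jacksonE_nonneg (x : ℝ) : 0 ≤ jacksonE x := by
  have h0 := abs_nonneg x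
  rw [jacksonE]
  split_ifs with h1 h2
  · have : x ^ 2 = |x| ^ 2 := (sq_abs x).symm
    nlinarith [mul_nonneg h0 h0, mul_nonneg (mul_nonneg h0 h0) h0]
  · have : 0 ≤ 1 - |x| := by linarith
    positivity
  · rfl

theorem antitoneOn_jacksonE : AntitoneOn jacksonE (Set.Ici 0) := by
  intro x hx y hy hxy
  have hx0 : 0 ≤ x := hx
  have hy0 : 0 ≤ y := hy
  have hlow : ∀ a b : ℝ, 0 ≤ a → a ≤ b → b ≤ 1 / 2 →
      1 - 6 * b ^ 2 + 6 * b ^ 3 ≤ 1 - 6 * a ^ 2 + 6 * a ^ 3 := by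
    intro a b h1 h2 h3
    have e : 1 - 6 * a ^ 2 + 6 * a ^ 3 - (1 - 6 * b ^ 2 + 6 * b ^ 3) =
      6 * ((b - a) * (a * (1 - a - b) + b * (1 - b))) := by ring
    have h4 : 0 ≤ (b - a) * (a * (1 - a - b) + b * (1 - b)) :=
      mul_nonneg (by linarith) (add_nonneg (mul_nonneg h1 (by linarith))
        (mul_nonneg (by linarith) (by linarith)))
    linarith
  rcases lt_or_ge 1 y with h | h
  · have : jacksonE y = 0 := by
      rw [jacksonE, abs_of_nonneg hy0, if_neg (by linarith), if_neg (by linarith)]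
    rw [this]
    exact jacksonE_nonneg x
  rw [jacksonE, jacksonE, abs_of_nonneg hx0, abs_of_nonneg hy0, if_pos h, if_pos (hxy.trans h)]
  have hcube : ∀ a b : ℝ, a ≤ b → b ≤ 1 → 2 * (1 - b) ^ 3 ≤ 2 * (1 - a) ^ 3 := by
    intro a b h1 h2
    have : 0 ≤ 1 - b := by linarith
    gcongr
  split_ifs with h1 h2 h2
  · exact hlow x y hx0 hxy h1
  · linarith
  · have h3 := hlow x (1 / 2) hx0 h2 le_rfl
    have h4 := hcube (1 / 2) y (by linarith) h
    norm_num at h3 h4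
    linarith
  · exact hcube x y hxy h

theorem integral_step (a x y : ℝ) :
    ∫ t in x..y, (if a ≤ t then 1 else 0 : ℝ) = max (y - a) 0 - max (x - a) 0 := by
  refine intervalIntegral.integral_eq_sub_of_hasDeriv_right (f := fun t => max (t - a) 0)
    (by fun_prop) (fun t _ => ?_) (Monotone.intervalIntegrable fun t u htu => ?_)
  · split_ifs with h
    · refine (((hasDerivAt_id t).sub_const a).hasDerivWithinAt).congr (fun u hu => ?_) ?_
      · have : t < u := hu
        simp only [id]
        rw [max_eq_left (by linarith)]
      · simp only [id]
        rw [max_eq_left (by linarith)]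
    · refine ((hasDerivAt_const t (0 : ℝ)).congr_of_eventuallyEq ?_).hasDerivWithinAt
      filter_upwards [eventually_lt_nhds (not_le.1 h)] with u hu
      rw [max_eq_right (by linarith)]
  · split_ifs with h1 h2 <;> linarith

theorem intervalIntegrable_step (a x y : ℝ) : IntervalIntegrable
    (fun t => if a ≤ t then 1 else 0 : ℝ → ℝ) MeasureTheory.volume x y := by
  refine Monotone.intervalIntegrable fun t u htu => ?_
  split_ifs with h1 h2 <;> linarith

theorem isSmoothSievingFunction_jacksonE : IsSmoothSievingFunction jacksonE where
  even x := by simp only [jacksonE, abs_neg, neg_sq]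
  support_eq := tsupport_jacksonE
  lipschitz := ContDiff.lipschitzWith_of_hasCompactSupport hasCompactSupport_jacksonE
    contDiff_jacksonE (by norm_num)
  antitone := antitoneOn_jacksonE
  apply_zero := by norm_num [jacksonE]
  contDiff := contDiff_jacksonE
  third_deriv_bv := by
    -- `E'''` is a fourth difference of Heaviside functions, here split into monotone parts
    set H : ℝ → ℝ → ℝ := fun a t => if a ≤ t then 1 else 0 with hH
    have hmono : ∀ a, Monotone (H a) := fun a t u htu => by
      simp only [hH]
      split_ifs with h1 h2 <;> linarith
    have h0 : ∀ a t, 0 ≤ H a t := fun a t => by simp only [hH]; split_ifs <;> norm_num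
    have h1 : ∀ a t, H a t ≤ 1 := fun a t => by simp only [hH]; split_ifs <;> norm_num
    refine ⟨fun t => 12 * (H (-1) t + 6 * H 0 t + H 1 t) -
      12 * (4 * H (-(1 / 2)) t + 4 * H (1 / 2) t), BoundedVariationOn.sub_real
        (MonotoneOn.boundedVariationOn (C := 96) (fun t _ u _ htu => ?_) fun t _ => ?_)
        (MonotoneOn.boundedVariationOn (C := 96) (fun t _ u _ htu => ?_) fun t _ => ?_),
        fun x y => ?_⟩
    · linarith [hmono (-1) htu, hmono 0 htu, hmono 1 htu]
    · rw [abs_le]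
      constructor <;> linarith [h0 (-1) t, h0 0 t, h0 1 t, h1 (-1) t, h1 0 t, h1 1 t]
    · linarith [hmono (-(1 / 2)) htu, hmono (1 / 2) htu]
    · rw [abs_le]
      constructor <;> linarith [h0 (-(1 / 2)) t, h0 (1 / 2) t, h1 (-(1 / 2)) t, h1 (1 / 2) t]
    · have i : ∀ a, IntervalIntegrable (H a) MeasureTheory.volume x y :=
        fun a => intervalIntegrable_step a x y
      rw [intervalIntegral.integral_sub ((((i _).add ((i _).const_mul 6)).add (i _)).const_mul 12)
        ((((i _).const_mul 4).add ((i _).const_mul 4)).const_mul 12),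
        intervalIntegral.integral_const_mul, intervalIntegral.integral_const_mul,
        intervalIntegral.integral_add ((i _).add ((i _).const_mul 6)) (i _),
        intervalIntegral.integral_add (i _) ((i _).const_mul 6),
        intervalIntegral.integral_add ((i _).const_mul 4) ((i _).const_mul 4),
        intervalIntegral.integral_const_mul, intervalIntegral.integral_const_mul,
        intervalIntegral.integral_const_mul]
      simp only [hH, integral_step]
      rw [iteratedDeriv_succ, iteratedDeriv_one, deriv_deriv_jacksonE]
      simp only [fourthDiff, sub_neg_eq_add, sub_zero]
      ring

theorem integral_linear_mul_cos (p q a b : ℝ) {t : ℝ} (ht : t ≠ 0) :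
    ∫ x in a..b, (p + q * x) * Real.cos (t * x) =
      ((p + q * b) * Real.sin (t * b) / t + q * Real.cos (t * b) / t ^ 2) -
        ((p + q * a) * Real.sin (t * a) / t + q * Real.cos (t * a) / t ^ 2) := by
  refine intervalIntegral.integral_eq_sub_of_hasDerivAt (f := fun x =>
    (p + q * x) * Real.sin (t * x) / t + q * Real.cos (t * x) / t ^ 2) (fun x _ => ?_)
    (Continuous.intervalIntegrable (by fun_prop) _ _)
  have h1 := (hasDerivAt_id x).const_mul t
  have h2 := ((hasDerivAt_id x).const_mul q).const_add p
  have h3 := ((h2.fun_mul h1.sin).div_const t).fun_add ((h1.cos.const_mul q).div_const (t ^ 2))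
  refine h3.congr_deriv ?_
  simp only [id, mul_one]
  field_simp
  ring

/-- The cosine transform of the Jackson function is a multiple of the Jackson kernel. -/
theorem integral_jacksonE_mul_cos {t : ℝ} (ht : t ≠ 0) :
    ∫ x, jacksonE x * Real.cos (t * x) = 48 * (1 - Real.cos (t / 2)) ^ 2 / t ^ 4 := by
  have hl : ∀ y : ℝ, 0 ≤ y → max y 0 = y := fun y h => max_eq_left h
  have hr : ∀ y : ℝ, y ≤ 0 → max y 0 = 0 := fun y h => max_eq_right h
  set k : ℝ → ℝ := fun x => deriv (deriv jacksonE) x * Real.cos (t * x) with hk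
  have hkc : Continuous k := by
    have h : Continuous (deriv (deriv jacksonE)) := by
      rw [deriv_deriv_jacksonE]
      exact (Continuous.fourthDiff (by fun_prop)).const_mul 12
    simp only [hk]
    fun_prop
  have hsupp : Function.support k ⊆ Set.Ioc (-1) 1 := by
    intro x hx
    by_contra hx'
    refine hx ?_
    simp only [hk, deriv_deriv_jacksonE, fourthDiff]
    rw [Set.mem_Ioc, not_and_or, not_lt, not_le] at hx'
    rcases hx' with h | h
    · rw [hr (x + 1) (by linarith), hr (x + 1 / 2) (by linarith), hr x (by linarith),
        hr (x - 1 / 2) (by linarith), hr (x - 1) (by linarith)]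
      ring
    · rw [hl (x + 1) (by linarith), hl (x + 1 / 2) (by linarith), hl x (by linarith),
        hl (x - 1 / 2) (by linarith), hl (x - 1) (by linarith)]
      ring
  have hi : ∀ a b, IntervalIntegrable k MeasureTheory.volume a b :=
    fun a b => hkc.intervalIntegrable a b
  have hpiece : ∀ a b p q : ℝ, a ≤ b → (∀ x, a ≤ x → x ≤ b →
      12 * fourthDiff (fun y => max y 0) x = p + q * x) → ∫ x in a..b, k x =
      ((p + q * b) * Real.sin (t * b) / t + q * Real.cos (t * b) / t ^ 2) -
        ((p + q * a) * Real.sin (t * a) / t + q * Real.cos (t * a) / t ^ 2) := by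
    intro a b p q hab h
    rw [← integral_linear_mul_cos p q a b ht]
    refine intervalIntegral.integral_congr fun x hx => ?_
    rw [Set.uIcc_of_le hab] at hx
    simp only [hk, deriv_deriv_jacksonE]
    rw [h x hx.1 hx.2]
  have k1 := hpiece (-1) (-(1 / 2)) 12 12 (by norm_num) fun x h1 h2 => by
    simp only [fourthDiff]
    rw [hl (x + 1) (by linarith), hr (x + 1 / 2) (by linarith), hr x (by linarith),
      hr (x - 1 / 2) (by linarith), hr (x - 1) (by linarith)]
    ring
  have k2 := hpiece (-(1 / 2)) 0 (-12) (-36) (by norm_num) fun x h1 h2 => by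
    simp only [fourthDiff]
    rw [hl (x + 1) (by linarith), hl (x + 1 / 2) (by linarith), hr x (by linarith),
      hr (x - 1 / 2) (by linarith), hr (x - 1) (by linarith)]
    ring
  have k3 := hpiece 0 (1 / 2) (-12) 36 (by norm_num) fun x h1 h2 => by
    simp only [fourthDiff]
    rw [hl (x + 1) (by linarith), hl (x + 1 / 2) (by linarith), hl x (by linarith),
      hr (x - 1 / 2) (by linarith), hr (x - 1) (by linarith)]
    ring
  have k4 := hpiece (1 / 2) 1 12 (-12) (by norm_num) fun x h1 h2 => by
    simp only [fourthDiff]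
    rw [hl (x + 1) (by linarith), hl (x + 1 / 2) (by linarith), hl x (by linarith),
      hl (x - 1 / 2) (by linarith), hr (x - 1) (by linarith)]
    ring
  rw [integral_mul_cos_eq contDiff_jacksonE hasCompactSupport_jacksonE ht]
  change -(1 / t ^ 2) * (∫ x, k x) = _
  rw [← intervalIntegral.integral_eq_integral_of_support_subset hsupp,
    ← intervalIntegral.integral_add_adjacent_intervals (hi (-1) (-(1 / 2))) (hi (-(1 / 2)) 1),
    ← intervalIntegral.integral_add_adjacent_intervals (hi (-(1 / 2)) 0) (hi 0 1),
    ← intervalIntegral.integral_add_adjacent_intervals (hi 0 (1 / 2)) (hi (1 / 2) 1), k1, k2, k3, k4]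
  have c1 : Real.cos t = 2 * Real.cos (t / 2) ^ 2 - 1 := by
    rw [← Real.cos_two_mul]
    congr 1
    ring
  simp only [mul_neg, Real.sin_neg, Real.cos_neg, mul_one, mul_zero, Real.sin_zero, Real.cos_zero,
    mul_one_div, c1]
  field_simp
  ring

theorem sieveFourier_jacksonE_nonneg {lam : ℝ} (h : 0 < lam) (t : ℝ) :
    0 ≤ sieveFourier jacksonE lam t := by
  rw [sieveFourier_eq_scale jacksonE h]
  refine mul_nonneg h.le ?_
  rcases eq_or_ne t 0 with rfl | ht
  · refine MeasureTheory.integral_nonneg fun x => ?_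
    simpa using jacksonE_nonneg x
  · rw [integral_jacksonE_mul_cos (by positivity)]
    positivity

theorem proposition3p7 :
    (∀ (E : ℝ → ℝ), IsSmoothSievingFunction E →
      ∀ (lam : ℝ), 0 < lam → (∀ t : ℝ, 0 ≤ sieveFourier E lam t) →
      ∀ (s : ℝ), 1 / 2 < s → s < 1 →
        (∀ ρ ∈ complexZetaZeros, ∀ ρ' ∈ complexZetaZeros,
          MellinConvergent (fun t : ℝ => (sieveFourier E lam t : ℂ)) (1 - (ρ + ρ' - 2 * s))) ∧
        ∃ L : ℝ, HasSigmaTwo E lam s (L : ℂ) ∧ 0 ≤ L) ∧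
    (IsSmoothSievingFunction jacksonE ∧
      ∀ (lam : ℝ), 0 < lam → ∀ t : ℝ, 0 ≤ sieveFourier jacksonE lam t) :=
  ⟨fun _ hE _ hlam h0 _ hs hs1 => exists_hasSigmaTwo hE hlam h0 hs hs1,
    isSmoothSievingFunction_jacksonE, fun _ hlam t => sieveFourier_jacksonE_nonneg hlam t⟩
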